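/- Let $\mathcal E,h,\mu,\omega\in\mathbb R$ with $\mathcal E+h>0$, $\mu>0$, $\omega>0$, and put $$V_I(z)=\mathcal E+h+\frac{\mu}{|z|}\quad(z\in\mathbb R^2\setminus\{0\}),\qquad V_E(z)=\mathcal E-\frac{\omega^2}{2}|z|^2 .$$ For $V\in\{V_I,V_E\}$, a classical solution on $[0,T]$ of $(HS_I)$, respectively $(HS_E)$, is a curve $z:[0,T]\to\mathbb R^2$ (avoiding $0$ for $V_I$) with $z''=\nabla V(z)$ and $\tfrac12|z'|^2-V(z)=0$ on $[0,T]$. An ejection-collision solution of $(HS_I)$ on $[0,T]$ is a continuous curve which vanishes at exactly one instant $c\in(0,T)$ and satisfies $(HS_I)$ on $[0,T]\setminus\{c\}$. Let $C_0>0$ and let $f(\xi;\epsilon)$ be a function of class $C^2$ on $\mathbb R/2\pi\mathbb Z\times[-C_0,C_0]$. Put $\gamma_\epsilon(\xi)=(1+\epsilon f(\xi;\epsilon))e^{i\xi}$ and $D_\epsilon=\{re^{i\xi}:0\le r<1+\epsilon f(\xi;\epsilon)\}$. For a curve $z:[0,T]\to\mathbb R^2\setminus\{0\}$ whose endpoints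 are not on opposite rays from $0$, let $I(z([0,T]),0)=\frac1{2\pi i}\int_\Gamma\frac{d\zeta}{\zeta}$, where $\Gamma$ is the closed curve that follows $z$, then the shortest arc of the circle $|\zeta|=|z(T)|$ from $z(T)$ to the ray through $z(0)$, then this ray up to $z(0)$. Below, $|\xi_0-\xi_1|$ is the distance in $\mathbb R/2\pi\mathbb Z$. **Inner arcs.** There are $\bar\epsilon_I\in(0,C_0]$, $\bar\delta_I\in(0,\pi]$ and $C>0$ such that for all $\epsilon$ with $|\epsilon|<\bar\epsilon_I$ and all $\xi_0,\xi_1$ with $|\xi_0-\xi_1|<\bar\delta_I$ there are a unique $T=T(\xi_0,\xi_1)>0$ and a unique $z(\cdot)=z(\cdot;\xi_0,\xi_1;\epsilon):[0,T]\to\mathbb R^2$ such that $z(0)=\gamma_\epsilon(\xi_0)$, $z(T)=\gamma_\epsilon(\xi_1)$, $z(s)\in D_\epsilon$ for $s\in(0,T)$, and * if $\xi_0\neq\xi_1$, $z$ is a classical solution of $(HS_I)$ with $|I(z([0,T]),0)|=1$; * if $\xi_0=\xi_1$, $z$ is an ejection-collision solution of $(HS_I)$. For each such $\epsilon$ the family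 is of class $C^1$ in $(\xi_0,\xi_1)$, in the following sense: $T(\xi_0,\xi_1)$ is of class $C^1$; $z(s;\xi_0,\xi_1;\epsilon)$ is jointly of class $C^1$ in $(s,\xi_0,\xi_1)$ at all points where $z\ne0$; and in the Levi-Civita time $\tau$, defined along each arc by $ds/d\tau=2|z|$ with $s$ strictly increasing in $\tau$ and $\tau=0$ at $s=0$, the duration of the arc is of class $C^1$ in $(\xi_0,\xi_1)$, and the physical time $s$ and the position $z$ are jointly of class $C^1$ in $(\tau,\xi_0,\xi_1)$, collisions included. Moreover the angles $\beta_0=\angle(\dot\gamma_\epsilon(\xi_0),z'(0))$ and $\beta_1=\angle(\dot\gamma_\epsilon(\xi_1),z'(T))$ satisfy $C<|\beta_j|<\pi-C$ for $j=0,1$. **Outer arcs.** Suppose in addition that $\mathcal E>\omega^2$. There are $\bar\epsilon_E\in(0,C_0]$ and $\bar\delta_E\in(0,\pi]$ such that for all $\epsilon$ with $|\epsilon|<\bar\epsilon_E$ and all $\xi_0,\xi_1$ with $|\xi_0-\xi_1|<\bar\delta_E$ there are $T\in(0,\pi/\omega)$ and $z:[0,T]\to\mathbb R^2$ such that * $z$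 is a classical solution of $(HS_E)$ on $[0,T]$ with $z(0)=\gamma_\epsilon(\xi_0)$, $z(T)=\gamma_\epsilon(\xi_1)$, and it is the only one on this interval $[0,T]$; * $z(s)\notin\overline{D_\epsilon}$ for $s\in(0,T)$; * $(T,z)$ is unique: if $T'\in(0,\pi/\omega)$ and $z'$ is a classical solution of $(HS_E)$ on $[0,T']$ with the same two endpoints and $z'(s)\notin\overline{D_\epsilon}$ for $s\in(0,T')$, then $T'=T$ and $z'=z$. -/

import Mathlib

open Set

noncomputable section

namespace RefractionBilliard

/-! The plane `ℝ²` is identified with `ℂ` (Mathlib's real inner product structure on `ℂ`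
is the Euclidean one), and `ℝ / 2πℤ` is handled through real lifts of angles. -/

/-- The inner (Kepler) potential `V_I(z) = E + h + μ / |z|`, for `z ≠ 0`. -/
def innerPotential (E h μ : ℝ) (z : ℂ) : ℝ := E + h + μ / ‖z‖

/-- The outer (harmonic) potential `V_E(z) = E - (ω² / 2) |z|²`. -/
def outerPotential (E ω : ℝ) (z : ℂ) : ℝ := E - ω ^ 2 / 2 * ‖z‖ ^ 2

/-- The curve `z : [0, T] → ℂ` satisfies at time `s` the equation `z'' = ∇V(z)` together with
the zero energy law `|z'|² / 2 - V(z) = 0`; derivatives are one-sided at the ends of `[0, T]`. -/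
structure HSAt (V : ℂ → ℝ) (T : ℝ) (z : ℝ → ℂ) (s : ℝ) : Prop where
  differentiable : DifferentiableWithinAt ℝ z (Icc 0 T) s
  newton : HasDerivWithinAt (derivWithin z (Icc 0 T)) (gradient V (z s)) (Icc 0 T) s
  energy : 1 / 2 * ‖derivWithin z (Icc 0 T) s‖ ^ 2 - V (z s) = 0

/-- Classical solution on `[0, T]` of the inner problem: it never meets the singularity `0`. -/
def IsInnerClassical (E h μ T : ℝ) (z : ℝ → ℂ) : Prop :=
  ∀ s ∈ Icc 0 T, z s ≠ 0 ∧ HSAt (innerPotential E h μ) T z s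

/-- Ejection-collision solution on `[0, T]` of the inner problem: a continuous curve which
is at the singularity `0` at exactly one instant `c ∈ (0, T)`, and which solves the inner problem
at all other times. -/
def IsEjectionCollision (E h μ T : ℝ) (z : ℝ → ℂ) : Prop :=
  ContinuousOn z (Icc 0 T) ∧
    ∃ c ∈ Ioo 0 T, z c = 0 ∧
      ∀ s ∈ Icc 0 T, s ≠ c → z s ≠ 0 ∧ HSAt (innerPotential E h μ) T z s

/-- Classical solution on `[0, T]` of the outer problem. -/
def IsOuterClassical (E ω T : ℝ) (z : ℝ → ℂ) : Prop :=
  ∀ s ∈ Icc 0 T, HSAt (outerPotential E ω) T z s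

/-- The boundary curve `γ_ε(ξ) = (1 + ε f(ξ; ε)) e^{iξ}`. -/
def boundaryCurve (f : ℝ → ℝ → ℝ) (ε ξ : ℝ) : ℂ :=
  ((1 + ε * f ξ ε : ℝ) : ℂ) * Complex.exp (ξ * Complex.I)

/-- The domain `D_ε` bounded by `γ_ε`: the points `r e^{iξ}` with `0 ≤ r < 1 + ε f(ξ; ε)`. -/
def domain (f : ℝ → ℝ → ℝ) (ε : ℝ) : Set ℂ :=
  {z | ‖z‖ < 1 + ε * f z.arg ε}

/-- `∫ dz / z` along the curve `α` restricted to `[a, b]`. -/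
def logIntegral (α : ℝ → ℂ) (a b : ℝ) : ℂ := ∫ t in a..b, deriv α t / α t

/-- The winding index `I(z([0, T]), 0) = (2πi)⁻¹ ∫_Γ dz / z` of an arc from `p₀ = z(0)` to
`p₁ = z(T)`. The closed curve `Γ` follows the arc, then the shortest arc of the circle centred
at `0` from `p₁` to the point `q` on the ray of `p₀` with `|q| = |p₁|`, then the segment
from `q` to `p₀`. -/
def windingIndex (T : ℝ) (z : ℝ → ℂ) : ℂ :=
  let d : ℝ := (z 0 / z T).arg
  let q : ℂ := z T * Complex.exp (d * Complex.I)
  (2 * Real.pi * Complex.I)⁻¹ *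
    (logIntegral z 0 T
      + logIntegral (fun t : ℝ => z T * Complex.exp ((t * d : ℝ) * Complex.I)) 0 1
      + logIntegral (fun t : ℝ => ((1 - t : ℝ) : ℂ) * q + (t : ℂ) * z 0) 0 1)

/-- `z : [0, T] → ℂ` is an inner arc from `γ_ε(ξ₀)` to `γ_ε(ξ₁)` inside `D_ε`: a classical solution
of winding index `±1` if `ξ₀ ≠ ξ₁`, an ejection-collision solution if `ξ₀ = ξ₁`. -/
structure IsInnerArc (E h μ : ℝ) (f : ℝ → ℝ → ℝ) (ε ξ₀ ξ₁ T : ℝ) (z : ℝ → ℂ) : Prop where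
  pos : 0 < T
  start : z 0 = boundaryCurve f ε ξ₀
  finish : z T = boundaryCurve f ε ξ₁
  inside : ∀ s ∈ Ioo 0 T, z s ∈ domain f ε
  classical : ξ₀ ≠ ξ₁ → IsInnerClassical E h μ T z ∧ ‖windingIndex T z‖ = 1
  ejectionCollision : ξ₀ = ξ₁ → IsEjectionCollision E h μ T z

/-- `z : [0, T] → ℂ` is a classical solution of the outer problem with ends `γ_ε(ξ₀)`, `γ_ε(ξ₁)`. -/
structure IsOuterFixedEnds (E ω : ℝ) (f : ℝ → ℝ → ℝ) (ε ξ₀ ξ₁ T : ℝ) (z : ℝ → ℂ) : Prop where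
  pos : 0 < T
  start : z 0 = boundaryCurve f ε ξ₀
  finish : z T = boundaryCurve f ε ξ₁
  classical : IsOuterClassical E ω T z

/-- An outer arc from `γ_ε(ξ₀)` to `γ_ε(ξ₁)`: it also stays outside the closure of `D_ε`. -/
def IsOuterArc (E ω : ℝ) (f : ℝ → ℝ → ℝ) (ε ξ₀ ξ₁ T : ℝ) (z : ℝ → ℂ) : Prop :=
  IsOuterFixedEnds E ω f ε ξ₀ ξ₁ T z ∧ ∀ s ∈ Ioo 0 T, z s ∉ closure (domain f ε)

/-- The family of arcs `z(· ; ξ₀, ξ₁) : [0, T(ξ₀, ξ₁)] → ℂ`, for `|ξ₀ - ξ₁| < δ`, is of class `C¹`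
with respect to the end angles:
* `T` is of class `C¹`;
* `z` is jointly of class `C¹` in `(s, ξ₀, ξ₁)` wherever `z ≠ 0` (at a collision the velocity
  blows up, and no regularity of this kind is possible in the physical time);
* in the Levi-Civita time `τ`, where `ds / dτ = 2 |z|`, the whole family, collisions
  included, is jointly of class `C¹`; here `σ ξ₀ ξ₁ τ` is the physical time `s` at `τ`, and `L ξ₀ ξ₁`
  is the Levi-Civita duration of the arc. -/
def IsC1InEndpoints (δ : ℝ) (T : ℝ → ℝ → ℝ) (z : ℝ → ℝ → ℝ → ℂ) : Prop :=
  ContDiffOn ℝ 1 (fun p : ℝ × ℝ => T p.1 p.2) {p | |p.1 - p.2| < δ} ∧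
  ContDiffOn ℝ 1 (fun p : ℝ × ℝ × ℝ => z p.2.1 p.2.2 p.1)
    {p | |p.2.1 - p.2.2| < δ ∧ p.1 ∈ Icc 0 (T p.2.1 p.2.2) ∧ z p.2.1 p.2.2 p.1 ≠ 0} ∧
  ∃ (L : ℝ → ℝ → ℝ) (σ : ℝ → ℝ → ℝ → ℝ),
    (∀ ξ₀ ξ₁, |ξ₀ - ξ₁| < δ →
      0 < L ξ₀ ξ₁ ∧ σ ξ₀ ξ₁ 0 = 0 ∧ σ ξ₀ ξ₁ (L ξ₀ ξ₁) = T ξ₀ ξ₁ ∧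
      StrictMonoOn (σ ξ₀ ξ₁) (Icc 0 (L ξ₀ ξ₁)) ∧
      ∀ τ ∈ Icc 0 (L ξ₀ ξ₁),
        HasDerivWithinAt (σ ξ₀ ξ₁) (2 * ‖z ξ₀ ξ₁ (σ ξ₀ ξ₁ τ)‖) (Icc 0 (L ξ₀ ξ₁)) τ) ∧
    ContDiffOn ℝ 1 (fun p : ℝ × ℝ => L p.1 p.2) {p | |p.1 - p.2| < δ} ∧
    ContDiffOn ℝ 1 (fun p : ℝ × ℝ × ℝ => σ p.2.1 p.2.2 p.1)
      {p | |p.2.1 - p.2.2| < δ ∧ p.1 ∈ Icc 0 (L p.2.1 p.2.2)} ∧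
    ContDiffOn ℝ 1 (fun p : ℝ × ℝ × ℝ => z p.2.1 p.2.2 (σ p.2.1 p.2.2 p.1))
      {p | |p.2.1 - p.2.2| < δ ∧ p.1 ∈ Icc 0 (L p.2.1 p.2.2)}

end RefractionBilliard

end

noncomputable section

namespace RefractionBilliard

open Filter Topology ComplexConjugate

/-! ### The Levi-Civita flow -/

/-! Inner arcs. The Levi-Civita substitution z = w², ds = 2|w|² dτ turns the Kepler problem at the
positive energy E + h into the linear equation w'' = Ω² w with Ω² = 2(E + h). For w = A cosh Ωτ + B
sinh Ωτ the energy law becomes |B|² - |A|² = k, where k = μ/(E + h). A collision is now an ordinary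
zero of w, so the ejection-collision arcs belong to the same smooth family as the classical ones.
Conversely every solution is of this form (`eqOn_lcOrbit_of_keplerAt`, `ejectionCollision_arc`).

In the w-plane the fixed ends problem from p to r ≠ p has exactly one solution: the hyperbolic
cosine of its duration is the only positive root of an explicit quadratic (`bvpCosh`, `bvp_unique`).
The end γ(ξ₁) has two square roots. The one close to p gives the arc of index 0
(`windingIndex_direct`), or no arc at all if it equals p. The opposite one gives the arc of index ±1
(`norm_windingIndex_opposite`), which meets 0 exactly when ξ₀ = ξ₁. Smooth dependence is read off
the formulas, with the implicit function theorem for the inverse of the time change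
(`contDiffAt_lcClock`). On the open arc w is a combination of p and r with positive weights of sum
less than 1, which keeps z inside the domain (`NearCircle.inside`). The end velocities are almost
radial, hence transversal to the boundary.

Outer arcs. Solutions are harmonic motions, and the energy law at fixed ends p₀, p₁ is the quadratic
M c² - 2(p₀·p₁) c + |p₀|² + |p₁|² - M = 0 in c = cos ωT, with M = 2E/ω². The hypothesis E > ω² says
M > 2. On the unit circle with p₀ = p₁ the roots are 1 and 2/M - 1, and the threshold 2/M keeps
separating the two roots after a small perturbation. The smaller root gives an arc that goes out and
comes back: it bulges beyond its chord by more than the boundary can vary (`sum_weights_bound`,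
`outer_arc_outside`). An arc with c ≥ 2/M has its midpoint in the domain (`chord_midpoint`,
`cos_lt_of_outside`), so it is not an outer arc. -/

/-- The real inner product on the plane. -/
def dot (A B : ℂ) : ℝ := A.re * B.re + A.im * B.im

/-- The solution `A cosh (Ω t) + B sinh (Ω t)` of `w'' = Ω² w`. -/
def lcW (Ω : ℝ) (A B : ℂ) (t : ℝ) : ℂ := (Real.cosh (Ω * t) : ℂ) * A + (Real.sinh (Ω * t) : ℂ) * B

/-- The derivative of `lcW`. -/
def lcDW (Ω : ℝ) (A B : ℂ) (t : ℝ) : ℂ :=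
  (Ω : ℂ) * ((Real.sinh (Ω * t) : ℂ) * A + (Real.cosh (Ω * t) : ℂ) * B)

/-- The physical time along `lcW`, a primitive of `2 |w|²`. -/
def lcTime (Ω : ℝ) (A B : ℂ) (t : ℝ) : ℝ :=
  ((Complex.normSq A + Complex.normSq B) / 2 * Real.sinh (2 * (Ω * t))
    + dot A B * (Real.cosh (2 * (Ω * t)) - 1)) / Ω - (Complex.normSq B - Complex.normSq A) * t

/-- The Levi-Civita time as a function of the physical time. -/
def lcClock (Ω : ℝ) (A B : ℂ) (s : ℝ) : ℝ := Function.invFun (lcTime Ω A B) s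

/-- The physical orbit `w²` in physical time. -/
def lcOrbit (Ω : ℝ) (A B : ℂ) (s : ℝ) : ℂ := lcW Ω A B (lcClock Ω A B s) ^ 2

/-- The physical velocity at Levi-Civita time `t`. -/
def lcVel (Ω : ℝ) (A B : ℂ) (t : ℝ) : ℂ := lcDW Ω A B t / conj (lcW Ω A B t)

lemma lcW_zero (Ω : ℝ) (A B : ℂ) : lcW Ω A B 0 = A := by simp [lcW]

lemma lcTime_zero (Ω : ℝ) (A B : ℂ) : lcTime Ω A B 0 = 0 := by simp [lcTime]

lemma hasDerivAt_lcW (Ω : ℝ) (A B : ℂ) (t : ℝ) : HasDerivAt (lcW Ω A B) (lcDW Ω A B t) t := by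
  have h0 : HasDerivAt (fun t : ℝ => Ω * t) Ω t := by simpa using (hasDerivAt_id t).const_mul Ω
  have hc := ((h0.cosh).ofReal_comp).mul_const A
  have hs := ((h0.sinh).ofReal_comp).mul_const B
  refine (hc.add hs).congr_deriv ?_
  simp only [lcDW]; push_cast; ring

lemma hasDerivAt_lcDW (Ω : ℝ) (A B : ℂ) (t : ℝ) :
    HasDerivAt (lcDW Ω A B) ((Ω : ℂ) ^ 2 * lcW Ω A B t) t := by
  have h0 : HasDerivAt (fun t : ℝ => Ω * t) Ω t := by simpa using (hasDerivAt_id t).const_mul Ω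
  have hc := ((h0.sinh).ofReal_comp).mul_const A
  have hs := ((h0.cosh).ofReal_comp).mul_const B
  refine ((hc.add hs).const_mul (Ω : ℂ)).congr_deriv ?_
  simp only [lcW]; push_cast; ring

lemma continuous_lcW (Ω : ℝ) (A B : ℂ) : Continuous (lcW Ω A B) :=
  continuous_iff_continuousAt.2 fun t => (hasDerivAt_lcW Ω A B t).continuousAt

lemma normSq_lcW (Ω : ℝ) (A B : ℂ) (t : ℝ) :
    Complex.normSq (lcW Ω A B t) = Complex.normSq A * Real.cosh (Ω * t) ^ 2
      + 2 * dot A B * Real.cosh (Ω * t) * Real.sinh (Ω * t)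
      + Complex.normSq B * Real.sinh (Ω * t) ^ 2 := by
  simp only [lcW, Complex.normSq_apply, dot, Complex.add_re, Complex.add_im, Complex.mul_re,
    Complex.mul_im, Complex.ofReal_re, Complex.ofReal_im]
  ring

lemma normSq_lcDW (Ω : ℝ) (A B : ℂ) (t : ℝ) :
    Complex.normSq (lcDW Ω A B t) = Ω ^ 2 * (Complex.normSq (lcW Ω A B t)
      + (Complex.normSq B - Complex.normSq A)) := by
  have h := Real.cosh_sq (Ω * t)
  simp only [lcDW, lcW, Complex.normSq_apply, Complex.add_re, Complex.add_im, Complex.mul_re,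
    Complex.mul_im, Complex.ofReal_re, Complex.ofReal_im]
  ring_nf
  rw [h]; ring

lemma hasDerivAt_lcTime {Ω : ℝ} (hΩ : 0 < Ω) (A B : ℂ) (t : ℝ) :
    HasDerivAt (lcTime Ω A B) (2 * Complex.normSq (lcW Ω A B t)) t := by
  have h0 : HasDerivAt (fun t : ℝ => 2 * (Ω * t)) (2 * Ω) t := by
    simpa using ((hasDerivAt_id t).const_mul Ω).const_mul 2
  have h1 := (((h0.sinh.const_mul ((Complex.normSq A + Complex.normSq B) / 2)).add
    ((h0.cosh.sub_const 1).const_mul (dot A B))).div_const Ω).sub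
    ((hasDerivAt_id t).const_mul (Complex.normSq B - Complex.normSq A))
  refine h1.congr_deriv ?_
  rw [normSq_lcW, Real.cosh_two_mul, Real.sinh_two_mul, Real.cosh_sq]
  field_simp; ring

lemma continuous_lcTime {Ω : ℝ} (hΩ : 0 < Ω) (A B : ℂ) : Continuous (lcTime Ω A B) :=
  continuous_iff_continuousAt.2 fun t => (hasDerivAt_lcTime hΩ A B t).continuousAt

lemma dot_sq_le (A B : ℂ) : dot A B ^ 2 ≤ Complex.normSq A * Complex.normSq B := by
  simp only [dot, Complex.normSq_apply]
  nlinarith [sq_nonneg (A.re * B.im - A.im * B.re)]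

/-- This makes the coefficients of both exponentials in `lcTime` nonzero with the right sign, so
that the time change is onto. -/
lemma abs_dot_lt {A B : ℂ} (hk : Complex.normSq A < Complex.normSq B) :
    |dot A B| < (Complex.normSq A + Complex.normSq B) / 2 := by
  have h1 := Complex.normSq_nonneg A
  apply abs_lt_of_sq_lt_sq _ (by linarith)
  nlinarith [dot_sq_le A B]

/-- The Levi-Civita curve of positive energy passes through the singularity at most once. -/
lemma lcW_zero_unique {Ω : ℝ} (hΩ : 0 < Ω) {A B : ℂ} (hk : Complex.normSq A < Complex.normSq B)
    {t u : ℝ} (ht : lcW Ω A B t = 0) (hu : lcW Ω A B u = 0) : t = u := by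
  have hdet : (Real.sinh (Ω * u - Ω * t) : ℂ) * B = 0 := by
    rw [Real.sinh_sub]
    simp only [lcW] at ht hu
    push_cast at *
    linear_combination (Complex.cosh (Ω * t)) * hu - (Complex.cosh (Ω * u)) * ht
  rcases mul_eq_zero.1 hdet with h | h
  · have := Real.sinh_eq_zero.1 (by exact_mod_cast h)
    have : Ω * (u - t) = 0 := by linarith
    rcases mul_eq_zero.1 this with h | h <;> linarith
  · have := Complex.normSq_nonneg A
    simp [h] at hk; linarith

/-- The derivative 2|w|² is nonnegative and vanishes at most once, so it is positive at one of any
two distinct instants. A collision therefore does not stop the physical time. -/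
lemma strictMono_lcTime {Ω : ℝ} (hΩ : 0 < Ω) {A B : ℂ}
    (hk : Complex.normSq A < Complex.normSq B) : StrictMono (lcTime Ω A B) := by
  intro a b hab
  have hc : Continuous fun t => 2 * Complex.normSq (lcW Ω A B t) :=
    continuous_const.mul (Complex.continuous_normSq.comp (continuous_lcW Ω A B))
  have hint := intervalIntegral.integral_eq_sub_of_hasDerivAt (a := a) (b := b)
    (fun t _ => hasDerivAt_lcTime hΩ A B t) (hc.intervalIntegrable a b)
  have hpos : 0 < ∫ t in a..b, 2 * Complex.normSq (lcW Ω A B t) := by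
    refine intervalIntegral.integral_pos hab hc.continuousOn
      (fun t _ => mul_nonneg zero_le_two (Complex.normSq_nonneg _)) ?_
    by_cases ha : lcW Ω A B a = 0
    · have hb : lcW Ω A B b ≠ 0 := fun hb => hab.ne (lcW_zero_unique hΩ hk ha hb)
      exact ⟨b, right_mem_Icc.2 hab.le, mul_pos two_pos (Complex.normSq_pos.2 hb)⟩
    · exact ⟨a, left_mem_Icc.2 hab.le, mul_pos two_pos (Complex.normSq_pos.2 ha)⟩
  linarith

lemma lcTime_neg (Ω : ℝ) (A B : ℂ) (t : ℝ) : lcTime Ω A B (-t) = -lcTime Ω A (-B) t := by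
  simp only [lcTime, dot, mul_neg, Real.sinh_neg, Real.cosh_neg, Complex.normSq_neg,
    Complex.neg_re, Complex.neg_im]
  ring

/-- With a = (|A|² + |B|²)/2 and b = A·B, the leading part of Ω times the physical time is (a + b)/2
· exp(2Ωt), and a + b > 0. It beats the linear term. -/
lemma lcTime_unbounded {Ω : ℝ} (hΩ : 0 < Ω) {A B : ℂ}
    (hk : Complex.normSq A < Complex.normSq B) (y : ℝ) : ∃ t, y ≤ lcTime Ω A B t := by
  have hab := abs_lt.1 (abs_dot_lt hk)
  set a := (Complex.normSq A + Complex.normSq B) / 2 with ha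
  set b := dot A B with hb
  set k := Complex.normSq B - Complex.normSq A with hkd
  have hk0 : 0 < k := by linarith
  -- Here x = 2Ωt, and the exponential is replaced by its quadratic lower bound 1 + x + x²/2.
  have key : ∀ x : ℝ, 0 ≤ x →
      ((a + b) * (x ^ 2 / 4) - (2 * |b| + a + k * x)) / Ω ≤ lcTime Ω A B (x / (2 * Ω)) + k * 0 := by
    intro x hx
    have hx1 : 2 * (Ω * (x / (2 * Ω))) = x := by field_simp
    simp only [lcTime, hx1, ← ha, ← hb, ← hkd]
    rw [Real.sinh_eq, Real.cosh_eq, mul_zero, add_zero]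
    have e1 := Real.quadratic_le_exp_of_nonneg hx
    have e2 : Real.exp (-x) ≤ 1 := by simpa using hx
    have e3 := Real.exp_pos (-x)
    have h3 : k * (x / (2 * Ω)) ≤ k * x / Ω := by
      rw [mul_div_assoc]; gcongr; linarith
    have h4 : (a + b) * (x ^ 2 / 4) - (2 * |b| + a) ≤ a * ((Real.exp x - Real.exp (-x)) / 2)
        + b * ((Real.exp x + Real.exp (-x)) / 2 - 1) := by
      nlinarith [le_abs_self b, neg_abs_le b, mul_le_mul_of_nonneg_left e1 (by linarith : 0 ≤ a + b),
        mul_le_mul_of_nonneg_left e2 (by linarith : 0 ≤ a - b)]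
    have h5 := div_le_div_of_nonneg_right h4 hΩ.le
    rw [show ((a + b) * (x ^ 2 / 4) - (2 * |b| + a + k * x)) / Ω
      = ((a + b) * (x ^ 2 / 4) - (2 * |b| + a)) / Ω - k * x / Ω by ring]
    linarith
  have hab0 : 0 < a + b := by linarith
  set N := |Ω * y| + (2 * |b| + a) + k with hN
  have hN0 : 0 < N := by have := abs_nonneg (Ω * y); have := abs_nonneg b; linarith
  -- Chosen so that (a + b) x ≥ 4N: the quadratic term is then at least N x, which dominates the
  -- linear terms and Ω y.
  set x := 1 + 4 * N / (a + b) with hx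
  have hx1 : 1 ≤ x := by
    have : 0 ≤ 4 * N / (a + b) := by positivity
    linarith
  refine ⟨x / (2 * Ω), le_trans ?_ (le_of_le_of_eq (key x (by linarith)) (by ring))⟩
  rw [le_div_iff₀ hΩ]
  have h1 : (a + b) * (x ^ 2 / 4) ≥ N * x := by
    have : (a + b) * x = (a + b) + 4 * N := by rw [hx]; field_simp
    nlinarith
  have h2 := le_abs_self (Ω * y)
  have h3 := abs_nonneg (Ω * y)
  have h4 := abs_nonneg b
  have : N * x = (|Ω * y| + (2 * |b| + a)) * x + k * x := by rw [hN]; ring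
  nlinarith

lemma lcTime_surjective {Ω : ℝ} (hΩ : 0 < Ω) {A B : ℂ}
    (hk : Complex.normSq A < Complex.normSq B) : Function.Surjective (lcTime Ω A B) := by
  intro y
  obtain ⟨t, ht⟩ := lcTime_unbounded hΩ hk y
  -- Reversing time replaces B by -B, so unboundedness below follows from unboundedness above.
  obtain ⟨u, hu⟩ := lcTime_unbounded hΩ (A := A) (B := -B) (by simpa using hk) (-y)
  exact mem_range_of_exists_le_of_exists_ge (continuous_lcTime hΩ A B)
    ⟨-u, by rw [lcTime_neg]; linarith⟩ ⟨t, ht⟩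

/-! ### The inverse time change and the Kepler equation for squared Levi-Civita curves. -/

section clock

variable {Ω : ℝ} (hΩ : 0 < Ω) {A B : ℂ} (hk : Complex.normSq A < Complex.normSq B)
include hΩ hk

lemma lcTime_lcClock (s : ℝ) : lcTime Ω A B (lcClock Ω A B s) = s :=
  Function.rightInverse_invFun (lcTime_surjective hΩ hk) s

lemma lcClock_lcTime (t : ℝ) : lcClock Ω A B (lcTime Ω A B t) = t :=
  Function.leftInverse_invFun (strictMono_lcTime hΩ hk).injective t

lemma lcClock_eq {s t : ℝ} (h : lcTime Ω A B t = s) : lcClock Ω A B s = t := by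
  rw [← h, lcClock_lcTime hΩ hk]

lemma strictMono_lcClock : StrictMono (lcClock Ω A B) := by
  intro s t hst
  rw [← lcTime_lcClock hΩ hk s, ← lcTime_lcClock hΩ hk t] at hst
  exact (strictMono_lcTime hΩ hk).lt_iff_lt.1 hst

lemma lcClock_zero : lcClock Ω A B 0 = 0 := lcClock_eq hΩ hk (lcTime_zero Ω A B)

lemma continuous_lcClock : Continuous (lcClock Ω A B) :=
  (strictMono_lcClock hΩ hk).monotone.continuous_of_surjective
    fun t => ⟨lcTime Ω A B t, lcClock_lcTime hΩ hk t⟩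

lemma continuous_lcOrbit : Continuous (lcOrbit Ω A B) :=
  ((continuous_lcW Ω A B).comp (continuous_lcClock hΩ hk)).pow 2

lemma lcOrbit_zero : lcOrbit Ω A B 0 = A ^ 2 := by
  rw [lcOrbit, lcClock_zero hΩ hk, lcW_zero]

lemma lcOrbit_lcTime (t : ℝ) : lcOrbit Ω A B (lcTime Ω A B t) = lcW Ω A B t ^ 2 := by
  rw [lcOrbit, lcClock_lcTime hΩ hk]

omit hΩ hk in
lemma norm_lcOrbit (s : ℝ) :
    ‖lcOrbit Ω A B s‖ = Complex.normSq (lcW Ω A B (lcClock Ω A B s)) := by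
  rw [lcOrbit, norm_pow, Complex.normSq_eq_norm_sq]

lemma hasDerivAt_lcClock {s : ℝ} (h : lcOrbit Ω A B s ≠ 0) :
    HasDerivAt (lcClock Ω A B) (1 / (2 * ‖lcOrbit Ω A B s‖)) s := by
  have h1 : HasDerivAt (lcTime Ω A B) (2 * ‖lcOrbit Ω A B s‖) (lcClock Ω A B s) := by
    rw [norm_lcOrbit]; exact hasDerivAt_lcTime hΩ A B _
  rw [one_div]
  exact HasDerivAt.of_local_left_inverse (continuous_lcClock hΩ hk).continuousAt h1
    (mul_ne_zero two_ne_zero (norm_ne_zero_iff.2 h))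
    (Eventually.of_forall (lcTime_lcClock hΩ hk))

lemma hasDerivAt_lcOrbit {s : ℝ} (h : lcOrbit Ω A B s ≠ 0) :
    HasDerivAt (lcOrbit Ω A B) (lcVel Ω A B (lcClock Ω A B s)) s := by
  have h1 := ((hasDerivAt_lcW Ω A B (lcClock Ω A B s)).scomp s (hasDerivAt_lcClock hΩ hk h)).pow 2
  refine h1.congr_deriv ?_
  have hw : lcW Ω A B (lcClock Ω A B s) ≠ 0 := fun h0 => h (by rw [lcOrbit, h0]; simp)
  rw [norm_lcOrbit, lcVel]
  have hc : conj (lcW Ω A B (lcClock Ω A B s)) ≠ 0 := by simpa using hw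
  simp only [Function.comp_apply, Complex.real_smul]
  push_cast
  rw [← Complex.mul_conj]
  field_simp

lemma hasDerivAt_lcVel_lcClock {s : ℝ} (h : lcOrbit Ω A B s ≠ 0) :
    HasDerivAt (fun s => lcVel Ω A B (lcClock Ω A B s))
      (((-(Ω ^ 2 * (Complex.normSq B - Complex.normSq A) / 2) / ‖lcOrbit Ω A B s‖ ^ 3 : ℝ) : ℂ)
        * lcOrbit Ω A B s) s := by
  have hw : lcW Ω A B (lcClock Ω A B s) ≠ 0 := fun h0 => h (by rw [lcOrbit, h0]; simp)
  have hc : conj (lcW Ω A B (lcClock Ω A B s)) ≠ 0 := by simpa using hw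
  have hd : HasDerivAt (lcVel Ω A B) _ (lcClock Ω A B s) :=
    (hasDerivAt_lcDW Ω A B _).div (hasDerivAt_lcW Ω A B _).star hc
  refine (hd.scomp s (hasDerivAt_lcClock hΩ hk h)).congr_deriv ?_
  rw [norm_lcOrbit, lcOrbit]
  set w := lcW Ω A B (lcClock Ω A B s) with hwdef
  have h2 := normSq_lcDW Ω A B (lcClock Ω A B s)
  rw [← hwdef] at h2
  -- The numerator of the derivative of w'/w̄ is Ω²|w|² - |w'|²; by the conserved quantity it is the
  -- constant -Ω²(|B|² - |A|²), which is the Kepler force.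
  have h3 : lcDW Ω A B (lcClock Ω A B s) * conj (lcDW Ω A B (lcClock Ω A B s))
      = (Ω : ℂ) ^ 2 * (w * conj w + ((Complex.normSq B : ℂ) - Complex.normSq A)) := by
    rw [Complex.mul_conj, Complex.mul_conj, h2]; push_cast; ring
  simp only [Complex.real_smul, Complex.star_def]
  push_cast
  rw [← Complex.mul_conj w]
  field_simp
  linear_combination (-1 : ℂ) * h3

omit hΩ hk in
lemma energy_lcVel {t : ℝ} (h : lcW Ω A B t ≠ 0) :
    1 / 2 * ‖lcVel Ω A B t‖ ^ 2 = Ω ^ 2 / 2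
      + Ω ^ 2 * (Complex.normSq B - Complex.normSq A) / 2 / ‖lcW Ω A B t ^ 2‖ := by
  have hn : ‖lcW Ω A B t‖ ≠ 0 := by simpa using h
  have h2 := normSq_lcDW Ω A B t
  rw [Complex.normSq_eq_norm_sq, Complex.normSq_eq_norm_sq] at h2
  rw [lcVel, norm_div, RCLike.norm_conj, div_pow, h2, norm_pow]
  field_simp

end clock

/-! ### Classical solutions of the inner problem -/

lemma gradient_innerPotential (E h μ : ℝ) {z : ℂ} (hz : z ≠ 0) :
    gradient (innerPotential E h μ) z = ((-μ / ‖z‖ ^ 3 : ℝ) : ℂ) * z := by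
  have hn : ‖z‖ ≠ 0 := norm_ne_zero_iff.2 hz
  apply HasGradientAt.gradient
  rw [hasGradientAt_iff_hasFDerivAt]
  have h1 : HasFDerivAt (fun y : ℂ => ‖y‖ ^ 2) (2 • innerSL ℝ z) z :=
    (hasStrictFDerivAt_norm_sq z).hasFDerivAt
  have h2 := (((hasDerivAt_inv (by positivity : √(‖z‖ ^ 2) ≠ 0)).comp_hasFDerivAt z
    (h1.sqrt (by positivity))).const_mul μ).const_add (E + h)
  have h3 : innerPotential E h μ = fun y => E + h + μ * (√(‖y‖ ^ 2))⁻¹ := by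
    ext y; rw [innerPotential, Real.sqrt_sq (norm_nonneg _), div_eq_mul_inv]
  rw [h3]
  refine h2.congr_fderiv ?_
  rw [← Complex.real_smul, map_smul]
  ext1 y
  simp [Real.sqrt_sq (norm_nonneg z), Complex.inner]
  field_simp

/-- The orbit together with its velocity solves the inner problem on `S` at `s`. -/
def KeplerAt (Ω μ : ℝ) (S : Set ℝ) (z v : ℝ → ℂ) (s : ℝ) : Prop :=
  z s ≠ 0 ∧ HasDerivWithinAt z (v s) S s ∧
    HasDerivWithinAt v (((-μ / ‖z s‖ ^ 3 : ℝ) : ℂ) * z s) S s ∧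
    1 / 2 * ‖v s‖ ^ 2 = Ω ^ 2 / 2 + μ / ‖z s‖

lemma HSAt.keplerAt {E h μ Ω T : ℝ} (hΩ : Ω ^ 2 / 2 = E + h) {z : ℝ → ℂ} {s : ℝ} (hz : z s ≠ 0)
    (hs : HSAt (innerPotential E h μ) T z s) :
    KeplerAt Ω μ (Icc 0 T) z (derivWithin z (Icc 0 T)) s := by
  refine ⟨hz, hs.differentiable.hasDerivWithinAt, ?_, ?_⟩
  · rw [← gradient_innerPotential E h μ hz]; exact hs.newton
  · have := hs.energy
    rw [innerPotential] at this; linarith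

lemma KeplerAt.mono {Ω μ : ℝ} {S S' : Set ℝ} {z v : ℝ → ℂ} {s : ℝ} (h : KeplerAt Ω μ S z v s)
    (hS : S' ⊆ S) : KeplerAt Ω μ S' z v s :=
  ⟨h.1, h.2.1.mono hS, h.2.2.1.mono hS, h.2.2.2⟩

/-- Used to read the part of an ejection-collision solution after the collision as another arc that
ends in collision. -/
lemma KeplerAt.reverse {Ω μ T c : ℝ} {z v : ℝ → ℂ} {s : ℝ}
    (h : KeplerAt Ω μ (Icc 0 T) z v (T - s)) (hc : c ≤ T) :
    KeplerAt Ω μ (Icc 0 c) (fun s => z (T - s)) (fun s => -v (T - s)) s := by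
  have hm : MapsTo (fun s => T - s) (Icc 0 c) (Icc 0 T) := fun x hx =>
    ⟨by linarith [hx.2], by linarith [hx.1]⟩
  have hd : HasDerivWithinAt (fun s => T - s) (-1) (Icc 0 c) s := by
    simpa using (hasDerivWithinAt_id s (Icc 0 c)).const_sub T
  refine ⟨h.1, ?_, ?_, ?_⟩
  · simpa using! h.2.1.scomp s hd hm
  · simpa using! (h.2.2.1.scomp s hd hm).neg
  · simpa using h.2.2.2

lemma hsAt_lcOrbit {E h μ Ω T : ℝ} (hΩ0 : 0 < Ω) (hΩ : Ω ^ 2 / 2 = E + h) {A B : ℂ}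
    (hk : Complex.normSq A < Complex.normSq B)
    (hμ : Ω ^ 2 * (Complex.normSq B - Complex.normSq A) / 2 = μ) (hT : 0 < T) {s : ℝ}
    (hs : s ∈ Icc 0 T) (hz : lcOrbit Ω A B s ≠ 0) :
    HSAt (innerPotential E h μ) T (lcOrbit Ω A B) s := by
  have hu := uniqueDiffOn_Icc hT
  have hev : ∀ᶠ t in 𝓝[Icc 0 T] s,
      derivWithin (lcOrbit Ω A B) (Icc 0 T) t = lcVel Ω A B (lcClock Ω A B t) := by
    have h1 : ∀ᶠ t in 𝓝[Icc 0 T] s, lcOrbit Ω A B t ≠ 0 :=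
      ((continuous_lcOrbit hΩ0 hk).continuousAt.eventually_ne hz).filter_mono nhdsWithin_le_nhds
    filter_upwards [h1, self_mem_nhdsWithin] with t ht ht'
    exact (hasDerivAt_lcOrbit hΩ0 hk ht).hasDerivWithinAt.derivWithin (hu t ht')
  have hds : derivWithin (lcOrbit Ω A B) (Icc 0 T) s = lcVel Ω A B (lcClock Ω A B s) :=
    (hasDerivAt_lcOrbit hΩ0 hk hz).hasDerivWithinAt.derivWithin (hu s hs)
  refine ⟨(hasDerivAt_lcOrbit hΩ0 hk hz).differentiableAt.differentiableWithinAt, ?_, ?_⟩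
  · rw [gradient_innerPotential E h μ hz]
    have h2 := (hasDerivAt_lcVel_lcClock hΩ0 hk hz).hasDerivWithinAt (s := Icc 0 T)
    rw [hμ] at h2
    exact h2.congr_of_eventuallyEq hev hds
  · have hw : lcW Ω A B (lcClock Ω A B s) ≠ 0 := fun h0 => hz (by rw [lcOrbit, h0]; simp)
    rw [hds, energy_lcVel hw, innerPotential, ← lcOrbit, hμ]
    linarith

/-- A primitive of a function continuous on a compact interval. -/
lemma exists_primitive_on_Icc {T : ℝ} (hT : 0 ≤ T) {g : ℝ → ℝ} (hg : ContinuousOn g (Icc 0 T)) :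
    ∃ F : ℝ → ℝ, F 0 = 0 ∧ ∀ s ∈ Icc 0 T, HasDerivWithinAt F (g s) (Icc 0 T) s := by
  have hc : Continuous (IccExtend hT ((Icc 0 T).domRestrict g)) :=
    (continuousOn_iff_continuous_domRestrict.1 hg).Icc_extend'
  refine ⟨fun s => ∫ x in (0 : ℝ)..s, IccExtend hT ((Icc 0 T).domRestrict g) x, by simp, ?_⟩
  intro s hs
  have h1 := (intervalIntegral.integral_hasDerivAt_right (hc.intervalIntegrable 0 s)
    (hc.stronglyMeasurableAtFilter _ _) hc.continuousAt).hasDerivWithinAt (s := Icc 0 T)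
  refine h1.congr_deriv ?_
  rw [IccExtend_of_mem _ _ hs]; rfl

lemma constant_of_hasDerivWithinAt_zero {T : ℝ} {f : ℝ → ℂ}
    (h : ∀ s ∈ Icc 0 T, HasDerivWithinAt f 0 (Icc 0 T) s) {s : ℝ} (hs : s ∈ Icc 0 T) :
    f s = f 0 := by
  rcases eq_or_lt_of_le (hs.1.trans hs.2) with hT | hT
  · have : s = 0 := le_antisymm (by linarith [hs.2]) hs.1
    rw [this]
  · exact constant_of_derivWithin_zero (fun x hx => (h x hx).differentiableWithinAt)
      (fun x hx => (h x (Ico_subset_Icc_self hx)).derivWithin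
        (uniqueDiffOn_Icc hT x (Ico_subset_Icc_self hx))) s hs

/-- Every classical solution of the inner problem is a Levi-Civita orbit. -/
lemma eqOn_lcOrbit_of_keplerAt {Ω μ T : ℝ} (hΩ : 0 < Ω) (hμ : 0 < μ) (hT : 0 ≤ T) {z v : ℝ → ℂ}
    (hz : ∀ s ∈ Icc 0 T, KeplerAt Ω μ (Icc 0 T) z v s) {p : ℂ} (hp : p ^ 2 = z 0) :
    Ω ^ 2 * (Complex.normSq (v 0 * conj p / Ω) - Complex.normSq p) / 2 = μ ∧
      EqOn z (lcOrbit Ω p (v 0 * conj p / Ω)) (Icc 0 T) := by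
  have h0 : (0 : ℝ) ∈ Icc 0 T := ⟨le_rfl, hT⟩
  have hΩc : (Ω : ℂ) ≠ 0 := by exact_mod_cast hΩ.ne'
  have hp0 : p ≠ 0 := fun h => (hz 0 h0).1 (by rw [← hp, h]; simp)
  have hr : ∀ s ∈ Icc 0 T, ((‖z s‖ : ℝ) : ℂ) ≠ 0 := fun s hs => by
    simpa using (hz s hs).1
  have hzz : ∀ s, z s * conj (z s) = ((‖z s‖ : ℝ) : ℂ) ^ 2 := fun s => Complex.mul_conj' _
  have hvv : ∀ s ∈ Icc 0 T, v s * conj (v s) * (‖z s‖ : ℂ) = Ω ^ 2 * (‖z s‖ : ℂ) + 2 * μ := by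
    intro s hs
    have h1 := (hz s hs).2.2.2
    have h2 : ‖z s‖ ≠ 0 := by simpa using (hz s hs).1
    have h3 : ‖v s‖ ^ 2 * ‖z s‖ = Ω ^ 2 * ‖z s‖ + 2 * μ := by
      field_simp at h1; linarith
    rw [Complex.mul_conj']
    exact_mod_cast h3
  have hdr : ∀ s ∈ Icc 0 T, HasDerivWithinAt (fun s => ((‖z s‖ : ℝ) : ℂ))
      ((v s * conj (z s) + conj (v s) * z s) / (2 * (‖z s‖ : ℂ))) (Icc 0 T) s := by
    intro s hs
    have hn : ‖z s‖ ≠ 0 := by simpa using (hz s hs).1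
    have h1 := ((hz s hs).2.1.norm_sq.sqrt (by positivity)).ofReal_comp
    simp only [Real.sqrt_sq (norm_nonneg _)] at h1
    refine h1.congr_deriv ?_
    rw [Complex.inner]
    have : (((v s * conj (z s)).re : ℝ) : ℂ) = (v s * conj (z s) + conj (v s) * z s) / 2 := by
      rw [Complex.re_eq_add_conj]; simp
    push_cast [this]
    field_simp
  -- The Levi-Civita time of the given solution, τ = ∫ ds / (2|z|).
  obtain ⟨τ, hτ0, hτ⟩ := exists_primitive_on_Icc hT (g := fun s => 1 / (2 * ‖z s‖)) (by
    have : ContinuousOn z (Icc 0 T) := fun s hs => (hz s hs).2.1.continuousWithinAt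
    exact continuousOn_const.div (continuousOn_const.mul this.norm)
      fun s hs => mul_ne_zero two_ne_zero (by simpa using (hz s hs).1))
  -- No continuous square root of z is chosen. In the time τ one has P = dz/dτ and Q = dP/dτ, and Q
  -- has derivative 4Ω² P: the position obeys the linear third order equation z''' = 4Ω² z', whose
  -- solutions are spanned by 1 and exp(±2Ωτ).
  set P : ℝ → ℂ := fun s => 2 * ((‖z s‖ : ℂ) * v s) with hP
  set Q : ℝ → ℂ := fun s => 2 * (v s ^ 2 * conj (z s)) + 2 * Ω ^ 2 * z s with hQ
  have hdP : ∀ s ∈ Icc 0 T, HasDerivWithinAt P (Q s / (2 * (‖z s‖ : ℂ))) (Icc 0 T) s := by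
    intro s hs
    have hn := hr s hs
    refine (((hdr s hs).mul (hz s hs).2.2.1).const_mul (2 : ℂ)).congr_deriv ?_
    simp only [hQ]
    push_cast
    have e1 := hzz s
    have e2 := hvv s hs
    field_simp
    linear_combination z s * e2
  have hdQ : ∀ s ∈ Icc 0 T, HasDerivWithinAt Q (4 * Ω ^ 2 * v s) (Icc 0 T) s := by
    intro s hs
    have hn := hr s hs
    refine (((((hz s hs).2.2.1.pow 2).mul (hz s hs).2.1.star).const_mul (2 : ℂ)).add
      ((hz s hs).2.1.const_mul (2 * (Ω : ℂ) ^ 2))).congr_deriv ?_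
    simp only [Complex.star_def, Pi.pow_apply]
    push_cast
    have e1 := hzz s
    have e2 := hvv s hs
    field_simp
    linear_combination (-4 * (μ : ℂ)) * v s * e1 + 2 * v s * (‖z s‖ : ℂ) ^ 2 * e2
  have hτc : ∀ s ∈ Icc 0 T, HasDerivWithinAt (fun s => ((τ s : ℝ) : ℂ)) (1 / (2 * (‖z s‖ : ℂ)))
      (Icc 0 T) s := fun s hs => by simpa using (hτ s hs).ofReal_comp
  have hexp : ∀ a : ℂ, ∀ s ∈ Icc 0 T, HasDerivWithinAt (fun s => Complex.exp (a * (τ s : ℂ)))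
      (Complex.exp (a * (τ s : ℂ)) * (a * (1 / (2 * (‖z s‖ : ℂ))))) (Icc 0 T) s :=
    fun a s hs => ((hτc s hs).const_mul a).cexp
  have c1 : ∀ s ∈ Icc 0 T, Q s - 4 * Ω ^ 2 * z s = Q 0 - 4 * Ω ^ 2 * z 0 := fun s hs =>
    constant_of_hasDerivWithinAt_zero (f := fun s => Q s - 4 * Ω ^ 2 * z s) (fun s hs =>
      ((hdQ s hs).sub ((hz s hs).2.1.const_mul (4 * (Ω : ℂ) ^ 2))).congr_deriv (by ring)) hs
  -- The two exponential modes a = ±2Ω. Together with `c1` they are three first integrals, which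
  -- determine z, P and Q from the data at 0.
  have c2 : ∀ a : ℂ, a ^ 2 = 4 * Ω ^ 2 → a ≠ 0 → ∀ s ∈ Icc 0 T,
      (P s + Q s / a) * Complex.exp (-a * (τ s : ℂ)) = P 0 + Q 0 / a := by
    intro a ha ha0 s hs
    have := constant_of_hasDerivWithinAt_zero
      (f := fun s => (P s + Q s / a) * Complex.exp (-a * (τ s : ℂ))) (fun s hs => by
        refine (((hdP s hs).add ((hdQ s hs).div_const a)).mul (hexp (-a) s hs)).congr_deriv ?_
        have hn := hr s hs
        have hPs : P s = 2 * ((‖z s‖ : ℂ) * v s) := rfl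
        simp only [Pi.add_apply, neg_mul]
        rw [hPs]
        field_simp
        linear_combination (-2 * Complex.exp (-(a * (τ s : ℂ))) * (‖z s‖ : ℂ) * v s) * ha) hs
    simpa [hτ0] using this
  have hB : (‖z 0‖ : ℂ) = p * conj p := by
    rw [← hp, norm_pow, Complex.mul_conj']; push_cast; rfl
  have hcp : conj p ≠ 0 := by simpa using hp0
  set B : ℂ := v 0 * conj p / Ω with hBdef
  have hv0 : v 0 * conj p = Ω * B := by rw [hBdef]; field_simp
  have hk : Ω ^ 2 * (Complex.normSq B - Complex.normSq p) / 2 = μ := by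
    have h1 := (hz 0 h0).2.2.2
    have hpn : ‖p‖ ≠ 0 := by simpa using hp0
    rw [← hp, norm_pow] at h1
    rw [hBdef, Complex.normSq_eq_norm_sq, Complex.normSq_eq_norm_sq, norm_div, norm_mul,
      RCLike.norm_conj, Complex.norm_real, Real.norm_of_nonneg hΩ.le]
    field_simp at h1 ⊢
    linarith
  have hkk : Complex.normSq p < Complex.normSq B := by
    have : 0 < Ω ^ 2 * (Complex.normSq B - Complex.normSq p) := by linarith
    have := (mul_pos_iff_of_pos_left (by positivity)).1 this
    linarith
  have hrep : ∀ s ∈ Icc 0 T, z s = lcW Ω p B (τ s) ^ 2 := by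
    intro s hs
    have d1 := c1 s hs
    have d2 := c2 (2 * Ω) (by ring) (by simpa using hΩc) s hs
    have d3 := c2 (-(2 * Ω)) (by ring) (by simpa using hΩc) s hs
    have hP0 : P 0 = 2 * (p * (Ω * B)) := by
      simp only [hP, hB]; linear_combination (2 * p) * hv0
    have hQ0 : Q 0 = 2 * (Ω * B) ^ 2 + 2 * Ω ^ 2 * p ^ 2 := by
      simp only [hQ, ← hp, map_pow]
      linear_combination (2 * v 0 * conj p + 2 * Ω * B) * hv0
    rw [hP0, hQ0] at d2 d3
    rw [hQ0, ← hp] at d1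
    have hx : Complex.exp (-(2 * Ω) * τ s) = (Complex.exp (-(Ω * τ s))) ^ 2 := by
      rw [← Complex.exp_nat_mul]; congr 1; push_cast; ring
    have hy : Complex.exp (-(-(2 * Ω)) * τ s) = (Complex.exp (Ω * τ s)) ^ 2 := by
      rw [← Complex.exp_nat_mul]; congr 1; push_cast; ring
    rw [hx] at d2
    rw [hy] at d3
    have hxy : Complex.exp (Ω * τ s) * Complex.exp (-(Ω * τ s)) = 1 := by
      rw [← Complex.exp_add]; simp
    simp only [lcW]
    push_cast
    rw [Complex.cosh, Complex.sinh]
    set e := Complex.exp (Ω * τ s)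
    set e' := Complex.exp (-(Ω * τ s))
    set Ps := P s
    set Qs := Q s
    field_simp at d2 d3
    have d2' : (2 * Ω * Ps + Qs) = e ^ 2 * (2 * Ω ^ 2 * (p + B) ^ 2) := by
      linear_combination e ^ 2 * d2 - (2 * Ω * Ps + Qs) * (e * e' + 1) * hxy
    have d3' : (Qs - 2 * Ω * Ps) = e' ^ 2 * (2 * Ω ^ 2 * (p - B) ^ 2) := by
      linear_combination (-e' ^ 2) * d3 + (2 * Ω * Ps - Qs) * (e * e' + 1) * hxy
    have hfin : 4 * Ω ^ 2 * z s = 4 * (Ω : ℂ) ^ 2 * ((e + e') / 2 * p + (e - e') / 2 * B) ^ 2 := by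
      linear_combination (-1 : ℂ) * d1 + d2' / 2 + d3' / 2
        - 2 * (Ω : ℂ) ^ 2 * (p ^ 2 - B ^ 2) * hxy
    exact mul_left_cancel₀ (by simpa using hΩc) hfin
  refine ⟨hk, fun s hs => ?_⟩
  -- The time change computed along the explicit curve has derivative 2|z| in τ, which inverts the
  -- defining derivative of τ; hence τ is the clock of the orbit.
  have htime : ∀ s ∈ Icc 0 T, lcTime Ω p B (τ s) = s := by
    intro s hs
    have := constant_of_hasDerivWithinAt_zero
      (f := fun s => ((lcTime Ω p B (τ s) - s : ℝ) : ℂ)) (fun s hs => by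
        have h1 := ((hasDerivAt_lcTime hΩ p B (τ s)).comp_hasDerivWithinAt s (hτ s hs)).sub
          (hasDerivWithinAt_id s (Icc 0 T))
        refine h1.ofReal_comp.congr_deriv ?_
        have hn : ‖z s‖ ≠ 0 := by simpa using (hz s hs).1
        have : Complex.normSq (lcW Ω p B (τ s)) = ‖z s‖ := by
          rw [hrep s hs, norm_pow, Complex.normSq_eq_norm_sq]
        rw [this]
        norm_cast
        field_simp
        ring) hs
    rw [hτ0, lcTime_zero] at this
    have := Complex.ofReal_injective this
    linarith
  rw [hrep s hs, lcOrbit, lcClock_eq hΩ hkk (htime s hs)]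

/-! ### The fixed ends problem in the Levi-Civita plane -/

/-- The hyperbolic cosine of the Levi-Civita duration of the arc from `p` to `r`. -/
def bvpCosh (k : ℝ) (p r : ℂ) : ℝ :=
  (√(dot p r ^ 2 + k * (k + Complex.normSq p + Complex.normSq r)) - dot p r) / k

/-- The hyperbolic sine of the Levi-Civita duration of the arc from `p` to `r`. -/
def bvpSinh (k : ℝ) (p r : ℂ) : ℝ := √(bvpCosh k p r ^ 2 - 1)

/-- The Levi-Civita duration of the arc from `p` to `r`. -/
def bvpTime (Ω k : ℝ) (p r : ℂ) : ℝ := Real.arsinh (bvpSinh k p r) / Ω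

/-- The coefficient of `sinh (Ω t)` in the arc from `p` to `r`. -/
def bvpCoeff (k : ℝ) (p r : ℂ) : ℂ := (r - bvpCosh k p r * p) / bvpSinh k p r

section bvp

variable {k : ℝ} (hk : 0 < k) {p r : ℂ}
include hk

lemma bvpCosh_disc_nonneg :
    0 < dot p r ^ 2 + k * (k + Complex.normSq p + Complex.normSq r) := by
  have := Complex.normSq_nonneg p
  have := Complex.normSq_nonneg r
  positivity

/-- The quadratic comes from |r - c p|² = |sinh|² |B|² on inserting sinh² = c² - 1 and |B|² = |p|² +
k: the terms c²|p|² cancel. -/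
lemma bvpCosh_root : k * bvpCosh k p r ^ 2 + 2 * dot p r * bvpCosh k p r
    - (k + Complex.normSq p + Complex.normSq r) = 0 := by
  have h := Real.sq_sqrt (bvpCosh_disc_nonneg hk (p := p) (r := r)).le
  rw [bvpCosh]
  field_simp
  linear_combination h

/-- The constant coefficient is negative, so the roots have opposite signs, and a positive root is
the one with the plus sign in front of the square root. -/
lemma bvpCosh_unique {c : ℝ} (hc : 0 < c) (h : k * c ^ 2 + 2 * dot p r * c
    - (k + Complex.normSq p + Complex.normSq r) = 0) : c = bvpCosh k p r := by
  have h1 := Complex.normSq_nonneg p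
  have h2 := Complex.normSq_nonneg r
  have h3 : 0 < k * c + dot p r + (k * c / 2 + dot p r + k * c / 2) := by
    have : 0 < c * (k * c + 2 * dot p r) := by nlinarith
    have := (mul_pos_iff_of_pos_left hc).1 this
    have := mul_pos hk hc
    linarith
  have h4 : √(dot p r ^ 2 + k * (k + Complex.normSq p + Complex.normSq r)) = k * c + dot p r := by
    rw [Real.sqrt_eq_iff_mul_self_eq_of_pos (by linarith)]
    linear_combination k * h
  rw [bvpCosh, h4]; field_simp; ring

/-- At c = 1 the quadratic takes the value -|p - r|², so its positive root lies beyond 1. -/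
lemma one_lt_bvpCosh (hpr : p ≠ r) : 1 < bvpCosh k p r := by
  have h1 : 0 < Complex.normSq (p - r) := Complex.normSq_pos.2 (sub_ne_zero.2 hpr)
  have h2 : Complex.normSq (p - r) = Complex.normSq p + Complex.normSq r - 2 * dot p r := by
    simp only [Complex.normSq_apply, dot, Complex.sub_re, Complex.sub_im]; ring
  rw [bvpCosh, lt_div_iff₀ hk, lt_sub_iff_add_lt]
  apply Real.lt_sqrt_of_sq_lt
  nlinarith

variable (hpr : p ≠ r)
include hpr

lemma bvpSinh_pos : 0 < bvpSinh k p r := by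
  have := one_lt_bvpCosh hk hpr
  exact Real.sqrt_pos.2 (by nlinarith)

lemma bvpSinh_sq : bvpSinh k p r ^ 2 = bvpCosh k p r ^ 2 - 1 := by
  have := one_lt_bvpCosh hk hpr
  exact Real.sq_sqrt (by nlinarith)

lemma normSq_bvpCoeff : Complex.normSq (bvpCoeff k p r) - Complex.normSq p = k := by
  have h1 := (bvpSinh_pos hk hpr).ne'
  have h2 := bvpSinh_sq hk hpr
  have h3 := bvpCosh_root hk (p := p) (r := r)
  rw [bvpCoeff, Complex.normSq_div, Complex.normSq_ofReal, ← sq]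
  field_simp
  simp only [Complex.normSq_apply, dot, Complex.sub_re, Complex.sub_im, Complex.mul_re,
    Complex.mul_im, Complex.ofReal_re, Complex.ofReal_im] at h3 ⊢
  linear_combination (-k - (p.re * p.re + p.im * p.im)) * h2 - h3

lemma normSq_lt_bvpCoeff : Complex.normSq p < Complex.normSq (bvpCoeff k p r) := by
  linarith [normSq_bvpCoeff hk hpr]

variable {Ω : ℝ} (hΩ : 0 < Ω)
include hΩ

omit hk hpr in
lemma sinh_bvpTime : Real.sinh (Ω * bvpTime Ω k p r) = bvpSinh k p r := by
  rw [bvpTime, mul_div_cancel₀ _ hΩ.ne', Real.sinh_arsinh]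

lemma cosh_bvpTime : Real.cosh (Ω * bvpTime Ω k p r) = bvpCosh k p r := by
  have h1 := one_lt_bvpCosh hk hpr
  rw [bvpTime, mul_div_cancel₀ _ hΩ.ne', Real.cosh_arsinh, bvpSinh_sq hk hpr,
    add_sub_cancel, Real.sqrt_sq (by linarith)]

lemma bvpTime_pos : 0 < bvpTime Ω k p r :=
  div_pos (Real.arsinh_pos_iff.2 (bvpSinh_pos hk hpr)) hΩ

lemma lcW_bvpTime : lcW Ω p (bvpCoeff k p r) (bvpTime Ω k p r) = r := by
  have h1 : (bvpSinh k p r : ℂ) ≠ 0 := by exact_mod_cast (bvpSinh_pos hk hpr).ne'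
  rw [lcW, sinh_bvpTime hΩ, cosh_bvpTime hk hpr hΩ, bvpCoeff]
  field_simp; ring

lemma lcDW_bvpTime : lcDW Ω p (bvpCoeff k p r) (bvpTime Ω k p r)
    = Ω / bvpSinh k p r * (bvpCosh k p r * r - p) := by
  have h1 : (bvpSinh k p r : ℂ) ≠ 0 := by exact_mod_cast (bvpSinh_pos hk hpr).ne'
  have h2 : (bvpSinh k p r : ℂ) ^ 2 = (bvpCosh k p r : ℂ) ^ 2 - 1 := by
    exact_mod_cast bvpSinh_sq hk hpr
  rw [lcDW, sinh_bvpTime hΩ, cosh_bvpTime hk hpr hΩ, bvpCoeff]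
  field_simp
  linear_combination Ω * p * h2

/-- Written in terms of the two ends, the curve shows its weights; their signs and sum control its
position and its zeros. -/
lemma lcW_bvpCoeff (t : ℝ) : lcW Ω p (bvpCoeff k p r) t =
    ((Real.sinh (Ω * (bvpTime Ω k p r - t)) / bvpSinh k p r : ℝ) : ℂ) * p
      + ((Real.sinh (Ω * t) / bvpSinh k p r : ℝ) : ℂ) * r := by
  have h1 : (bvpSinh k p r : ℂ) ≠ 0 := by exact_mod_cast (bvpSinh_pos hk hpr).ne'
  rw [mul_sub, Real.sinh_sub, sinh_bvpTime hΩ, cosh_bvpTime hk hpr hΩ, lcW, bvpCoeff]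
  push_cast
  field_simp; ring

/-- The sum is less than 1 because sinh(x + y) = sinh x cosh y + cosh x sinh y exceeds sinh x + sinh
y for x, y > 0. The open arc thus stays in the triangle 0, p, r, strictly off the side [p, r]. -/
lemma bvp_weights {t : ℝ} (ht : t ∈ Ioo 0 (bvpTime Ω k p r)) :
    0 < Real.sinh (Ω * (bvpTime Ω k p r - t)) / bvpSinh k p r ∧
    0 < Real.sinh (Ω * t) / bvpSinh k p r ∧
    Real.sinh (Ω * (bvpTime Ω k p r - t)) / bvpSinh k p r + Real.sinh (Ω * t) / bvpSinh k p r
      < 1 := by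
  have h0 := bvpSinh_pos hk hpr
  have hx : 0 < Real.sinh (Ω * (bvpTime Ω k p r - t)) :=
    Real.sinh_pos_iff.2 (mul_pos hΩ (sub_pos.2 ht.2))
  have hy : 0 < Real.sinh (Ω * t) := Real.sinh_pos_iff.2 (mul_pos hΩ ht.1)
  refine ⟨div_pos hx h0, div_pos hy h0, ?_⟩
  rw [← add_div, div_lt_one h0, ← sinh_bvpTime hΩ,
    show Ω * bvpTime Ω k p r = Ω * (bvpTime Ω k p r - t) + Ω * t by ring, Real.sinh_add]
  have hcx := Real.one_lt_cosh.2 (mul_pos hΩ (sub_pos.2 ht.2)).ne'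
  have hcy := Real.one_lt_cosh.2 (mul_pos hΩ ht.1).ne'
  nlinarith

omit hpr in
-- Every orbit of the right energy that reaches r at a positive time solves the quadratic, so
-- duration and velocity are forced. No orbit returns to p: for r = p the positive root is 1, which
-- is not cosh of a nonzero number.
lemma bvp_unique {B : ℂ} (hB : Complex.normSq B - Complex.normSq p = k) {t : ℝ} (ht : 0 < t)
    (hr : lcW Ω p B t = r) : p ≠ r ∧ t = bvpTime Ω k p r ∧ B = bvpCoeff k p r := by
  have hs : 0 < Real.sinh (Ω * t) := Real.sinh_pos_iff.2 (mul_pos hΩ ht)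
  have hc := Real.cosh_pos (Ω * t)
  have hc1 := Real.one_lt_cosh.2 (mul_pos hΩ ht).ne'
  have hcs := Real.cosh_sq (Ω * t)
  have hcc : Real.cosh (Ω * t) = bvpCosh k p r := by
    refine bvpCosh_unique hk hc ?_
    have h1 : Complex.normSq B = Complex.normSq p + k := by linarith
    rw [← hr, normSq_lcW, h1, lcW]
    simp only [dot, Complex.normSq_apply, Complex.add_re, Complex.add_im, Complex.mul_re,
      Complex.mul_im, Complex.ofReal_re, Complex.ofReal_im]
    linear_combination (k + (p.re * p.re + p.im * p.im)) * hcs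
  have hne : p ≠ r := by
    rintro rfl
    have h3 := bvpCosh_root hk (p := p) (r := p)
    rw [← hcc, show dot p p = Complex.normSq p by simp [dot, Complex.normSq_apply]] at h3
    have := Complex.normSq_nonneg p
    have h4 : (Real.cosh (Ω * t) - 1) * (k * (Real.cosh (Ω * t) + 1) + 2 * Complex.normSq p) = 0 := by
      linear_combination h3
    have h5 : 0 < k * (Real.cosh (Ω * t) + 1) + 2 * Complex.normSq p := by positivity
    rcases mul_eq_zero.1 h4 with h | h <;> linarith
  have hss : Real.sinh (Ω * t) = bvpSinh k p r := by
    rw [bvpSinh, ← hcc, hcs, add_sub_cancel_right, Real.sqrt_sq hs.le]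
  refine ⟨hne, ?_, ?_⟩
  · rw [bvpTime, ← hss, Real.arsinh_sinh]; field_simp
  · have h1 : (bvpSinh k p r : ℂ) ≠ 0 := by exact_mod_cast (bvpSinh_pos hk hne).ne'
    rw [bvpCoeff]
    nth_rewrite 1 [← hr]
    rw [lcW, hss, hcc]
    field_simp; ring

end bvp

/-- The ejection arc, up to its first collision, is a Levi-Civita orbit with prescribed data. -/
lemma collision_arc {Ω k μ c : ℝ} (hΩ : 0 < Ω) (hk : 0 < k) (hμ : Ω ^ 2 * k / 2 = μ) (hc : 0 < c)
    {z v : ℝ → ℂ} (hcont : ContinuousOn z (Icc 0 c)) (hzc : z c = 0)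
    (hz : ∀ s ∈ Ico 0 c, KeplerAt Ω μ (Icc 0 c) z v s) {p : ℂ} (hp : p ^ 2 = z 0) :
    lcTime Ω p (bvpCoeff k p 0) (bvpTime Ω k p 0) = c ∧
      EqOn z (lcOrbit Ω p (bvpCoeff k p 0)) (Icc 0 c) := by
  have hμ0 : 0 < μ := by rw [← hμ]; positivity
  set B := v 0 * conj p / Ω with hB
  have hloc : ∀ c' ∈ Ico 0 c, Ω ^ 2 * (Complex.normSq B - Complex.normSq p) / 2 = μ ∧
      EqOn z (lcOrbit Ω p B) (Icc 0 c') := fun c' hc' =>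
    eqOn_lcOrbit_of_keplerAt hΩ hμ0 hc'.1
      (fun s hs => (hz s ⟨hs.1, hs.2.trans_lt hc'.2⟩).mono (Icc_subset_Icc_right hc'.2.le)) hp
  have hBk : Complex.normSq B - Complex.normSq p = k := by
    have h1 := (hloc 0 ⟨le_rfl, hc⟩).1
    rw [← hμ] at h1
    have h2 : 0 < Ω ^ 2 := by positivity
    exact mul_left_cancel₀ h2.ne' (by linarith)
  have hBlt : Complex.normSq p < Complex.normSq B := by linarith
  have hIco : EqOn z (lcOrbit Ω p B) (Ico 0 c) := fun s hs => (hloc s hs).2 ⟨hs.1, le_rfl⟩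
  -- Before the collision the solution is classical; both curves are continuous, so the identity
  -- extends to the collision instant. That makes the arc the solution of the fixed ends problem
  -- from p to 0.
  have hIcc : EqOn z (lcOrbit Ω p B) (Icc 0 c) := by
    have := hIco.of_subset_closure (t := Icc 0 c) hcont
      (continuous_lcOrbit hΩ hBlt).continuousOn Ico_subset_Icc_self
      (by rw [closure_Ico hc.ne])
    exact this
  have hw : lcW Ω p B (lcClock Ω p B c) = 0 := by
    have h1 := hIcc (right_mem_Icc.2 hc.le)
    rw [hzc, lcOrbit] at h1
    exact pow_eq_zero_iff two_ne_zero |>.1 h1.symm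
  have hpos : 0 < lcClock Ω p B c := by
    rw [← lcClock_zero hΩ hBlt]; exact strictMono_lcClock hΩ hBlt hc
  obtain ⟨-, h1, h2⟩ := bvp_unique hk hΩ hBk hpos hw
  rw [← h2, ← h1]
  exact ⟨lcTime_lcClock hΩ hBlt c, hIcc⟩

/-- The ejection-collision solutions with both ends at `p²` are determined by `p`. -/
lemma ejectionCollision_arc {E h μ Ω k T : ℝ} (hΩ : 0 < Ω) (hk : 0 < k)
    (hE : Ω ^ 2 / 2 = E + h) (hμ : Ω ^ 2 * k / 2 = μ) {z : ℝ → ℂ} {p : ℂ} (h0 : z 0 = p ^ 2)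
    (hT : z T = p ^ 2) (hz : IsEjectionCollision E h μ T z) :
    T = 2 * lcTime Ω p (bvpCoeff k p 0) (bvpTime Ω k p 0) ∧
      ∀ s ∈ Icc 0 T, z s = lcOrbit Ω p (bvpCoeff k p 0) (min s (T - s)) := by
  obtain ⟨hcont, c, hc, hzc, hsol⟩ := hz
  have hK : ∀ s ∈ Icc 0 T, s ≠ c → KeplerAt Ω μ (Icc 0 T) z (derivWithin z (Icc 0 T)) s :=
    fun s hs hsc => (hsol s hs hsc).2.keplerAt hE (hsol s hs hsc).1
  obtain ⟨a1, a2⟩ := collision_arc hΩ hk hμ hc.1 (hcont.mono (Icc_subset_Icc_right hc.2.le)) hzc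
    (fun s hs => (hK s ⟨hs.1, by linarith [hs.2, hc.2]⟩ hs.2.ne).mono
      (Icc_subset_Icc_right hc.2.le)) h0.symm
  have hc' : 0 < T - c := sub_pos.2 hc.2
  -- The second half read backwards solves the same problem from p to 0. Uniqueness forces c = T - c
  -- and makes the solution symmetric about the collision.
  obtain ⟨b1, b2⟩ := collision_arc (c := T - c) (z := fun s => z (T - s))
    (v := fun s => -derivWithin z (Icc 0 T) (T - s)) hΩ hk hμ hc'
    (hcont.comp (by fun_prop) fun s hs => ⟨by linarith [hs.2, hc.1], by linarith [hs.1]⟩)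
    (by simpa using hzc)
    (fun s hs => (hK (T - s) ⟨by linarith [hs.2, hc.1], by linarith [hs.1]⟩
      (by have := hs.2; intro h; linarith)).reverse (by linarith [hc.1])) (p := p) (by simp [hT])
  rw [a1] at b1
  refine ⟨by rw [a1]; linarith, fun s hs => ?_⟩
  rcases le_total s (T - s) with h | h
  · rw [min_eq_left h]; exact a2 ⟨hs.1, by linarith⟩
  · rw [min_eq_right h]
    have := b2 (x := T - s) ⟨by linarith [hs.2], by linarith⟩
    simpa using this

/-! ### Smooth dependence -/

lemma contDiff_re {n : WithTop ℕ∞} : ContDiff ℝ n Complex.re := Complex.reCLM.contDiff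
lemma contDiff_im {n : WithTop ℕ∞} : ContDiff ℝ n Complex.im := Complex.imCLM.contDiff
lemma contDiff_ofReal {n : WithTop ℕ∞} : ContDiff ℝ n Complex.ofReal := Complex.ofRealCLM.contDiff

lemma contDiff_normSq {n : WithTop ℕ∞} : ContDiff ℝ n fun z : ℂ => Complex.normSq z := by
  simp only [Complex.normSq_apply]
  exact (contDiff_re.mul contDiff_re).add (contDiff_im.mul contDiff_im)

lemma contDiff_dot {n : WithTop ℕ∞} : ContDiff ℝ n fun x : ℂ × ℂ => dot x.1 x.2 := by
  simp only [dot]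
  exact ((contDiff_re.comp contDiff_fst).mul (contDiff_re.comp contDiff_snd)).add
    ((contDiff_im.comp contDiff_fst).mul (contDiff_im.comp contDiff_snd))

lemma contDiff_lcW {n : WithTop ℕ∞} (Ω : ℝ) :
    ContDiff ℝ n fun x : ℝ × ℂ × ℂ => lcW Ω x.2.1 x.2.2 x.1 := by
  have h : ContDiff ℝ n fun x : ℝ × ℂ × ℂ => Ω * x.1 := contDiff_const.mul contDiff_fst
  have hA : ContDiff ℝ n fun x : ℝ × ℂ × ℂ => x.2.1 := contDiff_snd.fst
  have hB : ContDiff ℝ n fun x : ℝ × ℂ × ℂ => x.2.2 := contDiff_snd.snd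
  exact ((contDiff_ofReal.comp h.cosh).mul hA).add ((contDiff_ofReal.comp h.sinh).mul hB)

lemma contDiff_lcTime {n : WithTop ℕ∞} (Ω : ℝ) :
    ContDiff ℝ n fun x : ℝ × ℂ × ℂ => lcTime Ω x.2.1 x.2.2 x.1 := by
  have h : ContDiff ℝ n fun x : ℝ × ℂ × ℂ => 2 * (Ω * x.1) :=
    contDiff_const.mul (contDiff_const.mul contDiff_fst)
  have hA : ContDiff ℝ n fun x : ℝ × ℂ × ℂ => Complex.normSq x.2.1 :=
    contDiff_normSq.comp contDiff_snd.fst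
  have hB : ContDiff ℝ n fun x : ℝ × ℂ × ℂ => Complex.normSq x.2.2 :=
    contDiff_normSq.comp contDiff_snd.snd
  have hAB : ContDiff ℝ n fun x : ℝ × ℂ × ℂ => dot x.2.1 x.2.2 := contDiff_dot.comp contDiff_snd
  exact (((((hA.add hB).div_const 2).mul h.sinh).add
    (hAB.mul (h.cosh.sub contDiff_const))).div_const Ω).sub ((hB.sub hA).mul contDiff_fst)

/-- Away from collisions the Levi-Civita time is a smooth function of the physical time and of
the initial data. -/
lemma contDiffAt_lcClock {Ω : ℝ} (hΩ : 0 < Ω) {A B : ℂ}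
    (hk : Complex.normSq A < Complex.normSq B) {s : ℝ} (hs : lcOrbit Ω A B s ≠ 0) :
    ContDiffAt ℝ 1 (fun x : ℝ × ℂ × ℂ => lcClock Ω x.2.1 x.2.2 x.1) (s, A, B) := by
  set t := lcClock Ω A B s with ht
  set F : (ℝ × ℂ × ℂ) × ℝ → ℝ := fun x => lcTime Ω x.1.2.1 x.1.2.2 x.2 - x.1.1 with hF
  have hFc : ContDiff ℝ 1 F :=
    ((contDiff_lcTime Ω).comp (contDiff_snd.prodMk contDiff_fst.snd)).sub contDiff_fst.fst
  set u : (ℝ × ℂ × ℂ) × ℝ := ((s, A, B), t) with hu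
  have hFu : F u = 0 := by simp [hF, hu, ht, lcTime_lcClock hΩ hk]
  -- The partial derivative in the Levi-Civita time is 2|z|, which is invertible away from
  -- collisions.
  have hder : (fderiv ℝ F u ∘L .inr ℝ (ℝ × ℂ × ℂ) ℝ) 1 = 2 * ‖lcOrbit Ω A B s‖ := by
    have h1 : HasFDerivAt F (fderiv ℝ F u) u := (hFc.differentiable one_ne_zero u).hasFDerivAt
    have h2 : HasDerivAt (fun y : ℝ => ((s, A, B), y)) ((0, 1) : (ℝ × ℂ × ℂ) × ℝ) t :=
      (hasDerivAt_const t (s, A, B)).prodMk (hasDerivAt_id t)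
    have h3 := h1.comp_hasDerivAt t h2
    have h4 : HasDerivAt (F ∘ fun y : ℝ => ((s, A, B), y))
        (2 * Complex.normSq (lcW Ω A B t)) t :=
      (hasDerivAt_lcTime hΩ A B t).sub_const s
    rw [norm_lcOrbit]
    exact (by simp : _ = _).trans (h4.unique h3).symm
  have hne : 2 * ‖lcOrbit Ω A B s‖ ≠ 0 := mul_ne_zero two_ne_zero (norm_ne_zero_iff.2 hs)
  have hinv : (fderiv ℝ F u ∘L .inr ℝ (ℝ × ℂ × ℂ) ℝ).IsInvertible := by
    refine ⟨ContinuousLinearEquiv.unitsEquivAut ℝ (Units.mk0 _ hne), ?_⟩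
    ext
    rw [hder]; simp
  have hψ := hFc.contDiffAt.contDiffAt_implicitFunction (u := u) one_ne_zero hinv
  refine hψ.congr_of_eventuallyEq ?_
  -- Where |A| < |B| the time change is injective, so the local implicit function can only be the
  -- clock; this condition is open.
  have hopen : ∀ᶠ x in 𝓝 (s, A, B), Complex.normSq x.2.1 < Complex.normSq x.2.2 := by
    have hc1 : Continuous fun x : ℝ × ℂ × ℂ => Complex.normSq x.2.1 :=
      Complex.continuous_normSq.comp continuous_snd.fst
    have hc2 : Continuous fun x : ℝ × ℂ × ℂ => Complex.normSq x.2.2 :=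
      Complex.continuous_normSq.comp continuous_snd.snd
    exact (hc1.tendsto _).eventually_lt (hc2.tendsto _) hk
  filter_upwards [hopen, hFc.contDiffAt.eventually_apply_implicitFunction (u := u) one_ne_zero hinv]
    with x hx1 hx2
  rw [hFu] at hx2
  exact lcClock_eq hΩ hx1 (by simpa [hF, sub_eq_zero] using hx2)

lemma contDiffAt_lcOrbit {Ω : ℝ} (hΩ : 0 < Ω) {A B : ℂ}
    (hk : Complex.normSq A < Complex.normSq B) {s : ℝ} (hs : lcOrbit Ω A B s ≠ 0) :
    ContDiffAt ℝ 1 (fun x : ℝ × ℂ × ℂ => lcOrbit Ω x.2.1 x.2.2 x.1) (s, A, B) :=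
  ((contDiff_lcW Ω).contDiffAt.comp (s, A, B)
    ((contDiffAt_lcClock hΩ hk hs).prodMk contDiff_snd.contDiffAt)).pow 2

lemma contDiff_bvpCosh {n : WithTop ℕ∞} {k : ℝ} (hk : 0 < k) :
    ContDiff ℝ n fun x : ℂ × ℂ => bvpCosh k x.1 x.2 := by
  have h1 : ContDiff ℝ n fun x : ℂ × ℂ => Complex.normSq x.1 := contDiff_normSq.comp contDiff_fst
  have h2 : ContDiff ℝ n fun x : ℂ × ℂ => Complex.normSq x.2 := contDiff_normSq.comp contDiff_snd
  exact ((((contDiff_dot.pow 2).add (contDiff_const.mul ((contDiff_const.add h1).add h2))).sqrt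
    fun x => (bvpCosh_disc_nonneg hk).ne').sub contDiff_dot).div_const k

lemma contDiffAt_bvpSinh {n : WithTop ℕ∞} {k : ℝ} (hk : 0 < k) {p r : ℂ} (hpr : p ≠ r) :
    ContDiffAt ℝ n (fun x : ℂ × ℂ => bvpSinh k x.1 x.2) (p, r) := by
  have h := one_lt_bvpCosh hk hpr
  exact (((contDiff_bvpCosh hk).contDiffAt.pow 2).sub contDiffAt_const).sqrt
    (ne_of_gt (by simp only []; nlinarith))

lemma contDiffAt_bvpTime {n : WithTop ℕ∞} (Ω : ℝ) {k : ℝ} (hk : 0 < k) {p r : ℂ} (hpr : p ≠ r) :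
    ContDiffAt ℝ n (fun x : ℂ × ℂ => bvpTime Ω k x.1 x.2) (p, r) :=
  (Real.contDiff_arsinh.contDiffAt.comp (p, r) (contDiffAt_bvpSinh hk hpr)).div_const Ω

lemma contDiffAt_bvpCoeff {n : WithTop ℕ∞} {k : ℝ} (hk : 0 < k) {p r : ℂ} (hpr : p ≠ r) :
    ContDiffAt ℝ n (fun x : ℂ × ℂ => bvpCoeff k x.1 x.2) (p, r) := by
  have h1 : ContDiffAt ℝ n (fun x : ℂ × ℂ => x.2 - (bvpCosh k x.1 x.2 : ℂ) * x.1) (p, r) :=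
    contDiffAt_snd.sub ((contDiff_ofReal.contDiffAt.comp (p, r)
      (contDiff_bvpCosh hk).contDiffAt).mul contDiffAt_fst)
  have h2 : ContDiffAt ℝ n (fun x : ℂ × ℂ => (bvpSinh k x.1 x.2 : ℂ)) (p, r) :=
    contDiff_ofReal.contDiffAt.comp (p, r) (contDiffAt_bvpSinh hk hpr)
  simp only [bvpCoeff, div_eq_mul_inv]
  exact h1.mul (h2.inv (by simpa using (bvpSinh_pos hk hpr).ne'))

/-! ### Boundaries close to the unit circle -/

/-- A polar radius which is `C²`-close to `1`. -/
structure NearCircle (κ : ℝ) (ρ : ℝ → ℝ) : Prop where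
  smooth : ContDiff ℝ 2 ρ
  periodic : Function.Periodic ρ (2 * Real.pi)
  near : ∀ ξ, |ρ ξ - 1| ≤ κ
  deriv_le : ∀ ξ, |deriv ρ ξ| ≤ κ
  deriv2_le : ∀ ξ, |deriv (deriv ρ) ξ| ≤ κ

/-- A continuous function on a strip, periodic in the first variable, is bounded on compact
substrips. -/
lemma exists_bound_of_periodic {c : ℝ} {G : ℝ × ℝ → ℝ}
    (hG : ContinuousOn G (univ ×ˢ Icc (-c) c))
    (hper : ∀ ε ∈ Icc (-c) c, Function.Periodic (fun ξ => G (ξ, ε)) (2 * Real.pi)) :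
    ∃ M, ∀ ξ, ∀ ε ∈ Icc (-c) c, |G (ξ, ε)| ≤ M := by
  obtain ⟨M, hM⟩ := (isCompact_Icc (a := (0 : ℝ)) (b := 2 * Real.pi)).prod
    (isCompact_Icc (a := -c) (b := c)) |>.exists_bound_of_continuousOn
    (hG.mono (prod_mono (subset_univ _) le_rfl))
  refine ⟨M, fun ξ ε hε => ?_⟩
  obtain ⟨y, hy, hy'⟩ := (hper ε hε).exists_mem_Ico₀ Real.two_pi_pos ξ
  have := hM (y, ε) ⟨Ico_subset_Icc_self hy, hε⟩
  rw [Real.norm_eq_abs] at this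
  rwa [hy']

lemma periodic_deriv {g : ℝ → ℝ} {c : ℝ} (hg : Function.Periodic g c) :
    Function.Periodic (deriv g) c := by
  intro x
  rw [← deriv_comp_add_const]
  congr 1
  exact funext hg

/-- By periodicity and compactness f and its first two angular derivatives are bounded on a strip,
and the factor ε makes them small. -/
lemma exists_nearCircle {Cε : ℝ} (hCε : 0 < Cε) {f : ℝ → ℝ → ℝ}
    (hper : ∀ ε ∈ Icc (-Cε) Cε, Function.Periodic (fun ξ => f ξ ε) (2 * Real.pi))
    (hf : ContDiffOn ℝ 2 (fun p : ℝ × ℝ => f p.1 p.2) (univ ×ˢ Icc (-Cε) Cε))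
    {κ : ℝ} (hκ : 0 < κ) :
    ∃ ε₀, 0 < ε₀ ∧ ε₀ ≤ Cε ∧ ∀ ε, |ε| < ε₀ → NearCircle κ (fun ξ => 1 + ε * f ξ ε) := by
  set F : ℝ × ℝ → ℝ := fun p => f p.1 p.2 with hF
  set U : Set (ℝ × ℝ) := univ ×ˢ Ioo (-Cε) Cε with hU
  have hUo : IsOpen U := isOpen_univ.prod isOpen_Ioo
  have hFU : ContDiffOn ℝ 2 F U := hf.mono (prod_mono le_rfl Ioo_subset_Icc_self)
  set G : ℝ × ℝ → ℝ := fun p => fderiv ℝ F p (1, 0) with hG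
  have hGU : ContDiffOn ℝ 1 G U :=
    (hFU.fderiv_of_isOpen hUo (m := 1) (by norm_num)).clm_apply contDiffOn_const
  set H : ℝ × ℝ → ℝ := fun p => fderiv ℝ G p (1, 0) with hH
  have hHU : ContDiffOn ℝ 0 H U :=
    (hGU.fderiv_of_isOpen hUo (m := 0) (by norm_num)).clm_apply contDiffOn_const
  have hline : ∀ ξ ε : ℝ, HasDerivAt (fun x : ℝ => (x, ε)) ((1, 0) : ℝ × ℝ) ξ := fun ξ ε =>
    (hasDerivAt_id ξ).prodMk (hasDerivAt_const ξ ε)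
  have hdF : ∀ ξ, ∀ ε ∈ Ioo (-Cε) Cε, HasDerivAt (fun x => f x ε) (G (ξ, ε)) ξ := by
    intro ξ ε hε
    have h1 : DifferentiableAt ℝ F (ξ, ε) :=
      (hFU.contDiffAt (hUo.mem_nhds ⟨mem_univ _, hε⟩)).differentiableAt (by norm_num)
    exact h1.hasFDerivAt.comp_hasDerivAt ξ (hline ξ ε)
  have hdG : ∀ ξ, ∀ ε ∈ Ioo (-Cε) Cε, HasDerivAt (fun x => G (x, ε)) (H (ξ, ε)) ξ := by
    intro ξ ε hε
    have h1 : DifferentiableAt ℝ G (ξ, ε) :=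
      (hGU.contDiffAt (hUo.mem_nhds ⟨mem_univ _, hε⟩)).differentiableAt (by norm_num)
    exact h1.hasFDerivAt.comp_hasDerivAt ξ (hline ξ ε)
  have hderF : ∀ ε ∈ Ioo (-Cε) Cε, deriv (fun x => f x ε) = fun x => G (x, ε) :=
    fun ε hε => funext fun ξ => (hdF ξ ε hε).deriv
  have hderG : ∀ ε ∈ Ioo (-Cε) Cε, deriv (fun x => G (x, ε)) = fun x => H (x, ε) :=
    fun ε hε => funext fun ξ => (hdG ξ ε hε).deriv
  have hpG : ∀ ε ∈ Ioo (-Cε) Cε, Function.Periodic (fun x => G (x, ε)) (2 * Real.pi) :=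
    fun ε hε => by
      rw [← hderF ε hε]; exact periodic_deriv (hper ε (Ioo_subset_Icc_self hε))
  have hpH : ∀ ε ∈ Ioo (-Cε) Cε, Function.Periodic (fun x => H (x, ε)) (2 * Real.pi) :=
    fun ε hε => by rw [← hderG ε hε]; exact periodic_deriv (hpG ε hε)
  -- The total derivatives are continuous on the open strip only, so the bounds are taken on a
  -- compact strip of half the width.
  have hsub : Icc (-(Cε / 2)) (Cε / 2) ⊆ Ioo (-Cε) Cε := fun x hx =>
    ⟨by linarith [hx.1], by linarith [hx.2]⟩
  have hsub' : (univ ×ˢ Icc (-(Cε / 2)) (Cε / 2) : Set (ℝ × ℝ)) ⊆ U := prod_mono le_rfl hsub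
  obtain ⟨M₀, hM₀⟩ := exists_bound_of_periodic (hFU.continuousOn.mono hsub')
    fun ε hε => hper ε (Ioo_subset_Icc_self (hsub hε))
  obtain ⟨M₁, hM₁⟩ := exists_bound_of_periodic (hGU.continuousOn.mono hsub')
    fun ε hε => hpG ε (hsub hε)
  obtain ⟨M₂, hM₂⟩ := exists_bound_of_periodic (hHU.continuousOn.mono hsub')
    fun ε hε => hpH ε (hsub hε)
  set M := |M₀| + |M₁| + |M₂| + 1 with hM
  have hMpos : 0 < M := by positivity
  refine ⟨min (Cε / 2) (κ / M), by positivity, (min_le_left _ _).trans (by linarith), ?_⟩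
  intro ε hε
  have hε1 : ε ∈ Icc (-(Cε / 2)) (Cε / 2) :=
    abs_le.1 (hε.le.trans (min_le_left _ _))
  have hε2 : |ε| * M ≤ κ := (le_div_iff₀ hMpos).1 (hε.le.trans (min_le_right _ _))
  have hbound : ∀ x : ℝ, |x| ≤ M → |ε * x| ≤ κ := fun x hx => by
    rw [abs_mul]; exact (mul_le_mul_of_nonneg_left hx (abs_nonneg ε)).trans hε2
  have d1 : deriv (fun ξ => 1 + ε * f ξ ε) = fun ξ => ε * G (ξ, ε) :=
    funext fun ξ => (((hdF ξ ε (hsub hε1)).const_mul ε).const_add 1).deriv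
  have d2 : deriv (fun ξ => ε * G (ξ, ε)) = fun ξ => ε * H (ξ, ε) :=
    funext fun ξ => ((hdG ξ ε (hsub hε1)).const_mul ε).deriv
  refine ⟨?_, ?_, ?_, ?_, ?_⟩
  · have h1 : ContDiff ℝ 2 fun ξ : ℝ => F (ξ, ε) := by
      rw [← contDiffOn_univ]
      exact hFU.comp (contDiff_id.prodMk contDiff_const).contDiffOn
        fun x _ => ⟨mem_univ _, hsub hε1⟩
    exact contDiff_const.add (contDiff_const.mul h1)
  · intro ξ
    have h1 : f (ξ + 2 * Real.pi) ε = f ξ ε := hper ε (Ioo_subset_Icc_self (hsub hε1)) ξ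
    simp only [h1]
  · intro ξ
    rw [add_sub_cancel_left]
    refine hbound _ ((hM₀ ξ ε hε1).trans ?_)
    linarith [le_abs_self M₀, abs_nonneg M₁, abs_nonneg M₂]
  · intro ξ
    rw [d1]
    refine hbound _ ((hM₁ ξ ε hε1).trans ?_)
    linarith [le_abs_self M₁, abs_nonneg M₀, abs_nonneg M₂]
  · intro ξ
    rw [d1, d2]
    refine hbound _ ((hM₂ ξ ε hε1).trans ?_)
    linarith [le_abs_self M₂, abs_nonneg M₀, abs_nonneg M₁]

/-- The closed curve with polar radius `ρ`. -/
def polarCurve (ρ : ℝ → ℝ) (ξ : ℝ) : ℂ := (ρ ξ : ℂ) * Complex.exp (ξ * Complex.I)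

/-- The square root of `polarCurve` with argument `ξ / 2`. -/
def polarSqrt (ρ : ℝ → ℝ) (ξ : ℝ) : ℂ := (√(ρ ξ) : ℂ) * Complex.exp ((ξ / 2 : ℝ) * Complex.I)

lemma exp_half_sq (ξ : ℝ) :
    Complex.exp ((ξ / 2 : ℝ) * Complex.I) ^ 2 = Complex.exp (ξ * Complex.I) := by
  rw [← Complex.exp_nat_mul]; congr 1; push_cast; ring

/-- The domain is defined with the principal argument; periodicity of ρ allows any real lift of the
angle in its place. -/
lemma arg_polar {ρ : ℝ → ℝ} (hρ : Function.Periodic ρ (2 * Real.pi)) {x : ℝ} (hx : 0 < x) (θ : ℝ) :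
    ρ (Complex.arg (x * Complex.exp (θ * Complex.I))) = ρ θ := by
  set z : ℂ := x * Complex.exp (θ * Complex.I) with hz
  have hn : ‖z‖ = x := by
    rw [hz, norm_mul, Complex.norm_exp_ofReal_mul_I, Complex.norm_real, mul_one,
      Real.norm_of_nonneg hx.le]
  have h1 := Complex.norm_mul_exp_arg_mul_I z
  rw [hn] at h1
  nth_rewrite 2 [hz] at h1
  have h2 := mul_left_cancel₀ (by exact_mod_cast hx.ne') h1
  obtain ⟨n, hn⟩ := Complex.exp_eq_exp_iff_exists_int.1 h2
  have h3 : ((Complex.arg z : ℝ) : ℂ) = ((θ + n * (2 * Real.pi) : ℝ) : ℂ) := by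
    push_cast
    apply mul_right_cancel₀ Complex.I_ne_zero
    rw [hn]; ring
  rw [Complex.ofReal_injective h3]
  exact hρ.int_mul n θ

namespace NearCircle

variable {κ : ℝ} {ρ : ℝ → ℝ} (hρ : NearCircle κ ρ)
include hρ

lemma differentiable : Differentiable ℝ ρ := hρ.smooth.differentiable (by norm_num)

lemma lipschitz (x y : ℝ) : |ρ x - ρ y| ≤ κ * |x - y| :=
  convex_univ.norm_image_sub_le_of_norm_deriv_le (fun x _ => hρ.differentiable x)
    (fun x _ => hρ.deriv_le x) (mem_univ y) (mem_univ x)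

lemma pos (hκ : κ < 1) (ξ : ℝ) : 0 < ρ ξ := by linarith [(abs_le.1 (hρ.near ξ)).1]

lemma polarSqrt_sq (hκ : κ < 1) (ξ : ℝ) : polarSqrt ρ ξ ^ 2 = polarCurve ρ ξ := by
  rw [polarSqrt, mul_pow, exp_half_sq, polarCurve]
  congr 1
  exact_mod_cast Real.sq_sqrt (hρ.pos hκ ξ).le

lemma polarCurve_ne_zero (hκ : κ < 1) (ξ : ℝ) : polarCurve ρ ξ ≠ 0 :=
  mul_ne_zero (by exact_mod_cast (hρ.pos hκ ξ).ne') (Complex.exp_ne_zero _)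

lemma polarSqrt_ne_zero (hκ : κ < 1) (ξ : ℝ) : polarSqrt ρ ξ ≠ 0 :=
  mul_ne_zero (by exact_mod_cast (Real.sqrt_pos.2 (hρ.pos hκ ξ)).ne') (Complex.exp_ne_zero _)

lemma contDiff_polarSqrt (hκ : κ < 1) : ContDiff ℝ 1 (polarSqrt ρ) := by
  have h1 : ContDiff ℝ 1 ρ := hρ.smooth.of_le (by norm_num)
  have h2 : ContDiff ℝ 1 fun ξ : ℝ => ((ξ / 2 : ℝ) : ℂ) * Complex.I :=
    (contDiff_ofReal.comp (contDiff_id.div_const 2)).mul contDiff_const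
  exact (contDiff_ofReal.comp (h1.sqrt fun ξ => (hρ.pos hκ ξ).ne')).mul h2.cexp

lemma hasDerivAt_polarCurve (ξ : ℝ) : HasDerivAt (polarCurve ρ)
    (((deriv ρ ξ : ℝ) + (ρ ξ : ℝ) * Complex.I) * Complex.exp (ξ * Complex.I)) ξ := by
  have h1 := (hρ.differentiable ξ).hasDerivAt.ofReal_comp
  have h2 : HasDerivAt (fun ξ : ℝ => (ξ : ℂ) * Complex.I) Complex.I ξ := by
    simpa using (hasDerivAt_id ξ).ofReal_comp.mul_const Complex.I
  exact (h1.mul h2.cexp).congr_deriv (by ring)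

end NearCircle

/-! ### Geometry of the inner arcs -/

/-- Jordan's inequality |sin x| ≥ (2/π)|x| on [-π/2, π/2], applied to sin(arg u) = Im u / |u|. -/
lemma abs_arg_le {u : ℂ} (h : 0 ≤ u.re) : |u.arg| ≤ Real.pi / 2 * (|u.im| / ‖u‖) := by
  have h1 : |u.arg| ≤ Real.pi / 2 := Complex.abs_arg_le_pi_div_two_iff.2 h
  have h2 := Real.mul_abs_le_abs_sin h1
  rw [Complex.sin_arg, abs_div, abs_norm] at h2
  have hpi := Real.pi_pos
  calc |u.arg| = Real.pi / 2 * (2 / Real.pi * |u.arg|) := by field_simp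
    _ ≤ _ := by gcongr

lemma NearCircle.polarSqrt_ratio {ρ : ℝ → ℝ} (hρ : NearCircle (1 / 100) ρ) (ξ₀ ξ₁ : ℝ) :
    ∃ m : ℝ, 9 / 10 ≤ m ∧ m ≤ 11 / 10 ∧ m ^ 2 = ρ ξ₁ / ρ ξ₀ ∧
      polarSqrt ρ ξ₁ = polarSqrt ρ ξ₀ * (m * Complex.exp (((ξ₁ - ξ₀) / 2 : ℝ) * Complex.I)) := by
  have h0 := abs_le.1 (hρ.near ξ₀)
  have h1 := abs_le.1 (hρ.near ξ₁)
  have p0 := hρ.pos (by norm_num) ξ₀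
  have p1 := hρ.pos (by norm_num) ξ₁
  have s0 := Real.sqrt_pos.2 p0
  have hm : (√(ρ ξ₁) / √(ρ ξ₀)) ^ 2 = ρ ξ₁ / ρ ξ₀ := by
    rw [div_pow, Real.sq_sqrt p0.le, Real.sq_sqrt p1.le]
  have hm0 : 0 ≤ √(ρ ξ₁) / √(ρ ξ₀) := by positivity
  refine ⟨√(ρ ξ₁) / √(ρ ξ₀), ?_, ?_, hm, ?_⟩
  · apply le_of_sq_le_sq _ hm0
    rw [hm, le_div_iff₀ p0]; nlinarith
  · apply le_of_sq_le_sq _ (by norm_num)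
    rw [hm, div_le_iff₀ p0]; nlinarith
  · have hs : (√(ρ ξ₀) : ℂ) ≠ 0 := by exact_mod_cast s0.ne'
    rw [polarSqrt, polarSqrt, show ((ξ₁ / 2 : ℝ) : ℂ) * Complex.I
      = ((ξ₀ / 2 : ℝ) : ℂ) * Complex.I + (((ξ₁ - ξ₀) / 2 : ℝ) : ℂ) * Complex.I by push_cast; ring,
      Complex.exp_add]
    push_cast
    field_simp

lemma polar_re_im {m η : ℝ} (hm : 9 / 10 ≤ m) (hm' : m ≤ 11 / 10) (hη : |η| < 1 / 10) :
    89 / 100 ≤ (m * Complex.exp ((η / 2 : ℝ) * Complex.I)).re ∧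
      |(m * Complex.exp ((η / 2 : ℝ) * Complex.I)).im| ≤ 6 / 100 := by
  have e1 : (m * Complex.exp ((η / 2 : ℝ) * Complex.I)).re = m * Real.cos (η / 2) := by
    rw [Complex.re_ofReal_mul, Complex.exp_ofReal_mul_I_re]
  have e2 : (m * Complex.exp ((η / 2 : ℝ) * Complex.I)).im = m * Real.sin (η / 2) := by
    rw [Complex.im_ofReal_mul, Complex.exp_ofReal_mul_I_im]
  have h1 := Real.one_sub_sq_div_two_le_cos (x := η / 2)
  have h2 := Real.abs_sin_le_abs (x := η / 2)
  rw [abs_div, abs_two] at h2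
  have h3 : η ^ 2 ≤ 1 / 100 := by
    rw [← sq_abs]; nlinarith [abs_nonneg η]
  rw [e1, e2, abs_mul, abs_of_nonneg (by linarith : 0 ≤ m)]
  constructor
  · nlinarith
  · nlinarith [abs_nonneg (Real.sin (η / 2))]

/-- The lifted point is u times the square root of γ(ξ₀), so z has angle ξ₀ + 2 arg u and modulus
ρ(ξ₀)|u|². If |u|² is not below 9/10, then |u|² ≤ 1 - (18/10) b while |arg u| ≤ b: the modulus drops
by a fixed multiple of b, and the radius of the boundary varies by at most (2/100) b. -/
lemma NearCircle.inside_of_re_nonneg {ρ : ℝ → ℝ} (hρ : NearCircle (1 / 100) ρ) {ξ₀ a b : ℝ}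
    (hb : 0 < b) (hab : a + b < 1) {q : ℂ} (hq : 89 / 100 ≤ q.re) (hq' : |q.im| ≤ 6 / 100)
    (hu : 0 ≤ (a - b * q : ℂ).re) :
    ‖(polarSqrt ρ ξ₀ * (a - b * q)) ^ 2‖ < ρ (Complex.arg ((polarSqrt ρ ξ₀ * (a - b * q)) ^ 2)) := by
  set u : ℂ := a - b * q with hudef
  have hre : u.re = a - b * q.re := by simp [hudef]
  have him : u.im = -(b * q.im) := by simp [hudef]
  have h0 := abs_le.1 (hρ.near ξ₀)
  have p0 := hρ.pos (by norm_num) ξ₀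
  have hnorm : ‖(polarSqrt ρ ξ₀ * u) ^ 2‖ = ρ ξ₀ * ‖u‖ ^ 2 := by
    rw [mul_pow, hρ.polarSqrt_sq (by norm_num), norm_mul, polarCurve, norm_mul,
      Complex.norm_exp_ofReal_mul_I, Complex.norm_real, Real.norm_of_nonneg p0.le, norm_pow, mul_one]
  have hnu : ‖u‖ ^ 2 = (a - b * q.re) ^ 2 + b ^ 2 * |q.im| ^ 2 := by
    rw [← Complex.normSq_eq_norm_sq, Complex.normSq_apply, hre, him, sq_abs]; ring
  rcases lt_or_ge (‖u‖ ^ 2) (9 / 10) with hsmall | hlarge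
  · have h1 := abs_le.1 (hρ.near (Complex.arg ((polarSqrt ρ ξ₀ * u) ^ 2)))
    rw [hnorm]
    nlinarith
  · have hupos : 0 < ‖u‖ := by
      by_contra h
      have : ‖u‖ = 0 := le_antisymm (not_lt.1 h) (norm_nonneg _)
      rw [this] at hlarge; norm_num at hlarge
    have hu9 : 9 / 10 ≤ ‖u‖ := by
      by_contra h
      nlinarith
    have harg : (polarSqrt ρ ξ₀ * u) ^ 2
        = ((ρ ξ₀ * ‖u‖ ^ 2 : ℝ) : ℂ) * Complex.exp ((ξ₀ + 2 * u.arg : ℝ) * Complex.I) := by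
      rw [mul_pow, hρ.polarSqrt_sq (by norm_num), polarCurve]
      nth_rewrite 1 [← Complex.norm_mul_exp_arg_mul_I u]
      rw [mul_pow, ← Complex.exp_nat_mul]
      push_cast
      rw [add_mul, Complex.exp_add]
      ring_nf
    have hval : ρ (Complex.arg ((polarSqrt ρ ξ₀ * u) ^ 2)) = ρ (ξ₀ + 2 * u.arg) := by
      rw [harg]; exact arg_polar hρ.periodic (by positivity) _
    rw [hnorm, hval]
    have hl := abs_le.1 (hρ.lipschitz (ξ₀ + 2 * u.arg) ξ₀)
    have ha := abs_arg_le hu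
    rw [him, abs_neg, abs_mul, abs_of_pos hb] at ha
    have h2 : b * |q.im| / ‖u‖ ≤ b * (1 / 10) := by
      rw [div_le_iff₀ hupos]; nlinarith [abs_nonneg q.im]
    have h3 : |u.arg| ≤ b := by
      have := Real.pi_lt_d2
      have := Real.pi_pos
      nlinarith
    rw [add_sub_cancel_left, abs_mul, abs_two] at hl
    rw [hre] at hu
    have hq2 : |q.im| ^ 2 ≤ 36 / 10000 := by nlinarith [abs_nonneg q.im]
    have h4 : a - b * q.re ≤ 1 - 189 / 100 * b := by nlinarith
    have h5 : (a - b * q.re) ^ 2 ≤ (1 - 189 / 100 * b) ^ 2 := by gcongr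
    have h6 : b ^ 2 * |q.im| ^ 2 ≤ b ^ 2 * (36 / 10000) := by gcongr
    have h7 : ‖u‖ ^ 2 ≤ 1 - 18 / 10 * b := by nlinarith
    nlinarith

lemma NearCircle.inside {ρ : ℝ → ℝ} (hρ : NearCircle (1 / 100) ρ) {ξ₀ ξ₁ a b : ℝ}
    (hξ : |ξ₀ - ξ₁| < 1 / 10) (ha : 0 < a) (hb : 0 < b) (hab : a + b < 1) :
    ‖(a * polarSqrt ρ ξ₀ + b * -polarSqrt ρ ξ₁) ^ 2‖
      < ρ (Complex.arg ((a * polarSqrt ρ ξ₀ + b * -polarSqrt ρ ξ₁) ^ 2)) := by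
  obtain ⟨m, hm1, hm2, -, hq⟩ := hρ.polarSqrt_ratio ξ₀ ξ₁
  obtain ⟨m', hm1', hm2', -, hq'⟩ := hρ.polarSqrt_ratio ξ₁ ξ₀
  obtain ⟨r1, r2⟩ := polar_re_im hm1 hm2 (by rwa [abs_sub_comm] at hξ : |ξ₁ - ξ₀| < 1 / 10)
  obtain ⟨r1', r2'⟩ := polar_re_im hm1' hm2' hξ
  set q : ℂ := m * Complex.exp (((ξ₁ - ξ₀) / 2 : ℝ) * Complex.I) with hqd
  set q' : ℂ := m' * Complex.exp (((ξ₀ - ξ₁) / 2 : ℝ) * Complex.I) with hqd'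
  have hqq : q * q' = 1 := by
    have h1 := hρ.polarSqrt_ne_zero (by norm_num) ξ₀
    apply mul_left_cancel₀ h1
    rw [← mul_assoc, ← hq, ← hq', mul_one]
  -- The estimate is made from the end on whose side the point lies. Since q q' = 1, the point seen
  -- from the other end is -(a - b q) q', and its real part is nonnegative when that of a - b q is
  -- nonpositive.
  rcases le_total 0 (a - b * q : ℂ).re with h | h
  · have := hρ.inside_of_re_nonneg (ξ₀ := ξ₀) hb hab r1 r2 h
    rwa [show polarSqrt ρ ξ₀ * (a - b * q) = a * polarSqrt ρ ξ₀ + b * -polarSqrt ρ ξ₁ by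
      rw [hq]; ring] at this
  · have hre : 0 ≤ (b - a * q' : ℂ).re := by
      have e1 : (b - a * q' : ℂ) = -(a - b * q) * q' := by linear_combination (-(b : ℂ)) * hqq
      have e2 : q.re * q'.im + q.im * q'.re = 0 := by
        have := congrArg Complex.im hqq; simpa using this
      have e3 : (-(a - b * q) * q' : ℂ).re
          = -(a - b * q : ℂ).re * q'.re + (b * q.re) * q'.im ^ 2 * (1 / q'.re) := by
        have h3 : (-(a - b * q) * q' : ℂ).re
            = -(a - b * q : ℂ).re * q'.re - (b * q.im) * q'.im := by simp
        rw [h3]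
        field_simp
        linear_combination (-(b * q'.im)) * e2
      rw [e1, e3]
      have : 0 ≤ -(a - b * q : ℂ).re * q'.re := mul_nonneg (by linarith) (by linarith)
      positivity
    have := hρ.inside_of_re_nonneg (ξ₀ := ξ₁) ha (by linarith) r1' r2' hre
    rwa [show (polarSqrt ρ ξ₁ * (b - a * q')) ^ 2
      = (a * polarSqrt ρ ξ₀ + b * -polarSqrt ρ ξ₁) ^ 2 by rw [hq']; ring] at this

/-- Vectors that are almost orthogonal make an angle bounded away from `0` and `π`. -/
lemma angle_mem {α β m n c : ℝ} {u : ℂ} (hu : ‖u‖ = 1) (hc : c ≠ 0) (hβ : 0 < β) (hm : 0 < m)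
    (hα : |α| ≤ β / 4) (hn : |n| ≤ m / 4) :
    InnerProductGeometry.angle ((α + β * Complex.I) * u) (c * ((m + n * Complex.I) * u))
      ∈ Ioo (Real.pi / 6) (Real.pi - Real.pi / 6) := by
  set x : ℂ := (α + β * Complex.I) * u with hx
  set y : ℂ := c * ((m + n * Complex.I) * u) with hy
  have hu2 : u.re ^ 2 + u.im ^ 2 = 1 := by
    have := Complex.normSq_eq_norm_sq u
    rw [hu, Complex.normSq_apply] at this; linarith
  have hin : inner ℝ x y = c * (α * m + β * n) := by
    rw [Complex.inner, hx, hy]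
    simp only [Complex.mul_re, Complex.mul_im, Complex.conj_re, Complex.conj_im, Complex.add_re,
      Complex.add_im, Complex.ofReal_re, Complex.ofReal_im, Complex.I_re, Complex.I_im]
    linear_combination (c * (α * m + β * n)) * hu2
  have hnx : β ≤ ‖x‖ := by
    rw [hx, norm_mul, hu, mul_one]
    have := Complex.abs_im_le_norm (α + β * Complex.I)
    simpa [abs_of_pos hβ] using this
  have hny : |c| * m ≤ ‖y‖ := by
    rw [hy, norm_mul, norm_mul, hu, mul_one, Complex.norm_real, Real.norm_eq_abs]
    have := Complex.abs_re_le_norm (m + n * Complex.I)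
    gcongr
    simpa [abs_of_pos hm] using this
  have hc0 : 0 < |c| := abs_pos.2 hc
  have hprod : 0 < ‖x‖ * ‖y‖ := mul_pos (hβ.trans_le hnx) ((mul_pos hc0 hm).trans_le hny)
  have hle : |inner ℝ x y / (‖x‖ * ‖y‖)| ≤ 1 / 2 := by
    rw [abs_div, abs_of_pos hprod, div_le_iff₀ hprod, hin, abs_mul]
    have h1 : |α * m + β * n| ≤ β * m / 2 := by
      calc |α * m + β * n| ≤ |α * m| + |β * n| := abs_add_le _ _
        _ = |α| * m + β * |n| := by rw [abs_mul, abs_mul, abs_of_pos hm, abs_of_pos hβ]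
        _ ≤ _ := by nlinarith
    calc |c| * |α * m + β * n| ≤ |c| * (β * m / 2) := by gcongr
      _ = 1 / 2 * (β * (|c| * m)) := by ring
      _ ≤ _ := by gcongr
  have hpi := Real.pi_pos
  have hcos3 : Real.cos (Real.pi / 3) = 1 / 2 := Real.cos_pi_div_three
  have hle' := abs_le.1 hle
  rw [InnerProductGeometry.angle]
  have h1 : Real.arccos (1 / 2) = Real.pi / 3 := by
    rw [← hcos3, Real.arccos_cos (by linarith) (by linarith)]
  have h2 : Real.arccos (-(1 / 2)) = Real.pi - Real.pi / 3 := by rw [Real.arccos_neg, h1]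
  have h3 := Real.antitone_arccos hle'.2
  have h4 := Real.antitone_arccos hle'.1
  rw [h1] at h3
  rw [h2] at h4
  constructor <;> linarith

/-! ### The winding index -/

/-- A logarithm of α along the curve is a primitive of α'/α. Derivatives are asked for in the open
interval only, because the two-sided derivative at an end depends on values outside the arc; the end
points have measure zero. -/
lemma logIntegral_eq_sub {α α' lg : ℝ → ℂ} {a b : ℝ} (hab : a ≤ b)
    (hα : ∀ t ∈ Ioo a b, HasDerivAt α (α' t) t) (hlc : ContinuousOn lg (Icc a b))
    (hl : ∀ t ∈ Ioo a b, HasDerivAt lg (α' t / α t) t)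
    (hc : ContinuousOn (fun t => α' t / α t) (Icc a b)) :
    logIntegral α a b = lg b - lg a := by
  have h1 : logIntegral α a b = ∫ t in a..b, α' t / α t := by
    apply intervalIntegral.integral_congr_ae
    have hne : ∀ᵐ t : ℝ, t ≠ b := by
      simp [MeasureTheory.ae_iff]
    filter_upwards [hne] with t htb ht
    rw [uIoc_of_le hab] at ht
    rw [(hα t ⟨ht.1, lt_of_le_of_ne ht.2 htb⟩).deriv]
  rw [h1]
  exact intervalIntegral.integral_eq_sub_of_hasDerivAt_of_le hab hlc hl
    (hc.intervalIntegrable_of_Icc hab)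

lemma logIntegral_congr {α β : ℝ → ℂ} {a b : ℝ} (hab : a ≤ b) (h : EqOn α β (Icc a b)) :
    logIntegral α a b = logIntegral β a b := by
  apply intervalIntegral.integral_congr_ae
  have hne : ∀ᵐ t : ℝ, t ≠ b := by
    simp [MeasureTheory.ae_iff]
  filter_upwards [hne] with t htb ht
  rw [uIoc_of_le hab] at ht
  have h2 : α =ᶠ[𝓝 t] β := by
    filter_upwards [Ioo_mem_nhds ht.1 (lt_of_le_of_ne ht.2 htb)] with x hx
    exact h (Ioo_subset_Icc_self hx)
  rw [h2.deriv_eq, h2.eq_of_nhds]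

lemma windingIndex_congr {T : ℝ} (hT : 0 ≤ T) {z z' : ℝ → ℂ} (h : EqOn z z' (Icc 0 T)) :
    windingIndex T z = windingIndex T z' := by
  simp only [windingIndex]
  rw [logIntegral_congr hT h, h (left_mem_Icc.2 hT), h (right_mem_Icc.2 hT)]

lemma arg_polar_div {x y : ℝ} (hx : 0 < x) (hy : 0 < y) {a b : ℝ} (hab : |a - b| < Real.pi) :
    ((x * Complex.exp (a * Complex.I)) / (y * Complex.exp (b * Complex.I))).arg = a - b := by
  have : (x * Complex.exp (a * Complex.I)) / (y * Complex.exp (b * Complex.I))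
      = ((x / y : ℝ) : ℂ) * Complex.exp (((a - b : ℝ) : ℂ) * Complex.I) := by
    push_cast
    rw [sub_mul, Complex.exp_sub]
    field_simp
  rw [this, Complex.arg_real_mul _ (by positivity), Complex.arg_exp_mul_I]
  have h := abs_lt.1 hab
  exact (toIocMod_eq_self _).2 ⟨h.1, by linarith⟩

/-- The winding index of an arc with polar end points. -/
lemma windingIndex_polar {T : ℝ} {z : ℝ → ℂ} {x y a b : ℝ} (hx : 0 < x) (hy : 0 < y)
    (hab : |a - b| < Real.pi) (h0 : z 0 = x * Complex.exp (a * Complex.I))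
    (hT : z T = y * Complex.exp (b * Complex.I)) :
    windingIndex T z = (2 * Real.pi * Complex.I)⁻¹ *
      (logIntegral z 0 T + (a - b) * Complex.I + (Real.log (x / y) : ℝ)) := by
  have hd : (z 0 / z T).arg = a - b := by rw [h0, hT]; exact arg_polar_div hx hy hab
  have hT0 : z T ≠ 0 := by
    rw [hT]; exact mul_ne_zero (by exact_mod_cast hy.ne') (Complex.exp_ne_zero _)
  simp only [windingIndex, hd]
  have h1 : logIntegral (fun t : ℝ => z T * Complex.exp ((t * (a - b) : ℝ) * Complex.I)) 0 1
      = (a - b) * Complex.I := by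
    have hder : ∀ t : ℝ, HasDerivAt (fun t : ℝ => ((t * (a - b) : ℝ) : ℂ) * Complex.I)
        ((a - b) * Complex.I) t := fun t => by
      have h2 : HasDerivAt (fun t : ℝ => t * (a - b)) (a - b) t := by
        simpa using (hasDerivAt_id t).mul_const (a - b)
      simpa using h2.ofReal_comp.mul_const Complex.I
    have hq : ∀ t : ℝ, z T * (Complex.exp (((t * (a - b) : ℝ) : ℂ) * Complex.I)
        * ((a - b) * Complex.I)) / (z T * Complex.exp (((t * (a - b) : ℝ) : ℂ) * Complex.I))
        = (a - b) * Complex.I := fun t => by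
      have := Complex.exp_ne_zero (((t * (a - b) : ℝ) : ℂ) * Complex.I)
      field_simp
    rw [logIntegral_eq_sub (lg := fun t : ℝ => ((t * (a - b) : ℝ) : ℂ) * Complex.I) zero_le_one
      (fun t _ => (hder t).cexp.const_mul (z T)) (by fun_prop)
      (fun t _ => (hder t).congr_deriv (hq t).symm)
      (by simp only [hq]; exact continuousOn_const)]
    simp
  have h2 : logIntegral (fun t : ℝ => ((1 - t : ℝ) : ℂ)
      * (z T * Complex.exp (((a - b : ℝ) : ℂ) * Complex.I)) + (t : ℂ) * z 0) 0 1
      = (Real.log (x / y) : ℝ) := by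
    have hcurve : ∀ t : ℝ, ((1 - t : ℝ) : ℂ)
        * (z T * Complex.exp (((a - b : ℝ) : ℂ) * Complex.I)) + (t : ℂ) * z 0
        = (((1 - t) * y + t * x : ℝ) : ℂ) * Complex.exp (a * Complex.I) := by
      intro t
      rw [h0, hT, mul_assoc, ← Complex.exp_add]
      rw [show (b : ℂ) * Complex.I + ((a - b : ℝ) : ℂ) * Complex.I = a * Complex.I by
        push_cast; ring]
      push_cast; ring
    have hpos : ∀ t ∈ Icc (0 : ℝ) 1, 0 < (1 - t) * y + t * x := by
      intro t ht
      rcases eq_or_lt_of_le ht.1 with h | h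
      · rw [← h]; simpa using hy
      · have := mul_pos h hx
        have := mul_nonneg (sub_nonneg.2 ht.2) hy.le
        linarith
    have hder : ∀ t : ℝ, HasDerivAt (fun t : ℝ => (1 - t) * y + t * x) (x - y) t := fun t => by
      have := (((hasDerivAt_id t).const_sub 1).mul_const y).add ((hasDerivAt_id t).mul_const x)
      exact this.congr_deriv (by ring)
    have hlog : ∀ t ∈ Icc (0 : ℝ) 1, HasDerivAt
        (fun t : ℝ => ((Real.log ((1 - t) * y + t * x) : ℝ) : ℂ))
        (((x - y) / ((1 - t) * y + t * x) : ℝ) : ℂ) t := fun t ht =>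
      ((hder t).log (hpos t ht).ne').ofReal_comp
    have hq : ∀ t ∈ Icc (0 : ℝ) 1, (((x - y : ℝ) : ℂ) * Complex.exp (a * Complex.I))
        / ((((1 - t) * y + t * x : ℝ) : ℂ) * Complex.exp (a * Complex.I))
        = (((x - y) / ((1 - t) * y + t * x) : ℝ) : ℂ) := fun t ht => by
      rw [mul_div_mul_right _ _ (Complex.exp_ne_zero _)]; push_cast; rfl
    simp only [hcurve]
    rw [logIntegral_eq_sub (lg := fun t : ℝ => ((Real.log ((1 - t) * y + t * x) : ℝ) : ℂ))
      zero_le_one (fun t _ => (hder t).ofReal_comp.mul_const _)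
      (fun t ht => (hlog t ht).continuousAt.continuousWithinAt)
      (fun t ht => (hlog t (Ioo_subset_Icc_self ht)).congr_deriv
        (hq t (Ioo_subset_Icc_self ht)).symm) ?_]
    · rw [Real.log_div hx.ne' hy.ne']; simp
    · refine ContinuousOn.congr ?_ hq
      refine Complex.continuous_ofReal.comp_continuousOn ?_
      exact continuousOn_const.div (by fun_prop) fun t ht => (hpos t ht).ne'
  rw [h1, h2]

/-- `∫ dz / z` along an orbit whose Levi-Civita lift stays in a half plane. -/
lemma logIntegral_lcOrbit {Ω : ℝ} (hΩ : 0 < Ω) {A B : ℂ}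
    (hk : Complex.normSq A < Complex.normSq B) {L : ℝ} (hL : 0 < L) {ζ : ℂ}
    (hζ : ∀ t ∈ Icc 0 L, ζ * lcW Ω A B t ∈ Complex.slitPlane) :
    logIntegral (lcOrbit Ω A B) 0 (lcTime Ω A B L)
      = 2 * (Complex.log (ζ * lcW Ω A B L) - Complex.log (ζ * A)) := by
  set T := lcTime Ω A B L with hT
  have hT0 : 0 < T := by
    rw [hT, ← lcTime_zero Ω A B]; exact strictMono_lcTime hΩ hk hL
  have hmem : ∀ s ∈ Icc 0 T, lcClock Ω A B s ∈ Icc 0 L := fun s hs => by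
    have hm := (strictMono_lcClock hΩ hk).monotone
    refine ⟨?_, ?_⟩
    · rw [← lcClock_zero hΩ hk]; exact hm hs.1
    · rw [← lcClock_lcTime hΩ hk L]; exact hm hs.2
  have hne : ∀ s ∈ Icc 0 T, lcW Ω A B (lcClock Ω A B s) ≠ 0 := fun s hs h0 => by
    have := hζ _ (hmem s hs)
    rw [h0, mul_zero] at this
    exact Complex.slitPlane_ne_zero this rfl
  have hOne : ∀ s ∈ Icc 0 T, lcOrbit Ω A B s ≠ 0 := fun s hs => pow_ne_zero 2 (hne s hs)
  have hd : ∀ s ∈ Icc 0 T, HasDerivAt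
      (fun s => 2 * Complex.log (ζ * lcW Ω A B (lcClock Ω A B s)))
      (lcVel Ω A B (lcClock Ω A B s) / lcOrbit Ω A B s) s := by
    intro s hs
    have h1 := (((hasDerivAt_lcW Ω A B (lcClock Ω A B s)).scomp s
      (hasDerivAt_lcClock hΩ hk (hOne s hs))).const_mul ζ).clog_real (hζ _ (hmem s hs))
    refine (h1.const_mul 2).congr_deriv ?_
    have hw := hne s hs
    have hc : conj (lcW Ω A B (lcClock Ω A B s)) ≠ 0 := by simpa using hw
    have hζ0 : ζ ≠ 0 := fun h0 => by
      have := hζ _ (hmem s hs)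
      rw [h0, zero_mul] at this
      exact Complex.slitPlane_ne_zero this rfl
    simp only [Function.comp_apply, Complex.real_smul]
    rw [norm_lcOrbit, lcVel, lcOrbit]
    push_cast
    rw [← Complex.mul_conj]
    field_simp
  rw [logIntegral_eq_sub (lg := fun s => 2 * Complex.log (ζ * lcW Ω A B (lcClock Ω A B s))) hT0.le
    (fun s hs => hasDerivAt_lcOrbit hΩ hk (hOne s (Ioo_subset_Icc_self hs)))
    (fun s hs => (hd s hs).continuousAt.continuousWithinAt)
    (fun s hs => hd s (Ioo_subset_Icc_self hs)) ?_]
  · rw [hT, lcClock_lcTime hΩ hk, lcClock_zero hΩ hk, lcW_zero]; ring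
  · have hc : ContinuousOn (fun s => lcVel Ω A B (lcClock Ω A B s)) (Icc 0 T) := fun s hs =>
      (hasDerivAt_lcVel_lcClock hΩ hk (hOne s hs)).continuousAt.continuousWithinAt
    exact hc.div (continuous_lcOrbit hΩ hk).continuousOn hOne

lemma log_polar {m θ : ℝ} (hm : 0 < m) (h1 : -Real.pi < θ) (h2 : θ ≤ Real.pi) :
    Complex.log (m * Complex.exp (θ * Complex.I)) = Real.log m + θ * Complex.I := by
  rw [Complex.log_ofReal_mul hm (Complex.exp_ne_zero _), Complex.log_exp (by simpa using h1)
    (by simpa using h2)]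

lemma bvp_weights_nonneg {Ω k : ℝ} (hΩ : 0 < Ω) (hk : 0 < k) {p r : ℂ} (hpr : p ≠ r) {t : ℝ}
    (ht : t ∈ Icc 0 (bvpTime Ω k p r)) :
    0 ≤ Real.sinh (Ω * (bvpTime Ω k p r - t)) / bvpSinh k p r ∧
    0 ≤ Real.sinh (Ω * t) / bvpSinh k p r ∧
    (Real.sinh (Ω * t) / bvpSinh k p r = 0 →
      0 < Real.sinh (Ω * (bvpTime Ω k p r - t)) / bvpSinh k p r) := by
  have h0 := bvpSinh_pos hk hpr
  refine ⟨div_nonneg (Real.sinh_nonneg_iff.2 (mul_nonneg hΩ.le (sub_nonneg.2 ht.2))) h0.le,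
    div_nonneg (Real.sinh_nonneg_iff.2 (mul_nonneg hΩ.le ht.1)) h0.le, fun h => ?_⟩
  have h1 : Real.sinh (Ω * t) = 0 := by
    rcases div_eq_zero_iff.1 h with h | h
    · exact h
    · exact absurd h h0.ne'
  have h2 : t = 0 := by
    rcases mul_eq_zero.1 (Real.sinh_eq_zero.1 h1) with h | h
    · exact absurd h hΩ.ne'
    · exact h
  rw [h2, sub_zero]
  exact div_pos (Real.sinh_pos_iff.2 (mul_pos hΩ (bvpTime_pos hk hpr hΩ))) h0

/-! ### The indices of the short and of the long inner arc. -/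

section winding

variable {Ω k : ℝ} (hΩ : 0 < Ω) (hk : 0 < k) {ρ : ℝ → ℝ} (hρ : NearCircle (1 / 100) ρ) {ξ₀ ξ₁ : ℝ}
  (hξ : |ξ₀ - ξ₁| < 1 / 10)
include hΩ hk hρ hξ

lemma windingIndex_bvp {r : ℂ} (hr : r ^ 2 = polarCurve ρ ξ₁) (hpr : polarSqrt ρ ξ₀ ≠ r)
    {ζ : ℂ} (hζ : ∀ t ∈ Icc 0 (bvpTime Ω k (polarSqrt ρ ξ₀) r),
      ζ * lcW Ω (polarSqrt ρ ξ₀) (bvpCoeff k (polarSqrt ρ ξ₀) r) t ∈ Complex.slitPlane) :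
    windingIndex (lcTime Ω (polarSqrt ρ ξ₀) (bvpCoeff k (polarSqrt ρ ξ₀) r)
        (bvpTime Ω k (polarSqrt ρ ξ₀) r))
      (lcOrbit Ω (polarSqrt ρ ξ₀) (bvpCoeff k (polarSqrt ρ ξ₀) r))
      = (2 * Real.pi * Complex.I)⁻¹ *
        (2 * (Complex.log (ζ * r) - Complex.log (ζ * polarSqrt ρ ξ₀)) + (ξ₀ - ξ₁) * Complex.I
          + (Real.log (ρ ξ₀ / ρ ξ₁) : ℝ)) := by
  have hlt := normSq_lt_bvpCoeff hk hpr
  rw [windingIndex_polar (hρ.pos (by norm_num) ξ₀) (hρ.pos (by norm_num) ξ₁)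
    (hξ.trans (by linarith [Real.pi_gt_three])),
    logIntegral_lcOrbit hΩ hlt (bvpTime_pos hk hpr hΩ) hζ, lcW_bvpTime hk hpr hΩ]
  · rw [lcOrbit_zero hΩ hlt, hρ.polarSqrt_sq (by norm_num)]; rfl
  · rw [lcOrbit_lcTime hΩ hlt, lcW_bvpTime hk hpr hΩ, hr]; rfl

/-- The short arc has winding index `0`. -/
lemma windingIndex_direct (hpr : polarSqrt ρ ξ₀ ≠ polarSqrt ρ ξ₁) :
    windingIndex (lcTime Ω (polarSqrt ρ ξ₀) (bvpCoeff k (polarSqrt ρ ξ₀) (polarSqrt ρ ξ₁))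
        (bvpTime Ω k (polarSqrt ρ ξ₀) (polarSqrt ρ ξ₁)))
      (lcOrbit Ω (polarSqrt ρ ξ₀) (bvpCoeff k (polarSqrt ρ ξ₀) (polarSqrt ρ ξ₁))) = 0 := by
  obtain ⟨m, hm1, hm2, hm, hq⟩ := hρ.polarSqrt_ratio ξ₀ ξ₁
  have hη : |ξ₁ - ξ₀| < 1 / 10 := by rwa [abs_sub_comm]
  have hp := hρ.polarSqrt_ne_zero (by norm_num) ξ₀
  have hqre := (polar_re_im hm1 hm2 hη).1
  -- Divided by its starting point the lift is a + b q with Re q > 0, which stays in the right half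
  -- plane; the closing arc and segment then cancel the whole integral.
  rw [windingIndex_bvp hΩ hk hρ hξ (hρ.polarSqrt_sq (by norm_num) ξ₁) hpr
    (ζ := (polarSqrt ρ ξ₀)⁻¹)]
  · rw [inv_mul_cancel₀ hp, Complex.log_one]
    nth_rewrite 1 [hq]
    have hη' := abs_lt.1 hη
    rw [inv_mul_cancel_left₀ hp, log_polar (by linarith) (by linarith [Real.pi_gt_three])
      (by linarith [Real.pi_gt_three])]
    have : Real.log (ρ ξ₀ / ρ ξ₁) = -(2 * Real.log m) := by
      rw [← inv_div, ← hm, Real.log_inv, Real.log_pow]; push_cast; ring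
    rw [this]
    push_cast
    ring
  · intro t ht
    obtain ⟨w1, w2, w3⟩ := bvp_weights_nonneg hΩ hk hpr ht
    rw [lcW_bvpCoeff hk hpr hΩ]
    set a := Real.sinh (Ω * (bvpTime Ω k (polarSqrt ρ ξ₀) (polarSqrt ρ ξ₁) - t))
      / bvpSinh k (polarSqrt ρ ξ₀) (polarSqrt ρ ξ₁)
    set b := Real.sinh (Ω * t) / bvpSinh k (polarSqrt ρ ξ₀) (polarSqrt ρ ξ₁)
    rw [hq]
    set q : ℂ := m * Complex.exp (((ξ₁ - ξ₀) / 2 : ℝ) * Complex.I)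
    have : (polarSqrt ρ ξ₀)⁻¹ * (a * polarSqrt ρ ξ₀ + b * (polarSqrt ρ ξ₀ * q)) = a + b * q := by
      field_simp
    rw [this]
    left
    have : (a + b * q : ℂ).re = a + b * q.re := by simp
    rw [this]
    rcases eq_or_lt_of_le w2 with h | h
    · have := w3 h.symm
      rw [← h]; linarith
    · have := mul_pos h (by linarith : 0 < q.re)
      linarith

/-- Here ς is the sign of ξ₁ - ξ₀. Divided by its starting point the lift is a - b q; multiplied by
ς i it has real part b ς Im q ≥ 0. One branch of the logarithm therefore serves for the whole lift,
whose argument changes by (ξ₁ - ξ₀)/2 - ς π. Doubling and closing up leaves the index -ς. -/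
lemma norm_windingIndex_aux {ς : ℝ} (hς : ς = 1 ∨ ς = -1) (hςη : 0 < ς * (ξ₁ - ξ₀))
    (hpr : polarSqrt ρ ξ₀ ≠ -polarSqrt ρ ξ₁) :
    ‖windingIndex (lcTime Ω (polarSqrt ρ ξ₀) (bvpCoeff k (polarSqrt ρ ξ₀) (-polarSqrt ρ ξ₁))
        (bvpTime Ω k (polarSqrt ρ ξ₀) (-polarSqrt ρ ξ₁)))
      (lcOrbit Ω (polarSqrt ρ ξ₀) (bvpCoeff k (polarSqrt ρ ξ₀) (-polarSqrt ρ ξ₁)))‖ = 1 := by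
  obtain ⟨m, hm1, hm2, hm, hq⟩ := hρ.polarSqrt_ratio ξ₀ ξ₁
  have hη : |ξ₁ - ξ₀| < 1 / 10 := by rwa [abs_sub_comm]
  have hη' := abs_lt.1 hη
  have hp := hρ.polarSqrt_ne_zero (by norm_num) ξ₀
  have hpi := Real.pi_gt_three
  have hI : Complex.exp ((ς * (Real.pi / 2) : ℝ) * Complex.I) = ς * Complex.I := by
    rcases hς with h | h
    · rw [h, one_mul]; push_cast; rw [Complex.exp_pi_div_two_mul_I]; simp
    · rw [h]; push_cast
      rw [show (-1 : ℂ) * (Real.pi / 2) * Complex.I = -(Real.pi / 2 * Complex.I) by ring,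
        Complex.exp_neg, Complex.exp_pi_div_two_mul_I]
      simp
  have hς2 : (ς : ℂ) ^ 2 = 1 := by rcases hς with h | h <;> simp [h]
  have hςm : -(ς * Complex.I) = Complex.exp ((-(ς * (Real.pi / 2)) : ℝ) * Complex.I) := by
    rw [Complex.ofReal_neg, neg_mul, Complex.exp_neg, hI, mul_inv, Complex.inv_I]
    have : (ς : ℂ)⁻¹ = ς := by rcases hς with h | h <;> simp [h]
    rw [this]; ring
  have hb1 : -(Real.pi / 2) ≤ ς * (Real.pi / 2) := by rcases hς with h | h <;> rw [h] <;> linarith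
  have hb2 : ς * (Real.pi / 2) ≤ Real.pi / 2 := by rcases hς with h | h <;> rw [h] <;> linarith
  rw [windingIndex_bvp hΩ hk hρ hξ (by rw [neg_sq, hρ.polarSqrt_sq (by norm_num) ξ₁]) hpr
    (ζ := ς * Complex.I * (polarSqrt ρ ξ₀)⁻¹)]
  · have e1 : ς * Complex.I * (polarSqrt ρ ξ₀)⁻¹ * polarSqrt ρ ξ₀
        = (1 : ℝ) * Complex.exp ((ς * (Real.pi / 2) : ℝ) * Complex.I) := by
      rw [hI, mul_assoc, inv_mul_cancel₀ hp]; simp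
    have e2 : ς * Complex.I * (polarSqrt ρ ξ₀)⁻¹ * -polarSqrt ρ ξ₁
        = m * Complex.exp (((ξ₁ - ξ₀) / 2 + -(ς * (Real.pi / 2)) : ℝ) * Complex.I) := by
      rw [hq, Complex.ofReal_add, add_mul, Complex.exp_add, ← hςm]
      field_simp
    rw [e1, e2, log_polar one_pos (by linarith) (by linarith),
      log_polar (by linarith) (by linarith) (by linarith)]
    have : Real.log (ρ ξ₀ / ρ ξ₁) = -(2 * Real.log m) := by
      rw [← inv_div, ← hm, Real.log_inv, Real.log_pow]; push_cast; ring
    rw [this]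
    have e3 : (2 * Real.pi * Complex.I)⁻¹ * (2 * (Real.log m
        + ((ξ₁ - ξ₀) / 2 + -(ς * (Real.pi / 2)) : ℝ) * Complex.I
        - (Real.log 1 + (ς * (Real.pi / 2) : ℝ) * Complex.I)) + (ξ₀ - ξ₁) * Complex.I
        + (-(2 * Real.log m) : ℝ)) = -(ς : ℂ) := by
      have hpi0 : (Real.pi : ℂ) ≠ 0 := by exact_mod_cast Real.pi_ne_zero
      rw [Real.log_one]
      push_cast
      field_simp
      ring
    rw [e3]
    rcases hς with h | h <;> simp [h]
  · intro t ht
    obtain ⟨w1, w2, w3⟩ := bvp_weights_nonneg hΩ hk hpr ht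
    rw [lcW_bvpCoeff hk hpr hΩ]
    set a := Real.sinh (Ω * (bvpTime Ω k (polarSqrt ρ ξ₀) (-polarSqrt ρ ξ₁) - t))
      / bvpSinh k (polarSqrt ρ ξ₀) (-polarSqrt ρ ξ₁)
    set b := Real.sinh (Ω * t) / bvpSinh k (polarSqrt ρ ξ₀) (-polarSqrt ρ ξ₁)
    rw [hq]
    have him : (m * Complex.exp (((ξ₁ - ξ₀) / 2 : ℝ) * Complex.I)).im
        = m * Real.sin ((ξ₁ - ξ₀) / 2) := by
      rw [Complex.im_ofReal_mul, Complex.exp_ofReal_mul_I_im]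
    set q : ℂ := m * Complex.exp (((ξ₁ - ξ₀) / 2 : ℝ) * Complex.I)
    have e : ς * Complex.I * (polarSqrt ρ ξ₀)⁻¹
        * (a * polarSqrt ρ ξ₀ + b * -(polarSqrt ρ ξ₀ * q)) = ς * (Complex.I * (a - b * q)) := by
      field_simp
      ring
    rw [e]
    have hre : (ς * (Complex.I * (a - b * q)) : ℂ).re = b * (ς * q.im) := by simp; ring
    have himm : (ς * (Complex.I * (a - b * q)) : ℂ).im = ς * (a - b * q.re) := by simp
    have hqim : 0 < ς * q.im := by
      rw [him]
      rcases hς with h | h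
      · rw [h, one_mul] at hςη ⊢
        exact mul_pos (by linarith) (Real.sin_pos_of_pos_of_lt_pi (by linarith) (by linarith))
      · rw [h] at hςη ⊢
        have : Real.sin ((ξ₁ - ξ₀) / 2) < 0 :=
          Real.sin_neg_of_neg_of_neg_pi_lt (by linarith) (by linarith)
        nlinarith
    rw [Complex.mem_slitPlane_iff, hre, himm]
    -- When b = 0, as at the starting point, the value lies on the imaginary axis, where nonzero
    -- points still belong to the slit plane.
    rcases eq_or_lt_of_le w2 with h | h
    · right
      have := w3 h.symm
      rw [← h]
      rcases hς with h | h <;> rw [h] <;> simp [this.ne']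
    · left; exact mul_pos h hqim

/-- The long arc has winding index `±1`. -/
lemma norm_windingIndex_opposite (hne : ξ₀ ≠ ξ₁) (hpr : polarSqrt ρ ξ₀ ≠ -polarSqrt ρ ξ₁) :
    ‖windingIndex (lcTime Ω (polarSqrt ρ ξ₀) (bvpCoeff k (polarSqrt ρ ξ₀) (-polarSqrt ρ ξ₁))
        (bvpTime Ω k (polarSqrt ρ ξ₀) (-polarSqrt ρ ξ₁)))
      (lcOrbit Ω (polarSqrt ρ ξ₀) (bvpCoeff k (polarSqrt ρ ξ₀) (-polarSqrt ρ ξ₁)))‖ = 1 := by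
  rcases lt_or_gt_of_ne hne with h | h
  · exact norm_windingIndex_aux hΩ hk hρ hξ (Or.inl rfl) (by linarith) hpr
  · exact norm_windingIndex_aux hΩ hk hρ hξ (Or.inr rfl) (by linarith) hpr

end winding

/-! ### The inner arcs -/

lemma polarSqrt_div_conj {ρ : ℝ → ℝ} {ξ : ℝ} (hξ : 0 < ρ ξ) :
    polarSqrt ρ ξ / conj (polarSqrt ρ ξ) = Complex.exp (ξ * Complex.I) := by
  have h1 : (√(ρ ξ) : ℂ) ≠ 0 := by exact_mod_cast (Real.sqrt_pos.2 hξ).ne'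
  have h2 := Complex.exp_ne_zero (((ξ / 2 : ℝ) : ℂ) * Complex.I)
  have h3 : conj (polarSqrt ρ ξ) = √(ρ ξ) * (Complex.exp (((ξ / 2 : ℝ) : ℂ) * Complex.I))⁻¹ := by
    rw [polarSqrt, map_mul, Complex.conj_ofReal, ← Complex.exp_conj, map_mul, Complex.conj_ofReal,
      Complex.conj_I, mul_neg, Complex.exp_neg]
  rw [h3, polarSqrt, ← exp_half_sq ξ]
  field_simp

/-- The Levi-Civita initial velocity (over `Ω`) of the inner arc. -/
def arcCoeff (k : ℝ) (ρ : ℝ → ℝ) (ξ₀ ξ₁ : ℝ) : ℂ := bvpCoeff k (polarSqrt ρ ξ₀) (-polarSqrt ρ ξ₁)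

/-- The Levi-Civita duration of the inner arc. -/
def arcLength (Ω k : ℝ) (ρ : ℝ → ℝ) (ξ₀ ξ₁ : ℝ) : ℝ :=
  bvpTime Ω k (polarSqrt ρ ξ₀) (-polarSqrt ρ ξ₁)

/-- The physical time along the inner arc. -/
def arcClock (Ω k : ℝ) (ρ : ℝ → ℝ) (ξ₀ ξ₁ τ : ℝ) : ℝ :=
  lcTime Ω (polarSqrt ρ ξ₀) (arcCoeff k ρ ξ₀ ξ₁) τ

/-- The duration of the inner arc. -/
def arcTime (Ω k : ℝ) (ρ : ℝ → ℝ) (ξ₀ ξ₁ : ℝ) : ℝ :=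
  arcClock Ω k ρ ξ₀ ξ₁ (arcLength Ω k ρ ξ₀ ξ₁)

/-- The inner arc. -/
def arcOrbit (Ω k : ℝ) (ρ : ℝ → ℝ) (ξ₀ ξ₁ : ℝ) : ℝ → ℂ :=
  lcOrbit Ω (polarSqrt ρ ξ₀) (arcCoeff k ρ ξ₀ ξ₁)

section innerArc

variable {Ω k : ℝ} (hΩ : 0 < Ω) (hk : 0 < k) {ρ : ℝ → ℝ} (hρ : NearCircle (1 / 100) ρ) {ξ₀ ξ₁ : ℝ}
  (hξ : |ξ₀ - ξ₁| < 1 / 10)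

include hρ hξ in
-- The ratio of the two square roots has positive real part, so it is not -1; the fixed ends problem
-- of the long arc is thus never degenerate, even for ξ₀ = ξ₁.
lemma polarSqrt_ne_neg : polarSqrt ρ ξ₀ ≠ -polarSqrt ρ ξ₁ := by
  obtain ⟨m, hm1, hm2, hm, hq⟩ := hρ.polarSqrt_ratio ξ₀ ξ₁
  have hp := hρ.polarSqrt_ne_zero (by norm_num) ξ₀
  have h1 := (polar_re_im hm1 hm2 (by rwa [abs_sub_comm] : |ξ₁ - ξ₀| < 1 / 10)).1
  intro h
  rw [hq] at h
  set q : ℂ := m * Complex.exp (((ξ₁ - ξ₀) / 2 : ℝ) * Complex.I)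
  have h2 : q = -1 := by
    apply mul_left_cancel₀ hp
    linear_combination h
  rw [h2] at h1
  norm_num at h1

include hΩ hk hρ hξ

lemma arcTime_pos : 0 < arcTime Ω k ρ ξ₀ ξ₁ := by
  have hpr := polarSqrt_ne_neg hρ hξ
  have h := strictMono_lcTime hΩ (normSq_lt_bvpCoeff hk hpr) (bvpTime_pos hk hpr hΩ)
  rwa [lcTime_zero] at h

omit hρ in
omit hξ in
lemma mem_Ioo_lcClock {p r : ℂ} (hpr : p ≠ r) {s : ℝ}
    (hs : s ∈ Ioo 0 (lcTime Ω p (bvpCoeff k p r) (bvpTime Ω k p r))) :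
    lcClock Ω p (bvpCoeff k p r) s ∈ Ioo 0 (bvpTime Ω k p r) := by
  have hlt := normSq_lt_bvpCoeff hk hpr
  have hm := strictMono_lcClock hΩ hlt
  refine ⟨?_, ?_⟩
  · rw [← lcClock_zero hΩ hlt]; exact hm hs.1
  · rw [← lcClock_lcTime hΩ hlt (bvpTime Ω k p r)]; exact hm hs.2

omit hρ in
omit hξ in
lemma mem_Icc_lcClock {p r : ℂ} (hpr : p ≠ r) {s : ℝ}
    (hs : s ∈ Icc 0 (lcTime Ω p (bvpCoeff k p r) (bvpTime Ω k p r))) :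
    lcClock Ω p (bvpCoeff k p r) s ∈ Icc 0 (bvpTime Ω k p r) := by
  have hlt := normSq_lt_bvpCoeff hk hpr
  have hm := (strictMono_lcClock hΩ hlt).monotone
  refine ⟨?_, ?_⟩
  · rw [← lcClock_zero hΩ hlt]; exact hm hs.1
  · rw [← lcClock_lcTime hΩ hlt (bvpTime Ω k p r)]; exact hm hs.2

lemma arcOrbit_zero : arcOrbit Ω k ρ ξ₀ ξ₁ 0 = polarCurve ρ ξ₀ := by
  rw [arcOrbit, arcCoeff, lcOrbit_zero hΩ (normSq_lt_bvpCoeff hk (polarSqrt_ne_neg hρ hξ)),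
    hρ.polarSqrt_sq (by norm_num)]

lemma arcOrbit_arcTime : arcOrbit Ω k ρ ξ₀ ξ₁ (arcTime Ω k ρ ξ₀ ξ₁) = polarCurve ρ ξ₁ := by
  have hpr := polarSqrt_ne_neg hρ hξ
  rw [arcOrbit, arcTime, arcClock, arcCoeff, arcLength, lcOrbit_lcTime hΩ (normSq_lt_bvpCoeff hk hpr),
    lcW_bvpTime hk hpr hΩ, neg_sq, hρ.polarSqrt_sq (by norm_num)]

lemma arcOrbit_inside {s : ℝ} (hs : s ∈ Ioo 0 (arcTime Ω k ρ ξ₀ ξ₁)) :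
    ‖arcOrbit Ω k ρ ξ₀ ξ₁ s‖ < ρ (arcOrbit Ω k ρ ξ₀ ξ₁ s).arg := by
  have hpr := polarSqrt_ne_neg hρ hξ
  have ht := mem_Ioo_lcClock hΩ hk hpr hs
  obtain ⟨w1, w2, w3⟩ := bvp_weights hk hpr hΩ ht
  rw [arcOrbit, arcCoeff, lcOrbit, lcW_bvpCoeff hk hpr hΩ]
  exact hρ.inside hξ w1 w2 w3

/-- A zero means a = b q. For ξ₀ ≠ ξ₁ the ratio q is not real, so b = 0 and then a = 0, but the
weights never vanish together. -/
lemma arcLift_ne_zero (hne : ξ₀ ≠ ξ₁) {t : ℝ} (ht : t ∈ Icc 0 (arcLength Ω k ρ ξ₀ ξ₁)) :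
    lcW Ω (polarSqrt ρ ξ₀) (arcCoeff k ρ ξ₀ ξ₁) t ≠ 0 := by
  have hpr := polarSqrt_ne_neg hρ hξ
  obtain ⟨m, hm1, hm2, hm, hq⟩ := hρ.polarSqrt_ratio ξ₀ ξ₁
  have hp := hρ.polarSqrt_ne_zero (by norm_num) ξ₀
  obtain ⟨w1, w2, w3⟩ := bvp_weights_nonneg hΩ hk hpr ht
  rw [arcCoeff, lcW_bvpCoeff hk hpr hΩ]
  set a := Real.sinh (Ω * (bvpTime Ω k (polarSqrt ρ ξ₀) (-polarSqrt ρ ξ₁) - t))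
      / bvpSinh k (polarSqrt ρ ξ₀) (-polarSqrt ρ ξ₁)
  set b := Real.sinh (Ω * t) / bvpSinh k (polarSqrt ρ ξ₀) (-polarSqrt ρ ξ₁)
  have him : (m * Complex.exp (((ξ₁ - ξ₀) / 2 : ℝ) * Complex.I)).im
        = m * Real.sin ((ξ₁ - ξ₀) / 2) := by
    rw [Complex.im_ofReal_mul, Complex.exp_ofReal_mul_I_im]
  rw [hq]
  set q : ℂ := m * Complex.exp (((ξ₁ - ξ₀) / 2 : ℝ) * Complex.I)
  intro h
  have h1 : (a - b * q : ℂ) = 0 := by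
    apply mul_left_cancel₀ hp
    linear_combination h
  have h2 : b * q.im = 0 := by
    have := congrArg Complex.im h1; simpa using this
  have hsin : Real.sin ((ξ₁ - ξ₀) / 2) ≠ 0 := by
    have hξ' := abs_lt.1 hξ
    have hpi := Real.pi_gt_three
    rw [Ne, Real.sin_eq_zero_iff_of_lt_of_lt (by linarith) (by linarith)]
    intro h
    exact hne (by linarith)
  rw [him] at h2
  have hb : b = 0 := by
    rcases mul_eq_zero.1 h2 with h | h
    · exact h
    · rcases mul_eq_zero.1 h with h | h
      · linarith
      · exact absurd h hsin
  have ha := w3 hb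
  rw [hb] at h1
  simp at h1
  exact ha.ne' h1

/-- The two weights agree at half time and the ends are opposite, so the collision is there. -/
lemma lcW_half_arcLength (heq : ξ₀ = ξ₁) :
    lcW Ω (polarSqrt ρ ξ₀) (arcCoeff k ρ ξ₀ ξ₁) (arcLength Ω k ρ ξ₀ ξ₁ / 2) = 0 := by
  have hpr := polarSqrt_ne_neg hρ hξ
  rw [arcCoeff, arcLength, lcW_bvpCoeff hk hpr hΩ, sub_half, ← heq]
  ring

lemma arcOrbit_isEjectionCollision {E h μ : ℝ} (hE : Ω ^ 2 / 2 = E + h) (hμ : Ω ^ 2 * k / 2 = μ)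
    (heq : ξ₀ = ξ₁) : IsEjectionCollision E h μ (arcTime Ω k ρ ξ₀ ξ₁) (arcOrbit Ω k ρ ξ₀ ξ₁) := by
  have hpr := polarSqrt_ne_neg hρ hξ
  have hlt := normSq_lt_bvpCoeff hk hpr
  have hL := bvpTime_pos hk hpr hΩ
  have hw := lcW_half_arcLength hΩ hk hρ hξ heq
  refine ⟨(continuous_lcOrbit hΩ hlt).continuousOn,
    arcClock Ω k ρ ξ₀ ξ₁ (arcLength Ω k ρ ξ₀ ξ₁ / 2), ⟨?_, ?_⟩, ?_, fun s hs hsc => ?_⟩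
  · have := strictMono_lcTime hΩ hlt (half_pos hL)
    rwa [lcTime_zero] at this
  · exact strictMono_lcTime hΩ hlt (half_lt_self hL)
  · rw [arcOrbit, arcClock, arcCoeff, lcOrbit_lcTime hΩ hlt, ← arcCoeff, hw]; simp
  · have hz : lcOrbit Ω (polarSqrt ρ ξ₀) (bvpCoeff k (polarSqrt ρ ξ₀) (-polarSqrt ρ ξ₁)) s ≠ 0 := by
      refine pow_ne_zero 2 fun h0 => hsc ?_
      have h1 := lcW_zero_unique hΩ hlt h0 hw
      have h2 := lcTime_lcClock hΩ hlt s
      rw [h1] at h2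
      exact h2.symm
    exact ⟨hz, hsAt_lcOrbit hΩ hE hlt (by rw [normSq_bvpCoeff hk hpr, hμ])
      (arcTime_pos hΩ hk hρ hξ) hs hz⟩

lemma arcOrbit_isInnerClassical {E h μ : ℝ} (hE : Ω ^ 2 / 2 = E + h) (hμ : Ω ^ 2 * k / 2 = μ)
    (hne : ξ₀ ≠ ξ₁) : IsInnerClassical E h μ (arcTime Ω k ρ ξ₀ ξ₁) (arcOrbit Ω k ρ ξ₀ ξ₁) := by
  have hpr := polarSqrt_ne_neg hρ hξ
  have hlt := normSq_lt_bvpCoeff hk hpr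
  intro s hs
  have hz : lcOrbit Ω (polarSqrt ρ ξ₀) (bvpCoeff k (polarSqrt ρ ξ₀) (-polarSqrt ρ ξ₁)) s ≠ 0 :=
    pow_ne_zero 2 (arcLift_ne_zero hΩ hk hρ hξ hne (mem_Icc_lcClock hΩ hk hpr hs))
  exact ⟨hz, hsAt_lcOrbit hΩ hE hlt (by rw [normSq_bvpCoeff hk hpr, hμ])
    (arcTime_pos hΩ hk hρ hξ) hs hz⟩

/-- The initial velocity is -(Ω/S)(c + q) exp(iξ₀) with c > 1 and q close to 1: it is almost radial
and points inwards, whereas the boundary is almost tangential to the circle. -/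
lemma angle_start : InnerProductGeometry.angle (deriv (polarCurve ρ) ξ₀)
    (derivWithin (arcOrbit Ω k ρ ξ₀ ξ₁) (Icc 0 (arcTime Ω k ρ ξ₀ ξ₁)) 0)
      ∈ Ioo (Real.pi / 6) (Real.pi - Real.pi / 6) := by
  have hpr := polarSqrt_ne_neg hρ hξ
  have hlt := normSq_lt_bvpCoeff hk hpr
  have hT := arcTime_pos hΩ hk hρ hξ
  have hp := hρ.polarSqrt_ne_zero (by norm_num) ξ₀
  have hS := bvpSinh_pos hk hpr
  have hz : lcOrbit Ω (polarSqrt ρ ξ₀) (bvpCoeff k (polarSqrt ρ ξ₀) (-polarSqrt ρ ξ₁)) 0 ≠ 0 := by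
    rw [lcOrbit_zero hΩ hlt]; exact pow_ne_zero 2 hp
  have hd : derivWithin (arcOrbit Ω k ρ ξ₀ ξ₁) (Icc 0 (arcTime Ω k ρ ξ₀ ξ₁)) 0 = _ :=
    (hasDerivAt_lcOrbit hΩ hlt hz).hasDerivWithinAt.derivWithin
      (uniqueDiffOn_Icc hT 0 (left_mem_Icc.2 hT.le))
  obtain ⟨m, hm1, hm2, hm, hq⟩ := hρ.polarSqrt_ratio ξ₀ ξ₁
  obtain ⟨r1, r2⟩ := polar_re_im hm1 hm2 (by rwa [abs_sub_comm] at hξ : |ξ₁ - ξ₀| < 1 / 10)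
  have hc := one_lt_bvpCosh hk hpr
  rw [hd, (hρ.hasDerivAt_polarCurve ξ₀).deriv, lcClock_zero hΩ hlt, lcVel, lcW_zero]
  set c := bvpCosh k (polarSqrt ρ ξ₀) (-polarSqrt ρ ξ₁) with hcdef
  set S := bvpSinh k (polarSqrt ρ ξ₀) (-polarSqrt ρ ξ₁) with hSdef
  set q : ℂ := m * Complex.exp (((ξ₁ - ξ₀) / 2 : ℝ) * Complex.I)
  have hv : lcDW Ω (polarSqrt ρ ξ₀) (bvpCoeff k (polarSqrt ρ ξ₀) (-polarSqrt ρ ξ₁)) 0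
      / conj (polarSqrt ρ ξ₀) = ((-(Ω / S) : ℝ) : ℂ) * ((((c + q.re : ℝ) : ℂ)
        + (q.im : ℝ) * Complex.I) * Complex.exp (ξ₀ * Complex.I)) := by
    have hSc : (S : ℂ) ≠ 0 := by exact_mod_cast hS.ne'
    have hconj : conj (polarSqrt ρ ξ₀) ≠ 0 := by simpa using hp
    have hqq : (((c + q.re : ℝ) : ℂ) + (q.im : ℝ) * Complex.I) = c + q := by
      nth_rewrite 3 [← Complex.re_add_im q]; push_cast; ring
    rw [hqq, ← polarSqrt_div_conj (hρ.pos (by norm_num) ξ₀), bvpCoeff, ← hcdef, ← hSdef, hq]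
    simp only [lcDW, mul_zero, Real.sinh_zero, Real.cosh_zero]
    push_cast
    field_simp
    ring
  rw [hv]
  have h0 := abs_le.1 (hρ.near ξ₀)
  refine angle_mem (Complex.norm_exp_ofReal_mul_I ξ₀) (neg_ne_zero.2 (div_pos hΩ hS).ne')
    (hρ.pos (by norm_num) ξ₀) (by linarith) ((hρ.deriv_le ξ₀).trans (by linarith))
    (r2.trans (by linarith))

/-- The final velocity is (Ω/S)(c + q) exp(iξ₁), with q the ratio of the square roots seen from the
second end: almost radial and outwards. -/
lemma angle_finish : InnerProductGeometry.angle (deriv (polarCurve ρ) ξ₁)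
    (derivWithin (arcOrbit Ω k ρ ξ₀ ξ₁) (Icc 0 (arcTime Ω k ρ ξ₀ ξ₁)) (arcTime Ω k ρ ξ₀ ξ₁))
      ∈ Ioo (Real.pi / 6) (Real.pi - Real.pi / 6) := by
  have hpr := polarSqrt_ne_neg hρ hξ
  have hlt := normSq_lt_bvpCoeff hk hpr
  have hT := arcTime_pos hΩ hk hρ hξ
  have hp := hρ.polarSqrt_ne_zero (by norm_num) ξ₁
  have hS := bvpSinh_pos hk hpr
  have hz : lcOrbit Ω (polarSqrt ρ ξ₀) (bvpCoeff k (polarSqrt ρ ξ₀) (-polarSqrt ρ ξ₁))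
      (arcTime Ω k ρ ξ₀ ξ₁) ≠ 0 := by
    have := arcOrbit_arcTime hΩ hk hρ hξ
    rw [arcOrbit, arcCoeff] at this
    rw [this]; exact hρ.polarCurve_ne_zero (by norm_num) ξ₁
  have hd : derivWithin (arcOrbit Ω k ρ ξ₀ ξ₁) (Icc 0 (arcTime Ω k ρ ξ₀ ξ₁))
      (arcTime Ω k ρ ξ₀ ξ₁) = _ :=
    (hasDerivAt_lcOrbit hΩ hlt hz).hasDerivWithinAt.derivWithin
      (uniqueDiffOn_Icc hT _ (right_mem_Icc.2 hT.le))
  obtain ⟨m, hm1, hm2, hm, hq⟩ := hρ.polarSqrt_ratio ξ₁ ξ₀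
  obtain ⟨r1, r2⟩ := polar_re_im hm1 hm2 hξ
  have hc := one_lt_bvpCosh hk hpr
  have hclock : lcClock Ω (polarSqrt ρ ξ₀) (bvpCoeff k (polarSqrt ρ ξ₀) (-polarSqrt ρ ξ₁))
      (arcTime Ω k ρ ξ₀ ξ₁) = bvpTime Ω k (polarSqrt ρ ξ₀) (-polarSqrt ρ ξ₁) :=
    lcClock_lcTime hΩ hlt _
  rw [hd, (hρ.hasDerivAt_polarCurve ξ₁).deriv, hclock, lcVel, lcW_bvpTime hk hpr hΩ,
    lcDW_bvpTime hk hpr hΩ]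
  set c := bvpCosh k (polarSqrt ρ ξ₀) (-polarSqrt ρ ξ₁) with hcdef
  set S := bvpSinh k (polarSqrt ρ ξ₀) (-polarSqrt ρ ξ₁) with hSdef
  set q : ℂ := m * Complex.exp (((ξ₀ - ξ₁) / 2 : ℝ) * Complex.I)
  have hv : (Ω / S * (c * -polarSqrt ρ ξ₁ - polarSqrt ρ ξ₀)) / conj (-polarSqrt ρ ξ₁)
      = ((Ω / S : ℝ) : ℂ) * ((((c + q.re : ℝ) : ℂ)
        + (q.im : ℝ) * Complex.I) * Complex.exp (ξ₁ * Complex.I)) := by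
    have hSc : (S : ℂ) ≠ 0 := by exact_mod_cast hS.ne'
    have hconj : conj (polarSqrt ρ ξ₁) ≠ 0 := by simpa using hp
    have hqq : (((c + q.re : ℝ) : ℂ) + (q.im : ℝ) * Complex.I) = c + q := by
      nth_rewrite 3 [← Complex.re_add_im q]; push_cast; ring
    rw [hqq, ← polarSqrt_div_conj (hρ.pos (by norm_num) ξ₁), hq, map_neg]
    push_cast
    field_simp
    ring
  rw [hv]
  have h0 := abs_le.1 (hρ.near ξ₁)
  refine angle_mem (Complex.norm_exp_ofReal_mul_I ξ₁) (div_pos hΩ hS).ne'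
    (hρ.pos (by norm_num) ξ₁) (by linarith) ((hρ.deriv_le ξ₁).trans (by linarith))
    (r2.trans (by linarith))

omit hΩ hk hξ in
lemma contDiff_arcEnds :
    ContDiff ℝ 1 fun x : ℝ × ℝ => (polarSqrt ρ x.1, -polarSqrt ρ x.2) :=
  ((hρ.contDiff_polarSqrt (by norm_num)).comp contDiff_fst).prodMk
    ((hρ.contDiff_polarSqrt (by norm_num)).comp contDiff_snd).neg

omit hΩ in
lemma contDiffAt_arcCoeff :
    ContDiffAt ℝ 1 (fun x : ℝ × ℝ => arcCoeff k ρ x.1 x.2) (ξ₀, ξ₁) :=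
  ContDiffAt.comp (g := fun y : ℂ × ℂ => bvpCoeff k y.1 y.2)
    (f := fun x : ℝ × ℝ => (polarSqrt ρ x.1, -polarSqrt ρ x.2)) (ξ₀, ξ₁)
    (contDiffAt_bvpCoeff hk (polarSqrt_ne_neg hρ hξ)) (contDiff_arcEnds hρ).contDiffAt

omit hΩ in
lemma contDiffAt_arcLength :
    ContDiffAt ℝ 1 (fun x : ℝ × ℝ => arcLength Ω k ρ x.1 x.2) (ξ₀, ξ₁) :=
  ContDiffAt.comp (g := fun y : ℂ × ℂ => bvpTime Ω k y.1 y.2)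
    (f := fun x : ℝ × ℝ => (polarSqrt ρ x.1, -polarSqrt ρ x.2)) (ξ₀, ξ₁)
    (contDiffAt_bvpTime Ω hk (polarSqrt_ne_neg hρ hξ)) (contDiff_arcEnds hρ).contDiffAt

omit hΩ in
lemma contDiffAt_arcData (t : ℝ) : ContDiffAt ℝ 1
    (fun x : ℝ × ℝ × ℝ => (x.1, polarSqrt ρ x.2.1, arcCoeff k ρ x.2.1 x.2.2)) (t, ξ₀, ξ₁) := by
  have h1 : ContDiff ℝ 1 fun x : ℝ × ℝ × ℝ => polarSqrt ρ x.2.1 :=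
    (hρ.contDiff_polarSqrt (by norm_num)).comp contDiff_snd.fst
  have h2 : ContDiffAt ℝ 1 (fun x : ℝ × ℝ × ℝ => arcCoeff k ρ x.2.1 x.2.2) (t, ξ₀, ξ₁) :=
    ContDiffAt.comp (g := fun x : ℝ × ℝ => arcCoeff k ρ x.1 x.2)
      (f := fun x : ℝ × ℝ × ℝ => x.2) (t, ξ₀, ξ₁) (contDiffAt_arcCoeff hk hρ hξ) contDiffAt_snd
  exact contDiffAt_fst.prodMk (h1.contDiffAt.prodMk h2)

omit hΩ in
lemma contDiffAt_arcClock (t : ℝ) : ContDiffAt ℝ 1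
    (fun x : ℝ × ℝ × ℝ => arcClock Ω k ρ x.2.1 x.2.2 x.1) (t, ξ₀, ξ₁) :=
  ContDiffAt.comp (g := fun x : ℝ × ℂ × ℂ => lcTime Ω x.2.1 x.2.2 x.1)
    (f := fun x : ℝ × ℝ × ℝ => (x.1, polarSqrt ρ x.2.1, arcCoeff k ρ x.2.1 x.2.2)) (t, ξ₀, ξ₁)
    (contDiff_lcTime Ω).contDiffAt (contDiffAt_arcData hk hρ hξ t)

omit hΩ in
lemma contDiffAt_arcTime :
    ContDiffAt ℝ 1 (fun x : ℝ × ℝ => arcTime Ω k ρ x.1 x.2) (ξ₀, ξ₁) :=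
  ContDiffAt.comp (g := fun x : ℝ × ℝ × ℝ => arcClock Ω k ρ x.2.1 x.2.2 x.1)
    (f := fun x : ℝ × ℝ => (arcLength Ω k ρ x.1 x.2, x)) (ξ₀, ξ₁)
    (contDiffAt_arcClock hk hρ hξ _) ((contDiffAt_arcLength hk hρ hξ).prodMk contDiffAt_id)

lemma contDiffAt_arcOrbit {s : ℝ} (hz : arcOrbit Ω k ρ ξ₀ ξ₁ s ≠ 0) : ContDiffAt ℝ 1
    (fun x : ℝ × ℝ × ℝ => arcOrbit Ω k ρ x.2.1 x.2.2 x.1) (s, ξ₀, ξ₁) :=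
  ContDiffAt.comp (g := fun x : ℝ × ℂ × ℂ => lcOrbit Ω x.2.1 x.2.2 x.1)
    (f := fun x : ℝ × ℝ × ℝ => (x.1, polarSqrt ρ x.2.1, arcCoeff k ρ x.2.1 x.2.2)) (s, ξ₀, ξ₁)
    (contDiffAt_lcOrbit hΩ (normSq_lt_bvpCoeff hk (polarSqrt_ne_neg hρ hξ)) hz)
    (contDiffAt_arcData hk hρ hξ s)

omit hΩ in
lemma contDiffAt_arcLift_sq (t : ℝ) : ContDiffAt ℝ 1
    (fun x : ℝ × ℝ × ℝ => lcW Ω (polarSqrt ρ x.2.1) (arcCoeff k ρ x.2.1 x.2.2) x.1 ^ 2)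
    (t, ξ₀, ξ₁) :=
  ContDiffAt.comp (g := fun x : ℝ × ℂ × ℂ => lcW Ω x.2.1 x.2.2 x.1 ^ 2)
    (f := fun x : ℝ × ℝ × ℝ => (x.1, polarSqrt ρ x.2.1, arcCoeff k ρ x.2.1 x.2.2)) (t, ξ₀, ξ₁)
    ((contDiff_lcW Ω).pow 2).contDiffAt (contDiffAt_arcData hk hρ hξ t)

lemma arcOrbit_arcClock (t : ℝ) : arcOrbit Ω k ρ ξ₀ ξ₁ (arcClock Ω k ρ ξ₀ ξ₁ t)
    = lcW Ω (polarSqrt ρ ξ₀) (arcCoeff k ρ ξ₀ ξ₁) t ^ 2 :=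
  lcOrbit_lcTime hΩ (normSq_lt_bvpCoeff hk (polarSqrt_ne_neg hρ hξ)) t

omit hξ in
lemma arc_isC1InEndpoints : IsC1InEndpoints (1 / 10) (arcTime Ω k ρ) (arcOrbit Ω k ρ) := by
  refine ⟨fun x hx => (contDiffAt_arcTime hk hρ hx).contDiffWithinAt,
    fun x hx => (contDiffAt_arcOrbit hΩ hk hρ hx.1 hx.2.2).contDiffWithinAt,
    arcLength Ω k ρ, arcClock Ω k ρ, ?_,
    fun x hx => (contDiffAt_arcLength hk hρ hx).contDiffWithinAt,
    fun x hx => (contDiffAt_arcClock hk hρ hx.1 x.1).contDiffWithinAt, ?_⟩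
  · intro ξ₀ ξ₁ hx
    have hpr := polarSqrt_ne_neg hρ hx
    refine ⟨bvpTime_pos hk hpr hΩ, lcTime_zero _ _ _, rfl,
      (strictMono_lcTime hΩ (normSq_lt_bvpCoeff hk hpr)).strictMonoOn _, fun τ _ => ?_⟩
    have h1 := hasDerivAt_lcTime hΩ (polarSqrt ρ ξ₀) (arcCoeff k ρ ξ₀ ξ₁) τ
    rw [arcOrbit_arcClock hΩ hk hρ hx, norm_pow, ← Complex.normSq_eq_norm_sq]
    exact h1.hasDerivWithinAt
  · exact ContDiffOn.congr
      (fun x hx => (contDiffAt_arcLift_sq hk hρ hx.1 x.1).contDiffWithinAt)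
      fun x hx => arcOrbit_arcClock hΩ hk hρ hx.1 x.1

end innerArc

/-- Uniqueness of the inner classical arc with winding index `±1`. -/
lemma inner_classical_unique {E h μ Ω k : ℝ} (hΩ : 0 < Ω) (hk : 0 < k) (hE : Ω ^ 2 / 2 = E + h)
    (hμ : Ω ^ 2 * k / 2 = μ) {ρ : ℝ → ℝ} (hρ : NearCircle (1 / 100) ρ) {ξ₀ ξ₁ : ℝ}
    (hξ : |ξ₀ - ξ₁| < 1 / 10) {T : ℝ} {z : ℝ → ℂ} (hT : 0 < T) (h0 : z 0 = polarCurve ρ ξ₀)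
    (h1 : z T = polarCurve ρ ξ₁) (hz : IsInnerClassical E h μ T z) (hw : ‖windingIndex T z‖ = 1) :
    T = arcTime Ω k ρ ξ₀ ξ₁ ∧ EqOn z (arcOrbit Ω k ρ ξ₀ ξ₁) (Icc 0 T) := by
  have hμ0 : 0 < μ := by rw [← hμ]; positivity
  set p := polarSqrt ρ ξ₀ with hp
  set B := derivWithin z (Icc 0 T) 0 * conj p / Ω
  obtain ⟨hB, heq⟩ := eqOn_lcOrbit_of_keplerAt hΩ hμ0 hT.le
    (fun s hs => (hz s hs).2.keplerAt hE (hz s hs).1) (p := p)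
    (by rw [h0, hp, hρ.polarSqrt_sq (by norm_num)])
  have hBk : Complex.normSq B - Complex.normSq p = k := by
    rw [← hμ] at hB
    have h2 : 0 < Ω ^ 2 := by positivity
    exact mul_left_cancel₀ h2.ne' (by linarith)
  have hlt : Complex.normSq p < Complex.normSq B := by linarith
  have hL : 0 < lcClock Ω p B T := by
    rw [← lcClock_zero hΩ hlt]; exact strictMono_lcClock hΩ hlt hT
  have hsq : lcW Ω p B (lcClock Ω p B T) ^ 2 = polarSqrt ρ ξ₁ ^ 2 := by
    rw [hρ.polarSqrt_sq (by norm_num), ← h1, heq (right_mem_Icc.2 hT.le), lcOrbit]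
  have hTime := lcTime_lcClock hΩ hlt T
  -- The lift ends at one of the two square roots of γ(ξ₁). The near one gives index 0, contrary to
  -- the assumption; the opposite one gives the constructed arc.
  rcases sq_eq_sq_iff_eq_or_eq_neg.1 hsq with h | h
  · obtain ⟨hne, e1, e2⟩ := bvp_unique hk hΩ hBk hL h
    have := windingIndex_direct hΩ hk hρ hξ hne
    rw [← hp, ← e2, ← e1, hTime, ← windingIndex_congr hT.le heq] at this
    rw [this] at hw
    simp at hw
  · obtain ⟨hne, e1, e2⟩ := bvp_unique hk hΩ hBk hL h
    refine ⟨?_, ?_⟩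
    · rw [arcTime, arcClock, arcLength, arcCoeff, ← hp, ← e2, ← e1, hTime]
    · rw [arcOrbit, arcCoeff, ← hp, ← e2]; exact heq

lemma inner_arcs (E h μ Cε : ℝ) (hEh : 0 < E + h) (hμ : 0 < μ) (hCε : 0 < Cε) (f : ℝ → ℝ → ℝ)
    (hper : ∀ ε ∈ Icc (-Cε) Cε, Function.Periodic (fun ξ => f ξ ε) (2 * Real.pi))
    (hf : ContDiffOn ℝ 2 (fun p : ℝ × ℝ => f p.1 p.2) (univ ×ˢ Icc (-Cε) Cε)) :
    ∃ εI δI C : ℝ, 0 < εI ∧ εI ≤ Cε ∧ 0 < δI ∧ δI ≤ Real.pi ∧ 0 < C ∧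
      ∀ ε : ℝ, |ε| < εI →
        ∃ (T : ℝ → ℝ → ℝ) (z : ℝ → ℝ → ℝ → ℂ),
          (∀ ξ₀ ξ₁ : ℝ, |ξ₀ - ξ₁| < δI →
            IsInnerArc E h μ f ε ξ₀ ξ₁ (T ξ₀ ξ₁) (z ξ₀ ξ₁) ∧
            (∀ (T' : ℝ) (z' : ℝ → ℂ), IsInnerArc E h μ f ε ξ₀ ξ₁ T' z' →
              T' = T ξ₀ ξ₁ ∧ EqOn z' (z ξ₀ ξ₁) (Icc 0 (T ξ₀ ξ₁))) ∧
            InnerProductGeometry.angle (deriv (boundaryCurve f ε) ξ₀)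
              (derivWithin (z ξ₀ ξ₁) (Icc 0 (T ξ₀ ξ₁)) 0) ∈ Ioo C (Real.pi - C) ∧
            InnerProductGeometry.angle (deriv (boundaryCurve f ε) ξ₁)
              (derivWithin (z ξ₀ ξ₁) (Icc 0 (T ξ₀ ξ₁)) (T ξ₀ ξ₁)) ∈ Ioo C (Real.pi - C)) ∧
          IsC1InEndpoints δI T z := by
  obtain ⟨ε₀, hε0, hε1, hnear⟩ := exists_nearCircle hCε hper hf (κ := 1 / 100) (by norm_num)
  set Ω := √(2 * (E + h)) with hΩdef
  have hΩ : 0 < Ω := Real.sqrt_pos.2 (by linarith)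
  have hΩ2 : Ω ^ 2 = 2 * (E + h) := Real.sq_sqrt (by linarith)
  set k := μ / (E + h) with hkdef
  have hk : 0 < k := div_pos hμ hEh
  have hE : Ω ^ 2 / 2 = E + h := by rw [hΩ2]; ring
  have hμk : Ω ^ 2 * k / 2 = μ := by rw [hΩ2, hkdef]; field_simp
  refine ⟨ε₀, 1 / 10, Real.pi / 6, hε0, hε1, by norm_num, by linarith [Real.pi_gt_three],
    by linarith [Real.pi_gt_three], fun ε hε => ?_⟩
  have hρ := hnear ε hε
  set ρ : ℝ → ℝ := fun ξ => 1 + ε * f ξ ε with hρdef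
  refine ⟨arcTime Ω k ρ, arcOrbit Ω k ρ, fun ξ₀ ξ₁ hξ => ⟨?_, ?_, angle_start hΩ hk hρ hξ,
    angle_finish hΩ hk hρ hξ⟩, arc_isC1InEndpoints hΩ hk hρ⟩
  · exact ⟨arcTime_pos hΩ hk hρ hξ, arcOrbit_zero hΩ hk hρ hξ, arcOrbit_arcTime hΩ hk hρ hξ,
      fun s hs => arcOrbit_inside hΩ hk hρ hξ hs,
      fun hne => ⟨arcOrbit_isInnerClassical hΩ hk hρ hξ hE hμk hne,
        norm_windingIndex_opposite hΩ hk hρ hξ hne (polarSqrt_ne_neg hρ hξ)⟩,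
      arcOrbit_isEjectionCollision hΩ hk hρ hξ hE hμk⟩
  · intro T' z' h'
    by_cases heq : ξ₀ = ξ₁
    · have hsq := hρ.polarSqrt_sq (by norm_num) ξ₀
      obtain ⟨a1, a2⟩ := ejectionCollision_arc hΩ hk hE hμk (p := polarSqrt ρ ξ₀)
        (by rw [hsq]; exact h'.start) (by rw [hsq, heq]; exact h'.finish) (h'.ejectionCollision heq)
      -- The constructed arc is itself put in the symmetric form that the competitor has, and the
      -- two forms are compared.
      obtain ⟨b1, b2⟩ := ejectionCollision_arc hΩ hk hE hμk (p := polarSqrt ρ ξ₀)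
        (by rw [hsq]; exact arcOrbit_zero hΩ hk hρ hξ)
        (by rw [hsq, arcOrbit_arcTime hΩ hk hρ hξ, heq])
        (arcOrbit_isEjectionCollision hΩ hk hρ hξ hE hμk heq)
      have hTT : T' = arcTime Ω k ρ ξ₀ ξ₁ := a1.trans b1.symm
      refine ⟨hTT, fun s hs => ?_⟩
      rw [a2 s (by rwa [hTT]), b2 s hs, hTT]
    · obtain ⟨c1, c2⟩ := h'.classical heq
      obtain ⟨d1, d2⟩ := inner_classical_unique hΩ hk hE hμk hρ hξ h'.pos h'.start h'.finish c1 c2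
      exact ⟨d1, by rwa [← d1]⟩

/-! ### The outer problem -/

lemma gradient_outerPotential (E ω : ℝ) (z : ℂ) :
    gradient (outerPotential E ω) z = ((-ω ^ 2 : ℝ) : ℂ) * z := by
  apply HasGradientAt.gradient
  rw [hasGradientAt_iff_hasFDerivAt]
  have h1 : HasFDerivAt (fun y : ℂ => ‖y‖ ^ 2) (2 • innerSL ℝ z) z :=
    (hasStrictFDerivAt_norm_sq z).hasFDerivAt
  have h2 := (h1.const_mul (ω ^ 2 / 2)).const_sub E
  refine h2.congr_fderiv ?_
  rw [← Complex.real_smul, map_smul]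
  ext1 y
  simp [Complex.inner]
  ring

/-- The harmonic motion with `z(0) = p₀` and `z(T) = p₁`. -/
def harmonicOrbit (ω T : ℝ) (p₀ p₁ : ℂ) (s : ℝ) : ℂ :=
  ((Real.sin (ω * (T - s)) / Real.sin (ω * T) : ℝ) : ℂ) * p₀
    + ((Real.sin (ω * s) / Real.sin (ω * T) : ℝ) : ℂ) * p₁

lemma harmonicOrbit_zero {ω T : ℝ} (h : Real.sin (ω * T) ≠ 0) (p₀ p₁ : ℂ) :
    harmonicOrbit ω T p₀ p₁ 0 = p₀ := by simp [harmonicOrbit, h]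

lemma harmonicOrbit_self {ω T : ℝ} (h : Real.sin (ω * T) ≠ 0) (p₀ p₁ : ℂ) :
    harmonicOrbit ω T p₀ p₁ T = p₁ := by simp [harmonicOrbit, h]

lemma harmonicOrbit_eq {ω T : ℝ} (h : Real.sin (ω * T) ≠ 0) (p₀ p₁ : ℂ) (s : ℝ) :
    harmonicOrbit ω T p₀ p₁ s = (Real.cos (ω * s) : ℂ) * p₀
      + (Real.sin (ω * s) : ℂ) * ((p₁ - Real.cos (ω * T) * p₀) / Real.sin (ω * T)) := by
  have h' : (Real.sin (ω * T) : ℂ) ≠ 0 := by exact_mod_cast h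
  rw [harmonicOrbit, mul_sub, Real.sin_sub, Complex.ofReal_div, Complex.ofReal_div,
    Complex.ofReal_sub, Complex.ofReal_mul, Complex.ofReal_mul]
  field_simp
  ring

/-- The classical solutions of the outer problem are harmonic motions. -/
lemma eqOn_harmonicOrbit {E ω T : ℝ} (hω : 0 < ω) (hT : 0 < T) (hTω : T < Real.pi / ω) {z : ℝ → ℂ}
    {p₀ p₁ : ℂ} (h0 : z 0 = p₀) (h1 : z T = p₁) (hz : IsOuterClassical E ω T z) :
    EqOn z (harmonicOrbit ω T p₀ p₁) (Icc 0 T) ∧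
      2 * E / ω ^ 2 * Real.cos (ω * T) ^ 2 - 2 * dot p₀ p₁ * Real.cos (ω * T)
        + Complex.normSq p₀ + Complex.normSq p₁ - 2 * E / ω ^ 2 = 0 := by
  have hsin : 0 < Real.sin (ω * T) := Real.sin_pos_of_pos_of_lt_pi (mul_pos hω hT)
    (by rw [lt_div_iff₀ hω] at hTω; linarith)
  have hωc : (ω : ℂ) ≠ 0 := by exact_mod_cast hω.ne'
  set v := derivWithin z (Icc 0 T) with hv
  have hd : ∀ s ∈ Icc 0 T, HasDerivWithinAt z (v s) (Icc 0 T) s := fun s hs =>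
    (hz s hs).differentiable.hasDerivWithinAt
  have hd2 : ∀ s ∈ Icc 0 T, HasDerivWithinAt v (((-ω ^ 2 : ℝ) : ℂ) * z s) (Icc 0 T) s :=
    fun s hs => by rw [← gradient_outerPotential E]; exact (hz s hs).newton
  have hcs : ∀ s, (Real.cos (ω * s) : ℂ) ^ 2 + (Real.sin (ω * s) : ℂ) ^ 2 = 1 := fun s => by
    exact_mod_cast Real.cos_sq_add_sin_sq (ω * s)
  have h00 : ∀ s : ℝ, HasDerivAt (fun t : ℝ => ω * t) ω s := fun s => by
    simpa using (hasDerivAt_id s).const_mul ω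
  have hcos : ∀ s, HasDerivWithinAt (fun s : ℝ => (Real.cos (ω * s) : ℂ))
      (-(Real.sin (ω * s) : ℂ) * ω) (Icc 0 T) s := fun s => by
    have := (h00 s).cos.ofReal_comp.hasDerivWithinAt (s := Icc 0 T)
    exact this.congr_deriv (by push_cast; ring)
  have hsn : ∀ s, HasDerivWithinAt (fun s : ℝ => (Real.sin (ω * s) : ℂ))
      ((Real.cos (ω * s) : ℂ) * ω) (Icc 0 T) s := fun s => by
    have := (h00 s).sin.ofReal_comp.hasDerivWithinAt (s := Icc 0 T)
    exact this.congr_deriv (by push_cast; ring)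
  -- Rotating the pair (z, v/ω) back by the angle ωs gives the two first integrals `c1` and `c2`.
  have hrep : ∀ s ∈ Icc 0 T, z s = (Real.cos (ω * s) : ℂ) * p₀ + (Real.sin (ω * s) : ℂ) * (v 0 / ω) := by
    intro s hs
    have c1 := constant_of_hasDerivWithinAt_zero
      (f := fun s => (Real.cos (ω * s) : ℂ) * z s - (Real.sin (ω * s) : ℂ) * (v s / ω))
      (fun s hs => (((hcos s).mul (hd s hs)).sub ((hsn s).mul ((hd2 s hs).div_const _))).congr_deriv
        (by push_cast; field_simp; ring)) hs
    have c2 := constant_of_hasDerivWithinAt_zero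
      (f := fun s => (Real.sin (ω * s) : ℂ) * z s + (Real.cos (ω * s) : ℂ) * (v s / ω))
      (fun s hs => (((hsn s).mul (hd s hs)).add ((hcos s).mul ((hd2 s hs).div_const _))).congr_deriv
        (by push_cast; field_simp; ring)) hs
    simp only [mul_zero, Real.cos_zero, Real.sin_zero, Complex.ofReal_one, Complex.ofReal_zero,
      one_mul, zero_mul, sub_zero, zero_add, h0] at c1 c2
    linear_combination (Real.cos (ω * s) : ℂ) * c1 + (Real.sin (ω * s) : ℂ) * c2 - z s * hcs s
  have hB : v 0 / ω = (p₁ - Real.cos (ω * T) * p₀) / Real.sin (ω * T) := by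
    have := hrep T (right_mem_Icc.2 hT.le)
    rw [h1] at this
    have hs : (Real.sin (ω * T) : ℂ) ≠ 0 := by exact_mod_cast hsin.ne'
    rw [eq_div_iff hs]
    linear_combination -this
  refine ⟨fun s hs => ?_, ?_⟩
  · rw [hrep s hs, harmonicOrbit_eq hsin.ne', hB]
  · have hen := (hz 0 (left_mem_Icc.2 hT.le)).energy
    rw [outerPotential, h0, ← Complex.normSq_eq_norm_sq, ← Complex.normSq_eq_norm_sq] at hen
    have hn : Complex.normSq (v 0) = ω ^ 2 * (Complex.normSq (p₁ - Real.cos (ω * T) * p₀)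
        / Real.sin (ω * T) ^ 2) := by
      have := congrArg Complex.normSq hB
      rw [Complex.normSq_div, Complex.normSq_div, Complex.normSq_ofReal, Complex.normSq_ofReal] at this
      field_simp at this ⊢
      linarith
    rw [← hv, hn] at hen
    have hexp : Complex.normSq (p₁ - Real.cos (ω * T) * p₀) = Complex.normSq p₁
        - 2 * dot p₀ p₁ * Real.cos (ω * T) + Real.cos (ω * T) ^ 2 * Complex.normSq p₀ := by
      simp only [Complex.normSq_apply, dot, Complex.sub_re, Complex.sub_im, Complex.mul_re,
        Complex.mul_im, Complex.ofReal_re, Complex.ofReal_im]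
      ring
    rw [hexp] at hen
    have hc2 := Real.sin_sq_add_cos_sq (ω * T)
    set S := Real.sin (ω * T)
    set c := Real.cos (ω * T)
    field_simp at hen
    field_simp
    linear_combination hen + (2 * E - ω ^ 2 * Complex.normSq p₀) * hc2

/-- For z = p₀ cos ωs + B sin ωs the energy law reads |B|² + |p₀|² = 2E/ω²; after multiplication by
sin² ωT it is the quadratic in cos ωT. -/
lemma harmonicOrbit_isOuterClassical {E ω T : ℝ} (hω : 0 < ω) (hT : 0 < T) (hTω : T < Real.pi / ω)
    {p₀ p₁ : ℂ} (hroot : 2 * E / ω ^ 2 * Real.cos (ω * T) ^ 2 - 2 * dot p₀ p₁ * Real.cos (ω * T)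
        + Complex.normSq p₀ + Complex.normSq p₁ - 2 * E / ω ^ 2 = 0) :
    IsOuterClassical E ω T (harmonicOrbit ω T p₀ p₁) := by
  have hsin : 0 < Real.sin (ω * T) := Real.sin_pos_of_pos_of_lt_pi (mul_pos hω hT)
    (by rw [lt_div_iff₀ hω] at hTω; linarith)
  set B : ℂ := (p₁ - Real.cos (ω * T) * p₀) / Real.sin (ω * T) with hB
  have hfun : harmonicOrbit ω T p₀ p₁
      = fun s => (Real.cos (ω * s) : ℂ) * p₀ + (Real.sin (ω * s) : ℂ) * B :=
    funext fun s => harmonicOrbit_eq hsin.ne' p₀ p₁ s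
  have h00 : ∀ s : ℝ, HasDerivAt (fun t : ℝ => ω * t) ω s := fun s => by
    simpa using (hasDerivAt_id s).const_mul ω
  have hd : ∀ s, HasDerivAt (harmonicOrbit ω T p₀ p₁)
      ((ω : ℂ) * ((Real.cos (ω * s) : ℂ) * B - (Real.sin (ω * s) : ℂ) * p₀)) s := fun s => by
    rw [hfun]
    refine (((h00 s).cos.ofReal_comp.mul_const p₀).add
      ((h00 s).sin.ofReal_comp.mul_const B)).congr_deriv ?_
    push_cast; ring
  have hd2 : ∀ s, HasDerivAt (fun s : ℝ => (ω : ℂ) * ((Real.cos (ω * s) : ℂ) * B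
      - (Real.sin (ω * s) : ℂ) * p₀)) (((-ω ^ 2 : ℝ) : ℂ) * harmonicOrbit ω T p₀ p₁ s) s := fun s => by
    rw [hfun]
    refine ((((h00 s).cos.ofReal_comp.mul_const B).sub
      ((h00 s).sin.ofReal_comp.mul_const p₀)).const_mul (ω : ℂ)).congr_deriv ?_
    push_cast; ring
  have hu := uniqueDiffOn_Icc hT
  have hdw : ∀ s ∈ Icc 0 T, derivWithin (harmonicOrbit ω T p₀ p₁) (Icc 0 T) s
      = (ω : ℂ) * ((Real.cos (ω * s) : ℂ) * B - (Real.sin (ω * s) : ℂ) * p₀) := fun s hs =>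
    (hd s).hasDerivWithinAt.derivWithin (hu s hs)
  have hnB : Complex.normSq B + Complex.normSq p₀ = 2 * E / ω ^ 2 := by
    rw [hB, Complex.normSq_div, Complex.normSq_ofReal]
    have hexp : Complex.normSq (p₁ - Real.cos (ω * T) * p₀) = Complex.normSq p₁
        - 2 * dot p₀ p₁ * Real.cos (ω * T) + Real.cos (ω * T) ^ 2 * Complex.normSq p₀ := by
      simp only [Complex.normSq_apply, dot, Complex.sub_re, Complex.sub_im, Complex.mul_re,
        Complex.mul_im, Complex.ofReal_re, Complex.ofReal_im]
      ring
    rw [hexp, div_add' _ _ _ (by positivity), div_eq_iff (by positivity)]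
    have hc2 := Real.sin_sq_add_cos_sq (ω * T)
    linear_combination hroot + (Complex.normSq p₀ - 2 * E / ω ^ 2) * hc2
  intro s hs
  refine ⟨(hd s).differentiableAt.differentiableWithinAt, ?_, ?_⟩
  · rw [gradient_outerPotential]
    exact (hd2 s).hasDerivWithinAt.congr hdw (hdw s hs)
  · rw [hdw s hs, outerPotential, hfun]
    simp only
    rw [← Complex.normSq_eq_norm_sq, ← Complex.normSq_eq_norm_sq, Complex.normSq_mul,
      Complex.normSq_ofReal]
    have hE : 2 * E = ω ^ 2 * (Complex.normSq B + Complex.normSq p₀) := by rw [hnB]; field_simp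
    have hc2 := Real.sin_sq_add_cos_sq (ω * s)
    simp only [Complex.normSq_apply, Complex.sub_re, Complex.sub_im, Complex.add_re,
      Complex.add_im, Complex.mul_re, Complex.mul_im, Complex.ofReal_re, Complex.ofReal_im] at hE ⊢
    linear_combination (1 / 2 * ω ^ 2 * (B.re * B.re + B.im * B.im + p₀.re * p₀.re
      + p₀.im * p₀.im)) * hc2 - hE / 2

/-- The identity sin x + sin y - sin(x + y) = 4 sin(x/2) sin(y/2) sin((x + y)/2) measures how far
the arc lies beyond its chord. The lower bound carries the product of both weights, so it vanishes
at the ends no faster than the errors it has to absorb. -/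
lemma sum_weights_bound {x y : ℝ} (hx : 0 < x) (hy : 0 < y) (hxy : x + y < Real.pi) :
    Real.sin (x + y) ^ 2 / 2 * ((Real.sin x / Real.sin (x + y)) * (Real.sin y / Real.sin (x + y)))
      ≤ Real.sin x / Real.sin (x + y) + Real.sin y / Real.sin (x + y) - 1 := by
  have hs : 0 < Real.sin (x + y) := Real.sin_pos_of_pos_of_lt_pi (by linarith) hxy
  obtain ⟨X, rfl⟩ : ∃ X, x = 2 * X := ⟨x / 2, by ring⟩
  obtain ⟨Y, rfl⟩ : ∃ Y, y = 2 * Y := ⟨y / 2, by ring⟩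
  have hsX : 0 < Real.sin X := Real.sin_pos_of_pos_of_lt_pi (by linarith) (by linarith)
  have hsY : 0 < Real.sin Y := Real.sin_pos_of_pos_of_lt_pi (by linarith) (by linarith)
  have hsW : 0 < Real.sin (X + Y) := Real.sin_pos_of_pos_of_lt_pi (by linarith) (by linarith)
  have hcX : 0 < Real.cos X := Real.cos_pos_of_mem_Ioo ⟨by linarith, by linarith⟩
  have hcY : 0 < Real.cos Y := Real.cos_pos_of_mem_Ioo ⟨by linarith, by linarith⟩
  have hcW : 0 < Real.cos (X + Y) := Real.cos_pos_of_mem_Ioo ⟨by linarith, by linarith⟩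
  have hid : Real.sin (2 * X) + Real.sin (2 * Y) - Real.sin (2 * X + 2 * Y)
      = 4 * Real.sin X * Real.sin Y * Real.sin (X + Y) := by
    rw [Real.sin_add (2 * X), Real.sin_add X, Real.sin_two_mul, Real.sin_two_mul, Real.cos_two_mul,
      Real.cos_two_mul]
    have h1 := Real.sin_sq_add_cos_sq X
    have h2 := Real.sin_sq_add_cos_sq Y
    linear_combination (-4 * Real.sin Y * Real.cos Y) * h1 + (-4 * Real.sin X * Real.cos X) * h2
  have hW : Real.sin (2 * X + 2 * Y) = 2 * Real.sin (X + Y) * Real.cos (X + Y) := by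
    rw [← mul_add, Real.sin_two_mul]
  have e1 : Real.sin (2 * X) / Real.sin (2 * X + 2 * Y)
      + Real.sin (2 * Y) / Real.sin (2 * X + 2 * Y) - 1
      = 4 * Real.sin X * Real.sin Y * Real.sin (X + Y) / Real.sin (2 * X + 2 * Y) := by
    rw [← hid]
    generalize Real.sin (2 * X + 2 * Y) = W at hs
    field_simp
  have e2 : Real.sin (2 * X + 2 * Y) ^ 2 / 2 * ((Real.sin (2 * X) / Real.sin (2 * X + 2 * Y))
      * (Real.sin (2 * Y) / Real.sin (2 * X + 2 * Y)))
      = 2 * Real.sin X * Real.sin Y * (Real.cos X * Real.cos Y) := by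
    rw [Real.sin_two_mul X, Real.sin_two_mul Y]
    generalize Real.sin (2 * X + 2 * Y) = W at hs
    field_simp
  rw [e1, e2, le_div_iff₀ hs, hW]
  have h1 : Real.cos X * Real.cos Y * Real.cos (X + Y) ≤ 1 :=
    mul_le_one₀ (mul_le_one₀ (Real.cos_le_one X) hcY.le (Real.cos_le_one Y)) hcW.le
      (Real.cos_le_one _)
  have h2 : 0 ≤ 4 * Real.sin X * Real.sin Y * Real.sin (X + Y) := by positivity
  nlinarith

lemma polarCurve_ratio {ρ : ℝ → ℝ} {ξ₀ : ℝ} (h0 : 0 < ρ ξ₀) (ξ₁ : ℝ) : polarCurve ρ ξ₁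
    = polarCurve ρ ξ₀ * ((ρ ξ₁ / ρ ξ₀ : ℝ) * Complex.exp ((ξ₁ - ξ₀ : ℝ) * Complex.I)) := by
  have h : (ρ ξ₀ : ℂ) ≠ 0 := by exact_mod_cast h0.ne'
  rw [polarCurve, polarCurve, show (ξ₁ : ℂ) * Complex.I
    = (ξ₀ : ℂ) * Complex.I + ((ξ₁ - ξ₀ : ℝ) : ℂ) * Complex.I by push_cast; ring, Complex.exp_add]
  push_cast
  field_simp

lemma normSq_polarCurve (ρ : ℝ → ℝ) (ξ : ℝ) : Complex.normSq (polarCurve ρ ξ) = ρ ξ ^ 2 := by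
  rw [polarCurve, Complex.normSq_mul, Complex.normSq_ofReal, Complex.normSq_eq_norm_sq,
    Complex.norm_exp_ofReal_mul_I]
  ring

lemma dot_polarCurve (ρ : ℝ → ℝ) (ξ₀ ξ₁ : ℝ) :
    dot (polarCurve ρ ξ₀) (polarCurve ρ ξ₁) = ρ ξ₀ * ρ ξ₁ * Real.cos (ξ₁ - ξ₀) := by
  simp only [dot, polarCurve, Complex.re_ofReal_mul, Complex.im_ofReal_mul,
    Complex.exp_ofReal_mul_I_re, Complex.exp_ofReal_mul_I_im]
  rw [Real.cos_sub]; ring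

lemma normSq_add (p q : ℂ) :
    Complex.normSq (p + q) = Complex.normSq p + Complex.normSq q + 2 * dot p q := by
  simp only [Complex.normSq_apply, dot, Complex.add_re, Complex.add_im]; ring

lemma normSq_sub (p q : ℂ) :
    Complex.normSq (p - q) = Complex.normSq p + Complex.normSq q - 2 * dot p q := by
  simp only [Complex.normSq_apply, dot, Complex.sub_re, Complex.sub_im]; ring

/-- The polar radius in a direction close to that of `polarCurve ρ ξ₀`. -/
lemma NearCircle.arg_mul {κ : ℝ} {ρ : ℝ → ℝ} (hρ : NearCircle κ ρ) (hκ : κ < 1) (ξ₀ : ℝ) {u : ℂ}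
    (hu : u ≠ 0) : ρ (Complex.arg (polarCurve ρ ξ₀ * u)) = ρ (ξ₀ + u.arg) := by
  have h : polarCurve ρ ξ₀ * u
      = ((ρ ξ₀ * ‖u‖ : ℝ) : ℂ) * Complex.exp ((ξ₀ + u.arg : ℝ) * Complex.I) := by
    nth_rewrite 1 [← Complex.norm_mul_exp_arg_mul_I u]
    rw [polarCurve]
    push_cast
    rw [add_mul, Complex.exp_add]
    ring
  rw [h]
  exact arg_polar hρ.periodic (mul_pos (hρ.pos hκ ξ₀) (norm_pos_iff.2 hu)) _

/-- Outside the curve means outside the closure of the domain. -/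
lemma NearCircle.notMem_closure {κ : ℝ} {ρ : ℝ → ℝ} (hρ : NearCircle κ ρ) (hκ : κ < 1) {z : ℂ}
    (hz : ρ z.arg < ‖z‖) : z ∉ closure {y : ℂ | ‖y‖ < ρ y.arg} := by
  have hpos := hρ.pos hκ z.arg
  have hz0 : z ≠ 0 := norm_pos_iff.1 (hpos.trans hz)
  -- The angle arg z + arg(y/z) is continuous near z even when z lies on the cut of the principal
  -- argument.
  have hev : ∀ᶠ y in 𝓝 z, ρ (z.arg + (y / z).arg) < ‖y‖ := by
    have h1 : ContinuousAt (fun y : ℂ => ρ (z.arg + (y / z).arg)) z := by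
      have h2 : ContinuousAt (fun y : ℂ => (y / z).arg) z := by
        refine ContinuousAt.comp (g := Complex.arg) (Complex.continuousAt_arg ?_)
          (continuousAt_id.div_const z)
        simp [div_self hz0]
      exact hρ.smooth.continuous.continuousAt.comp (continuousAt_const.add h2)
    have h3 : ρ (z.arg + (z / z).arg) < ‖z‖ := by simpa [div_self hz0] using hz
    exact h1.eventually_lt continuous_norm.continuousAt h3
  have hev0 : ∀ᶠ y in 𝓝 z, y ≠ 0 := continuousAt_id.eventually_ne hz0
  rw [mem_closure_iff_frequently, not_frequently]
  filter_upwards [hev, hev0] with y hy hy0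
  have h : y = ((‖z‖ * ‖y / z‖ : ℝ) : ℂ) * Complex.exp ((z.arg + (y / z).arg : ℝ) * Complex.I) := by
    have e1 := Complex.norm_mul_exp_arg_mul_I z
    have e2 := Complex.norm_mul_exp_arg_mul_I (y / z)
    push_cast
    rw [add_mul, Complex.exp_add]
    calc y = z * (y / z) := by field_simp
      _ = (‖z‖ * Complex.exp (z.arg * Complex.I))
          * (‖y / z‖ * Complex.exp ((y / z).arg * Complex.I)) := by rw [e1, e2]
      _ = _ := by ring
  have h2 : ρ y.arg = ρ (z.arg + (y / z).arg) := by
    nth_rewrite 1 [h]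
    exact arg_polar hρ.periodic
      (mul_pos (norm_pos_iff.2 hz0) (norm_pos_iff.2 (div_ne_zero hy0 hz0))) _
  change ¬ ‖y‖ < ρ y.arg
  rw [h2]
  exact hy.le.not_gt

/-! ### Chords of a curve close to the unit circle. -/

section smallCurve

variable {κ : ℝ} {ρ : ℝ → ℝ} (hρ : NearCircle κ ρ) (hκ : κ ≤ 1 / 1000) {ξ₀ ξ₁ : ℝ}
  (hξ : |ξ₁ - ξ₀| ≤ 1 / 1000)
include hρ hκ hξ

lemma polarRatio_bounds :
    99 / 100 ≤ ρ ξ₁ / ρ ξ₀ ∧ ρ ξ₁ / ρ ξ₀ ≤ 101 / 100 ∧ 98 / 100 ≤ Real.cos (ξ₁ - ξ₀) := by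
  have h0 := abs_le.1 (hρ.near ξ₀)
  have h1 := abs_le.1 (hρ.near ξ₁)
  have p0 := hρ.pos (by linarith) ξ₀
  have h2 := Real.one_sub_sq_div_two_le_cos (x := ξ₁ - ξ₀)
  have h3 : (ξ₁ - ξ₀) ^ 2 ≤ 1 / 1000000 := by
    rw [← sq_abs]; nlinarith [abs_nonneg (ξ₁ - ξ₀)]
  refine ⟨?_, ?_, by linarith⟩
  · rw [le_div_iff₀ p0]; linarith
  · rw [div_le_iff₀ p0]; linarith

lemma polarRatio_re :
    97 / 100 ≤ ((ρ ξ₁ / ρ ξ₀ : ℝ) * Complex.exp ((ξ₁ - ξ₀ : ℝ) * Complex.I)).re := by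
  obtain ⟨h1, h2, h3⟩ := polarRatio_bounds hρ hκ hξ
  rw [Complex.re_ofReal_mul, Complex.exp_ofReal_mul_I_re]
  nlinarith

/-- Variation of the polar radius along the chord. -/
lemma abs_radius_sub_le {a b : ℝ} (ha : 0 < a) (hb : 0 < b) :
    |ρ (Complex.arg (a * polarCurve ρ ξ₀ + b * polarCurve ρ ξ₁)) - ρ ξ₀|
      ≤ κ * (2 * b * |ξ₁ - ξ₀| / (a + b)) := by
  obtain ⟨h1, h2, h3⟩ := polarRatio_bounds hρ hκ hξ
  have hκ0 : 0 ≤ κ := (abs_nonneg _).trans (hρ.near ξ₀)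
  have hre := polarRatio_re hρ hκ hξ
  have hq := polarCurve_ratio (hρ.pos (by linarith) ξ₀) ξ₁
  have him : ((ρ ξ₁ / ρ ξ₀ : ℝ) * Complex.exp ((ξ₁ - ξ₀ : ℝ) * Complex.I)).im
      = ρ ξ₁ / ρ ξ₀ * Real.sin (ξ₁ - ξ₀) := by
    rw [Complex.im_ofReal_mul, Complex.exp_ofReal_mul_I_im]
  set q : ℂ := (ρ ξ₁ / ρ ξ₀ : ℝ) * Complex.exp ((ξ₁ - ξ₀ : ℝ) * Complex.I)
  have hu : (a * polarCurve ρ ξ₀ + b * polarCurve ρ ξ₁ : ℂ) = polarCurve ρ ξ₀ * (a + b * q) := by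
    rw [hq]; ring
  have hure : (a + b * q : ℂ).re = a + b * q.re := by simp
  have huim : (a + b * q : ℂ).im = b * q.im := by simp
  have hurep : 97 / 100 * (a + b) ≤ (a + b * q : ℂ).re := by rw [hure]; nlinarith
  have hu0 : (a + b * q : ℂ) ≠ 0 := fun h => by
    rw [h] at hurep; simp at hurep; linarith
  rw [hu, hρ.arg_mul (by linarith) ξ₀ hu0]
  refine (hρ.lipschitz _ _).trans (mul_le_mul_of_nonneg_left ?_ hκ0)
  rw [add_sub_cancel_left]
  refine (abs_arg_le (by linarith)).trans ?_
  have hnorm : 97 / 100 * (a + b) ≤ ‖(a + b * q : ℂ)‖ := hurep.trans (Complex.re_le_norm _)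
  have hsin := Real.abs_sin_le_abs (x := ξ₁ - ξ₀)
  have hnum : |(a + b * q : ℂ).im| ≤ b * (101 / 100 * |ξ₁ - ξ₀|) := by
    rw [huim, him, abs_mul, abs_mul, abs_of_pos hb, abs_of_nonneg (by linarith : 0 ≤ ρ ξ₁ / ρ ξ₀)]
    gcongr
  have hab : 0 < a + b := by linarith
  calc Real.pi / 2 * (|(a + b * q : ℂ).im| / ‖(a + b * q : ℂ)‖)
      ≤ Real.pi / 2 * (b * (101 / 100 * |ξ₁ - ξ₀|) / (97 / 100 * (a + b))) := by
        have := Real.pi_pos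
        gcongr
    _ = (Real.pi / 2 * (101 / 97)) * (b * |ξ₁ - ξ₀| / (a + b)) := by field_simp
    _ ≤ 2 * (b * |ξ₁ - ξ₀| / (a + b)) := by
        have := Real.pi_lt_d2
        have h5 : 0 ≤ b * |ξ₁ - ξ₀| / (a + b) := by positivity
        nlinarith
    _ = _ := by ring

/-- A curve close to the unit circle is uniformly convex. -/
lemma chord_midpoint :
    (Complex.normSq (polarCurve ρ ξ₀) + Complex.normSq (polarCurve ρ ξ₁)) / 2
      ≤ ρ (Complex.arg (polarCurve ρ ξ₀ + polarCurve ρ ξ₁)) ^ 2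
        + 4 * κ * Complex.normSq (polarCurve ρ ξ₀ - polarCurve ρ ξ₁) := by
  have hκ0 : 0 ≤ κ := (abs_nonneg _).trans (hρ.near ξ₀)
  have hp0 := hρ.pos (by linarith) ξ₀
  have hre := polarRatio_re hρ hκ hξ
  have hq := polarCurve_ratio hp0 ξ₁
  have hqarg : ((ρ ξ₁ / ρ ξ₀ : ℝ) * Complex.exp ((ξ₁ - ξ₀ : ℝ) * Complex.I)).arg = ξ₁ - ξ₀ := by
    rw [Complex.arg_real_mul _ (div_pos (hρ.pos (by linarith) ξ₁) hp0), Complex.arg_exp_mul_I]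
    have h := abs_le.1 hξ
    have := Real.pi_gt_three
    exact (toIocMod_eq_self _).2 ⟨by linarith, by linarith⟩
  set q : ℂ := (ρ ξ₁ / ρ ξ₀ : ℝ) * Complex.exp ((ξ₁ - ξ₀ : ℝ) * Complex.I)
  -- The chord is γ(ξ₀) G(t), and g(t) = ρ² in its direction has second derivative at most 7κ|q -
  -- 1|². At t = 0 and t = 1 the function g is the squared modulus of the ends, and |q - 1| is
  -- proportional to the length of the chord.
  set G : ℝ → ℂ := fun t => 1 + t * (q - 1) with hG
  have hGre : ∀ t ∈ Icc (0 : ℝ) 1, 97 / 100 ≤ (G t).re := fun t ht => by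
    have : (G t).re = 1 + t * (q.re - 1) := by simp [hG]
    rw [this]; nlinarith [ht.1, ht.2]
  have hGslit : ∀ t ∈ Icc (0 : ℝ) 1, G t ∈ Complex.slitPlane := fun t ht =>
    Or.inl (by linarith [hGre t ht])
  have hG0 : ∀ t ∈ Icc (0 : ℝ) 1, G t ≠ 0 := fun t ht => Complex.slitPlane_ne_zero (hGslit t ht)
  have hGn : ∀ t ∈ Icc (0 : ℝ) 1, 97 / 100 ≤ ‖G t‖ := fun t ht =>
    (hGre t ht).trans (Complex.re_le_norm _)
  have hdG : ∀ t, HasDerivAt G (q - 1) t := fun t =>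
    (((hasDerivAt_id t).ofReal_comp.mul_const (q - 1)).const_add 1).congr_deriv (by simp)
  set θ : ℝ → ℝ := fun t => ξ₀ + (G t).arg with hθ
  set θ' : ℝ → ℝ := fun t => ((q - 1) / G t).im with hθ'
  set θ'' : ℝ → ℝ := fun t => (-((q - 1) * (q - 1)) / G t ^ 2).im with hθ''
  have hdθ : ∀ t ∈ Icc (0 : ℝ) 1, HasDerivAt θ (θ' t) t := fun t ht => by
    have h1 := Complex.imCLM.hasFDerivAt.comp_hasDerivAt t ((hdG t).clog_real (hGslit t ht))
    have h2 := h1.const_add ξ₀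
    refine h2.congr_of_eventuallyEq (Eventually.of_forall fun s => ?_)
    simp [hθ, Complex.log_im]
  have hdθ' : ∀ t ∈ Icc (0 : ℝ) 1, HasDerivAt θ' (θ'' t) t := fun t ht => by
    have h1 := Complex.imCLM.hasFDerivAt.comp_hasDerivAt t
      ((hasDerivAt_const t (q - 1)).div (hdG t) (hG0 t ht))
    refine h1.congr_deriv ?_
    simp [hθ'']
  set Q := ‖q - 1‖ with hQ
  have hθ'b : ∀ t ∈ Icc (0 : ℝ) 1, |θ' t| ≤ 11 / 10 * Q := fun t ht => by
    refine (Complex.abs_im_le_norm _).trans ?_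
    have := hGn t ht
    rw [norm_div, div_le_iff₀ (by linarith)]
    have : 0 ≤ Q := norm_nonneg _
    nlinarith
  have hθ''b : ∀ t ∈ Icc (0 : ℝ) 1, |θ'' t| ≤ 11 / 10 * Q ^ 2 := fun t ht => by
    refine (Complex.abs_im_le_norm _).trans ?_
    have h1 := hGn t ht
    rw [norm_div, norm_neg, norm_mul, norm_pow, ← sq, div_le_iff₀ (by positivity)]
    have h2 : (97 / 100) ^ 2 ≤ ‖G t‖ ^ 2 := by gcongr
    nlinarith [sq_nonneg Q]
  have hsm := hρ.smooth
  have hdρ : ∀ x, HasDerivAt ρ (deriv ρ x) x := fun x => (hρ.differentiable x).hasDerivAt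
  have hdρ' : ∀ x, HasDerivAt (deriv ρ) (deriv (deriv ρ) x) x := fun x => by
    have h1 : ContDiff ℝ 1 (deriv ρ) := by
      have := (contDiff_succ_iff_deriv (n := 1)).1 (by simpa [one_add_one_eq_two] using hsm)
      exact this.2.2
    exact (h1.differentiable one_ne_zero x).hasDerivAt
  set g : ℝ → ℝ := fun t => ρ (θ t) ^ 2 with hg
  set g' : ℝ → ℝ := fun t => 2 * (ρ (θ t) * (deriv ρ (θ t) * θ' t)) with hg'
  set g'' : ℝ → ℝ := fun t => 2 * (deriv ρ (θ t) * θ' t * (deriv ρ (θ t) * θ' t)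
    + ρ (θ t) * (deriv (deriv ρ) (θ t) * θ' t * θ' t + deriv ρ (θ t) * θ'' t)) with hg''
  have hdg : ∀ t ∈ Icc (0 : ℝ) 1, HasDerivAt g (g' t) t := fun t ht => by
    refine (((hdρ (θ t)).comp t (hdθ t ht)).pow 2).congr_deriv ?_
    simp [hg']; ring
  have hdg' : ∀ t ∈ Icc (0 : ℝ) 1, HasDerivAt g' (g'' t) t := fun t ht =>
    (((hdρ (θ t)).comp t (hdθ t ht)).mul
      (((hdρ' (θ t)).comp t (hdθ t ht)).mul (hdθ' t ht))).const_mul 2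
  have hg''b : ∀ t ∈ Icc (0 : ℝ) 1, |g'' t| ≤ 7 * κ * Q ^ 2 := fun t ht => by
    have b1 := hθ'b t ht
    have b2 := hθ''b t ht
    have b3 := hρ.deriv_le (θ t)
    have b4 := hρ.deriv2_le (θ t)
    have b5 : |ρ (θ t)| ≤ 101 / 100 := by
      have := abs_le.1 (hρ.near (θ t))
      exact abs_le.2 ⟨by linarith, by linarith⟩
    have hQ0 : 0 ≤ Q := norm_nonneg _
    have c1 : |deriv ρ (θ t) * θ' t * (deriv ρ (θ t) * θ' t)| ≤ κ * (11 / 10 * Q) * (1 / 1000 * (11 / 10 * Q)) := by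
      rw [abs_mul, abs_mul]
      have : |deriv ρ (θ t)| ≤ 1 / 1000 := b3.trans hκ
      gcongr
    have c2 : |ρ (θ t) * (deriv (deriv ρ) (θ t) * θ' t * θ' t + deriv ρ (θ t) * θ'' t)|
        ≤ 101 / 100 * (κ * (11 / 10 * Q) * (11 / 10 * Q) + κ * (11 / 10 * Q ^ 2)) := by
      rw [abs_mul]
      have d1 : |deriv (deriv ρ) (θ t) * θ' t * θ' t| ≤ κ * (11 / 10 * Q) * (11 / 10 * Q) := by
        rw [abs_mul, abs_mul]; gcongr
      have d2 : |deriv ρ (θ t) * θ'' t| ≤ κ * (11 / 10 * Q ^ 2) := by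
        rw [abs_mul]; gcongr
      have d3 := (abs_add_le (deriv (deriv ρ) (θ t) * θ' t * θ' t) (deriv ρ (θ t) * θ'' t)).trans
        (add_le_add d1 d2)
      gcongr
    have c3 := abs_add_le (deriv ρ (θ t) * θ' t * (deriv ρ (θ t) * θ' t))
      (ρ (θ t) * (deriv (deriv ρ) (θ t) * θ' t * θ' t + deriv ρ (θ t) * θ'' t))
    rw [hg'', abs_mul, abs_two]
    have hκQ : 0 ≤ κ * Q ^ 2 := by positivity
    nlinarith
  -- The mean value theorem on each half, then the Lipschitz bound on g', control the second
  -- difference g(0) + g(1) - 2g(1/2).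
  obtain ⟨c₁, hc₁, e₁⟩ := exists_hasDerivAt_eq_slope g g' (by norm_num : (0 : ℝ) < 1 / 2)
    (fun t ht => (hdg t ⟨ht.1, by linarith [ht.2]⟩).continuousAt.continuousWithinAt)
    (fun t ht => hdg t ⟨ht.1.le, by linarith [ht.2]⟩)
  obtain ⟨c₂, hc₂, e₂⟩ := exists_hasDerivAt_eq_slope g g' (by norm_num : (1 / 2 : ℝ) < 1)
    (fun t ht => (hdg t ⟨by linarith [ht.1], ht.2⟩).continuousAt.continuousWithinAt)
    (fun t ht => hdg t ⟨by linarith [ht.1], ht.2.le⟩)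
  have hlip : |g' c₂ - g' c₁| ≤ 7 * κ * Q ^ 2 * |c₂ - c₁| :=
    (convex_Icc (0 : ℝ) 1).norm_image_sub_le_of_norm_hasDerivWithin_le
      (fun t ht => (hdg' t ht).hasDerivWithinAt) hg''b
      ⟨hc₁.1.le, by linarith [hc₁.2]⟩ ⟨by linarith [hc₂.1], hc₂.2.le⟩
  have hcc : |c₂ - c₁| ≤ 1 := abs_le.2 ⟨by linarith [hc₁.2, hc₂.1], by linarith [hc₁.1, hc₂.2]⟩
  have hK : 0 ≤ 7 * κ * Q ^ 2 := by positivity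
  have hdiff : g 0 + g 1 - 2 * g (1 / 2) ≤ 7 * κ * Q ^ 2 / 2 := by
    have h1 : g' c₁ = 2 * (g (1 / 2) - g 0) := by rw [e₁]; ring
    have h2 : g' c₂ = 2 * (g 1 - g (1 / 2)) := by rw [e₂]; ring
    have h3 := (le_abs_self _).trans hlip
    nlinarith
  have g0 : g 0 = Complex.normSq (polarCurve ρ ξ₀) := by
    rw [normSq_polarCurve]; simp [hg, hθ, hG]
  have g1 : g 1 = Complex.normSq (polarCurve ρ ξ₁) := by
    rw [normSq_polarCurve]; simp [hg, hθ, hG, hqarg]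
  have gm : g (1 / 2) = ρ (Complex.arg (polarCurve ρ ξ₀ + polarCurve ρ ξ₁)) ^ 2 := by
    have h2 : polarCurve ρ ξ₀ + polarCurve ρ ξ₁ = ((2 : ℝ) : ℂ) * (polarCurve ρ ξ₀ * G (1 / 2)) := by
      rw [hq]; simp only [hG]; push_cast; ring
    rw [h2, Complex.arg_real_mul _ two_pos,
      hρ.arg_mul (by linarith) ξ₀ (hG0 _ ⟨by norm_num, by norm_num⟩)]
  have hD : Complex.normSq (polarCurve ρ ξ₀ - polarCurve ρ ξ₁) = ρ ξ₀ ^ 2 * Q ^ 2 := by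
    have h3 : polarCurve ρ ξ₀ - polarCurve ρ ξ₁ = -(polarCurve ρ ξ₀ * (q - 1)) := by rw [hq]; ring
    rw [h3, Complex.normSq_neg, Complex.normSq_mul, normSq_polarCurve,
      Complex.normSq_eq_norm_sq (q - 1)]
  rw [hD, ← g0, ← g1, ← gm]
  have hρ0 : 99 / 100 ≤ ρ ξ₀ ^ 2 := by
    have := abs_le.1 (hρ.near ξ₀)
    nlinarith
  have hκQ : 0 ≤ κ * Q ^ 2 := by positivity
  nlinarith

end smallCurve

/-! ### The two roots of the outer energy quadratic and the position of their arcs. -/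

section outer

variable {M e : ℝ} (hM : 2 < M) (he0 : 0 < e) (he1 : e ≤ 1 / 1000) (he2 : 1000 * M ^ 2 * e ≤ M - 2)
  {ρ : ℝ → ℝ} (hρ : NearCircle e ρ) {ξ₀ ξ₁ : ℝ} (hξ : |ξ₁ - ξ₀| ≤ e)

include he0 he1 hρ hξ in
lemma polar_products :
    1 - 22 / 10 * e ≤ ρ ξ₀ * ρ ξ₁ * Real.cos (ξ₁ - ξ₀) ∧ ρ ξ₀ ^ 2 ≤ 1 + 22 / 10 * e ∧
      ρ ξ₁ ^ 2 ≤ 1 + 22 / 10 * e := by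
  have h0 := abs_le.1 (hρ.near ξ₀)
  have h1 := abs_le.1 (hρ.near ξ₁)
  have h2 := Real.one_sub_sq_div_two_le_cos (x := ξ₁ - ξ₀)
  have h3 : (ξ₁ - ξ₀) ^ 2 ≤ e ^ 2 := by rw [← sq_abs (ξ₁ - ξ₀)]; gcongr
  have h4 : 1 - e ^ 2 / 2 ≤ Real.cos (ξ₁ - ξ₀) := by linarith
  refine ⟨?_, by nlinarith, by nlinarith⟩
  have h5 : (1 - e) * (1 - e) ≤ ρ ξ₀ * ρ ξ₁ :=
    mul_le_mul (by linarith) (by linarith) (by linarith) (by linarith)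
  have h6 : (1 - e) * (1 - e) * (1 - e ^ 2 / 2) ≤ ρ ξ₀ * ρ ξ₁ * Real.cos (ξ₁ - ξ₀) :=
    mul_le_mul h5 h4 (by nlinarith) (le_trans (by nlinarith) h5)
  have h7 : e ^ 2 ≤ 1 / 1000 * e := by nlinarith
  have h8 : (1 - 2 * e) * (1 - e ^ 2 / 2) ≤ (1 - e) * (1 - e) * (1 - e ^ 2 / 2) :=
    mul_le_mul_of_nonneg_right (by linarith [sq_nonneg e]) (by linarith)
  have h9 : 0 ≤ e * e ^ 2 := by positivity
  linarith

include hM he0 he1 he2 hρ hξ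

/-- This is M times the value of the quadratic at 2/M, so 2/M lies strictly between the roots. In
the unperturbed case it equals -M(M - 2). -/
lemma outer_quadratic_neg : 4 - 4 * (ρ ξ₀ * ρ ξ₁ * Real.cos (ξ₁ - ξ₀))
    + M * (ρ ξ₀ ^ 2 + ρ ξ₁ ^ 2 - M) < 0 := by
  obtain ⟨h1, h2, h3⟩ := polar_products he0 he1 hρ hξ
  have h4 : M * (ρ ξ₀ ^ 2 + ρ ξ₁ ^ 2 - M) ≤ M * (2 + 44 / 10 * e - M) :=
    mul_le_mul_of_nonneg_left (by linarith) (by linarith)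
  have h5 : 2000 * (M * e) ≤ M - 2 := by nlinarith [mul_pos he0 (by linarith : 0 < M)]
  nlinarith [mul_pos he0 (by linarith : 0 < M - 2)]

lemma outer_root_exists : ∃ c : ℝ, -1 < c ∧ c < 2 / M ∧
    M * c ^ 2 - 2 * (ρ ξ₀ * ρ ξ₁ * Real.cos (ξ₁ - ξ₀)) * c + ρ ξ₀ ^ 2 + ρ ξ₁ ^ 2 - M = 0 := by
  have hneg := outer_quadratic_neg hM he0 he1 he2 hρ hξ
  obtain ⟨h1, h2, h3⟩ := polar_products he0 he1 hρ hξ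
  have hM0 : 0 < M := by linarith
  set d := ρ ξ₀ * ρ ξ₁ * Real.cos (ξ₁ - ξ₀)
  set g : ℝ → ℝ := fun c => M * c ^ 2 - 2 * d * c + ρ ξ₀ ^ 2 + ρ ξ₁ ^ 2 - M with hg
  have hgm : 0 < g (-1) := by
    simp only [hg]
    nlinarith [sq_nonneg (ρ ξ₀), sq_nonneg (ρ ξ₁)]
  have hg2 : g (2 / M) < 0 := by
    have : g (2 / M) = (4 - 4 * d + M * (ρ ξ₀ ^ 2 + ρ ξ₁ ^ 2 - M)) / M := by
      simp only [hg]; field_simp; ring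
    rw [this]
    exact div_neg_of_neg_of_pos hneg hM0
  have hle : -1 ≤ 2 / M := by have : 0 < 2 / M := by positivity
                              linarith
  obtain ⟨c, hc, hc0⟩ := intermediate_value_Icc' hle (f := g) (by fun_prop) ⟨hg2.le, hgm.le⟩
  refine ⟨c, lt_of_le_of_ne hc.1 ?_, lt_of_le_of_ne hc.2 ?_, hc0⟩
  · rintro rfl; exact hgm.ne' hc0
  · rintro rfl; exact hg2.ne hc0

/-- For two distinct roots (2 - M c)(2 - M c') is M times the value at 2/M, which is negative; so
they are not both below 2/M. -/
lemma outer_root_unique {c c' : ℝ} (hc : c < 2 / M) (hc' : c' < 2 / M)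
    (h : M * c ^ 2 - 2 * (ρ ξ₀ * ρ ξ₁ * Real.cos (ξ₁ - ξ₀)) * c + ρ ξ₀ ^ 2 + ρ ξ₁ ^ 2 - M = 0)
    (h' : M * c' ^ 2 - 2 * (ρ ξ₀ * ρ ξ₁ * Real.cos (ξ₁ - ξ₀)) * c' + ρ ξ₀ ^ 2 + ρ ξ₁ ^ 2 - M = 0) :
    c = c' := by
  have hneg := outer_quadratic_neg hM he0 he1 he2 hρ hξ
  have hM0 : 0 < M := by linarith
  set d := ρ ξ₀ * ρ ξ₁ * Real.cos (ξ₁ - ξ₀)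
  by_contra hne
  have h1 : M * (c + c') = 2 * d := by
    apply mul_left_cancel₀ (sub_ne_zero.2 hne)
    linear_combination h - h'
  rw [lt_div_iff₀ hM0] at hc hc'
  have h2 := mul_pos (sub_pos.2 hc) (sub_pos.2 hc')
  have h3 : (2 - c * M) * (2 - c' * M) = 4 - 4 * d + M * (ρ ξ₀ ^ 2 + ρ ξ₁ ^ 2 - M) := by
    linear_combination (-2 + M * c) * h1 - M * h
  linarith

set_option maxHeartbeats 1000000 in
/-- The long harmonic arc stays outside the domain. -/
lemma outer_arc_outside {ω T : ℝ} (hω : 0 < ω) (hT : 0 < T) (hTω : T < Real.pi / ω)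
    (hc : Real.cos (ω * T) < 2 / M)
    (hroot : M * Real.cos (ω * T) ^ 2
      - 2 * (ρ ξ₀ * ρ ξ₁ * Real.cos (ξ₁ - ξ₀)) * Real.cos (ω * T)
      + ρ ξ₀ ^ 2 + ρ ξ₁ ^ 2 - M = 0) {s : ℝ} (hs : s ∈ Ioo 0 T) :
    harmonicOrbit ω T (polarCurve ρ ξ₀) (polarCurve ρ ξ₁) s ∉ closure {y : ℂ | ‖y‖ < ρ y.arg} := by
  apply hρ.notMem_closure (by linarith)
  obtain ⟨h1, h2, h3⟩ := polar_products he0 he1 hρ hξ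
  have hM0 : 0 < M := by linarith
  have hωT : ω * T < Real.pi := by rw [lt_div_iff₀ hω] at hTω; linarith
  have hωT0 : 0 < ω * T := mul_pos hω hT
  have hsin : 0 < Real.sin (ω * T) := Real.sin_pos_of_pos_of_lt_pi hωT0 hωT
  have hx : 0 < ω * (T - s) := mul_pos hω (sub_pos.2 hs.2)
  have hy : 0 < ω * s := mul_pos hω hs.1
  have hxy : ω * (T - s) + ω * s = ω * T := by ring
  have hw := sum_weights_bound hx hy (by rw [hxy]; exact hωT)
  rw [hxy] at hw
  have ha : 0 < Real.sin (ω * (T - s)) / Real.sin (ω * T) :=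
    div_pos (Real.sin_pos_of_pos_of_lt_pi hx (by linarith)) hsin
  have hb : 0 < Real.sin (ω * s) / Real.sin (ω * T) :=
    div_pos (Real.sin_pos_of_pos_of_lt_pi hy (by linarith)) hsin
  -- The motion must not be too close to the singular values ωT = 0, π. The factor M(1 - c) is at
  -- least M - 2 since c < 2/M; the quadratic bounds M(1 + c) below by about 2; and M - 2 ≥ 1000 M²
  -- e.
  have hκ2 : 900 * e ≤ Real.sin (ω * T) ^ 2 / 2 := by
    have hs2 := Real.sin_sq_add_cos_sq (ω * T)
    rw [lt_div_iff₀ hM0] at hc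
    set c := Real.cos (ω * T)
    set d := ρ ξ₀ * ρ ξ₁ * Real.cos (ξ₁ - ξ₀)
    have hcsq : c ^ 2 < 1 := by linarith [pow_pos hsin 2]
    obtain ⟨hcm, hc1⟩ := abs_lt.1 ((sq_lt_one_iff_abs_lt_one c).1 hcsq)
    have hd1 : 2 * d ≤ ρ ξ₀ ^ 2 + ρ ξ₁ ^ 2 := by
      have := Real.cos_le_one (ξ₁ - ξ₀)
      have p0 := hρ.pos (by linarith) ξ₀
      have p1 := hρ.pos (by linarith) ξ₁
      have := mul_le_mul_of_nonneg_left this (mul_pos p0 p1).le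
      nlinarith [sq_nonneg (ρ ξ₀ - ρ ξ₁)]
    have hS : (ρ ξ₀ ^ 2 + ρ ξ₁ ^ 2 + 2 * d) ≤ 2 * M * (1 + c) := by
      have h5 : (1 - c) * (ρ ξ₀ ^ 2 + ρ ξ₁ ^ 2 + 2 * d)
          ≤ (1 - c) * (2 * M * (1 + c)) := by
        have h4 : (ρ ξ₀ ^ 2 + ρ ξ₁ ^ 2 - 2 * d) * (1 + c)
            = (1 - c) * (2 * M * (1 + c) - (ρ ξ₀ ^ 2 + ρ ξ₁ ^ 2 + 2 * d)) := by
          linear_combination 2 * hroot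
        have h4' := mul_nonneg (sub_nonneg.2 hd1) (by linarith : 0 ≤ 1 + c)
        rw [h4] at h4'
        linarith
      exact le_of_mul_le_mul_left h5 (by linarith)
    have h6 : 19 / 10 ≤ M * (1 + c) := by linarith
    have h7 : M - 2 ≤ M * (1 - c) := by linarith
    have h8 : (M - 2) * (19 / 10) ≤ M * (1 - c) * (M * (1 + c)) :=
      mul_le_mul h7 h6 (by norm_num) (by linarith)
    have h9 : M ^ 2 * (1900 * e) ≤ M ^ 2 * (1 - c ^ 2) := by linarith
    have h10 := le_of_mul_le_mul_left h9 (by positivity)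
    linarith
  rw [harmonicOrbit]
  set a := Real.sin (ω * (T - s)) / Real.sin (ω * T)
  set b := Real.sin (ω * s) / Real.sin (ω * T)
  have hab0 : 0 < a * b := mul_pos ha hb
  have hab : 1 + 900 * e * (a * b) ≤ a + b := by
    linarith [mul_le_mul_of_nonneg_right hκ2 hab0.le]
  have hr0 := abs_le.1 (abs_radius_sub_le hρ he1 (hξ.trans he1) ha hb)
  have hr1 := abs_le.1 (abs_radius_sub_le hρ he1
    (by rw [abs_sub_comm]; exact hξ.trans he1 : |ξ₀ - ξ₁| ≤ 1 / 1000) hb ha)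
  rw [add_comm (b * polarCurve ρ ξ₁) (a * polarCurve ρ ξ₀), abs_sub_comm ξ₀, add_comm b a] at hr1
  have hRn := abs_le.1 (hρ.near (Complex.arg (a * polarCurve ρ ξ₀ + b * polarCurve ρ ξ₁)))
  set R := ρ (Complex.arg (a * polarCurve ρ ξ₀ + b * polarCurve ρ ξ₁))
  have hp0 := abs_le.1 (hρ.near ξ₀)
  have hp1 := abs_le.1 (hρ.near ξ₁)
  have hab1 : 1 ≤ a + b := by linarith [mul_pos he0 hab0]
  have hη0 := abs_nonneg (ξ₁ - ξ₀)
  have hdiv : ∀ x, 0 ≤ x → x / (a + b) ≤ x := fun x hx => div_le_self hx hab1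
  -- The boundary radius R in the direction of the point differs from ρ(ξ₀) by O(e² b) and from
  -- ρ(ξ₁) by O(e² a), so the weighted error carries the product ab.
  have hY : (a + b) * R - 4 * e ^ 2 * (a * b) ≤ a * ρ ξ₀ + b * ρ ξ₁ := by
    have k0 : e * (2 * b * |ξ₁ - ξ₀| / (a + b)) ≤ e * (2 * b * e) := by
      refine mul_le_mul_of_nonneg_left ((hdiv _ (by positivity)).trans ?_) he0.le
      gcongr
    have k1 : e * (2 * a * |ξ₁ - ξ₀| / (a + b)) ≤ e * (2 * a * e) := by
      refine mul_le_mul_of_nonneg_left ((hdiv _ (by positivity)).trans ?_) he0.le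
      gcongr
    have j0 : R - ρ ξ₀ ≤ e * (2 * b * e) := hr0.2.trans k0
    have j1 : R - ρ ξ₁ ≤ e * (2 * a * e) := hr1.2.trans k1
    linarith [mul_le_mul_of_nonneg_left j0 ha.le, mul_le_mul_of_nonneg_left j1 hb.le]
  have hY2 : R + 800 * e * (a * b) ≤ a * ρ ξ₀ + b * ρ ξ₁ := by
    have k2 : e ^ 2 * (a * b) ≤ 1 / 1000 * (e * (a * b)) := by
      have := mul_le_mul_of_nonneg_right he1 (mul_pos he0 hab0).le
      linarith
    have k3 : (1 + 900 * e * (a * b)) * R ≤ (a + b) * R :=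
      mul_le_mul_of_nonneg_right hab (by linarith)
    have k4 : 0 < e * (a * b) := mul_pos he0 hab0
    have k5 : 99 / 100 * (e * (a * b)) ≤ R * (e * (a * b)) :=
      mul_le_mul_of_nonneg_right (by linarith) k4.le
    linarith
  have hnorm : ‖(a * polarCurve ρ ξ₀ + b * polarCurve ρ ξ₁ : ℂ)‖ ^ 2
      = (a * ρ ξ₀) ^ 2 + (b * ρ ξ₁) ^ 2
        + 2 * (a * b) * (ρ ξ₀ * ρ ξ₁ * Real.cos (ξ₁ - ξ₀)) := by
    have hda : dot (a * polarCurve ρ ξ₀) (b * polarCurve ρ ξ₁)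
        = a * b * dot (polarCurve ρ ξ₀) (polarCurve ρ ξ₁) := by
      simp [dot]; ring
    rw [← Complex.normSq_eq_norm_sq, normSq_add, Complex.normSq_mul, Complex.normSq_mul,
      Complex.normSq_ofReal, Complex.normSq_ofReal, normSq_polarCurve, normSq_polarCurve, hda,
      dot_polarCurve]
    ring
  have hcosb : ρ ξ₀ * ρ ξ₁ - 6 / 10 * e ^ 2 ≤ ρ ξ₀ * ρ ξ₁ * Real.cos (ξ₁ - ξ₀) := by
    have h2 := Real.one_sub_sq_div_two_le_cos (x := ξ₁ - ξ₀)
    have h3 : (ξ₁ - ξ₀) ^ 2 ≤ e ^ 2 := by rw [← sq_abs (ξ₁ - ξ₀)]; gcongr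
    have h4 : ρ ξ₀ * ρ ξ₁ ≤ 12 / 10 := by nlinarith
    have h5 : 0 < ρ ξ₀ * ρ ξ₁ := mul_pos (by linarith) (by linarith)
    have h6 : 1 - e ^ 2 / 2 ≤ Real.cos (ξ₁ - ξ₀) := by linarith
    linarith [mul_le_mul_of_nonneg_left h6 h5.le, mul_le_mul_of_nonneg_right h4 (sq_nonneg e)]
  have hR0 : 0 < R := by linarith
  -- All losses are of size e² ab, including the one from the angle between the ends, and the gain
  -- from the bulge is of size e ab.
  have hfin : R ^ 2 < ‖(a * polarCurve ρ ξ₀ + b * polarCurve ρ ξ₁ : ℂ)‖ ^ 2 := by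
    rw [hnorm]
    have k5 : (R + 800 * e * (a * b)) ^ 2 ≤ (a * ρ ξ₀ + b * ρ ξ₁) ^ 2 := by gcongr
    have k6 := mul_le_mul_of_nonneg_left hcosb hab0.le
    have k7 : e ^ 2 * (a * b) ≤ 1 / 1000 * (e * (a * b)) := by
      have := mul_le_mul_of_nonneg_right he1 (mul_pos he0 hab0).le
      linarith
    have k8 : 0 < e * (a * b) := mul_pos he0 hab0
    have k9 : 99 / 100 * (e * (a * b)) ≤ R * (e * (a * b)) :=
      mul_le_mul_of_nonneg_right (by linarith) k8.le
    linarith only [k5, k6, k7, k8, k9, sq_nonneg (e * (a * b))]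
  exact lt_of_pow_lt_pow_left₀ 2 (norm_nonneg _) hfin

set_option maxHeartbeats 1000000 in
/-- A harmonic arc whose midpoint is outside the domain is long. -/
lemma cos_lt_of_outside {ω T : ℝ} (hω : 0 < ω) (hT : 0 < T) (hTω : T < Real.pi / ω)
    (hroot : M * Real.cos (ω * T) ^ 2
      - 2 * (ρ ξ₀ * ρ ξ₁ * Real.cos (ξ₁ - ξ₀)) * Real.cos (ω * T)
      + ρ ξ₀ ^ 2 + ρ ξ₁ ^ 2 - M = 0)
    (hout : ρ (Complex.arg (harmonicOrbit ω T (polarCurve ρ ξ₀) (polarCurve ρ ξ₁) (T / 2)))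
      ≤ ‖harmonicOrbit ω T (polarCurve ρ ξ₀) (polarCurve ρ ξ₁) (T / 2)‖) :
    Real.cos (ω * T) < 2 / M := by
  obtain ⟨h1, h2, h3⟩ := polar_products he0 he1 hρ hξ
  have hM0 : 0 < M := by linarith
  have hωT : ω * T < Real.pi := by rw [lt_div_iff₀ hω] at hTω; linarith
  have hωT0 : 0 < ω * T := mul_pos hω hT
  have hsin : 0 < Real.sin (ω * T) := Real.sin_pos_of_pos_of_lt_pi hωT0 hωT
  have hch : 0 < Real.cos (ω * T / 2) := Real.cos_pos_of_mem_Ioo ⟨by linarith, by linarith⟩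
  have hsh : 0 < Real.sin (ω * T / 2) := Real.sin_pos_of_pos_of_lt_pi (by linarith) (by linarith)
  have hdouble : Real.sin (ω * T) = 2 * Real.sin (ω * T / 2) * Real.cos (ω * T / 2) := by
    rw [← Real.sin_two_mul]; congr 1; ring
  have hcos2 : 2 * Real.cos (ω * T / 2) ^ 2 = 1 + Real.cos (ω * T) := by
    rw [Real.cos_sq, show 2 * (ω * T / 2) = ω * T by ring]; ring
  -- Both weights at half time are 1/(2 cos(ωT/2)), so only the direction of the midpoint of the
  -- chord matters.
  have hmid : harmonicOrbit ω T (polarCurve ρ ξ₀) (polarCurve ρ ξ₁) (T / 2)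
      = ((1 / (2 * Real.cos (ω * T / 2)) : ℝ) : ℂ) * (polarCurve ρ ξ₀ + polarCurve ρ ξ₁) := by
    have e1 : Real.sin (ω * (T - T / 2)) / Real.sin (ω * T) = 1 / (2 * Real.cos (ω * T / 2)) := by
      rw [hdouble, show ω * (T - T / 2) = ω * T / 2 by ring]; field_simp
    have e2 : Real.sin (ω * (T / 2)) / Real.sin (ω * T) = 1 / (2 * Real.cos (ω * T / 2)) := by
      rw [hdouble, show ω * (T / 2) = ω * T / 2 by ring]; field_simp
    rw [harmonicOrbit, e1, e2]; ring
  have hfac : 0 < 1 / (2 * Real.cos (ω * T / 2)) := by positivity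
  rw [hmid, Complex.arg_real_mul _ hfac, norm_mul, Complex.norm_real,
    Real.norm_of_nonneg hfac.le] at hout
  have hch2 := chord_midpoint hρ he1 (hξ.trans he1)
  have hRn := abs_le.1 (hρ.near (Complex.arg (polarCurve ρ ξ₀ + polarCurve ρ ξ₁)))
  have hS : Complex.normSq (polarCurve ρ ξ₀ + polarCurve ρ ξ₁)
      = ρ ξ₀ ^ 2 + ρ ξ₁ ^ 2 + 2 * (ρ ξ₀ * ρ ξ₁ * Real.cos (ξ₁ - ξ₀)) := by
    rw [normSq_add, normSq_polarCurve, normSq_polarCurve, dot_polarCurve]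
  have hD : Complex.normSq (polarCurve ρ ξ₀ - polarCurve ρ ξ₁)
      = ρ ξ₀ ^ 2 + ρ ξ₁ ^ 2 - 2 * (ρ ξ₀ * ρ ξ₁ * Real.cos (ξ₁ - ξ₀)) := by
    rw [normSq_sub, normSq_polarCurve, normSq_polarCurve, dot_polarCurve]
  have hD0 := Complex.normSq_nonneg (polarCurve ρ ξ₀ - polarCurve ρ ξ₁)
  rw [hD, normSq_polarCurve, normSq_polarCurve] at hch2
  rw [hD] at hD0
  set R := ρ (Complex.arg (polarCurve ρ ξ₀ + polarCurve ρ ξ₁))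
  have hR0 : 0 < R := by linarith
  have hR2 : R ^ 2 ≤ 1 + 3 * e := by
    have := pow_le_pow_left₀ hR0.le (by linarith : R ≤ 1 + e) 2
    nlinarith
  have hX : 2 * (1 + Real.cos (ω * T)) * R ^ 2
      ≤ ρ ξ₀ ^ 2 + ρ ξ₁ ^ 2 + 2 * (ρ ξ₀ * ρ ξ₁ * Real.cos (ξ₁ - ξ₀)) := by
    rw [← hS, Complex.normSq_eq_norm_sq, ← hcos2]
    have k : 2 * Real.cos (ω * T / 2) * R ≤ ‖polarCurve ρ ξ₀ + polarCurve ρ ξ₁‖ := by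
      rw [one_div, inv_mul_eq_div, le_div_iff₀ (by positivity)] at hout
      linarith
    calc _ = (2 * Real.cos (ω * T / 2) * R) ^ 2 := by ring
      _ ≤ _ := by gcongr
  have hc1 : Real.cos (ω * T) < 1 := by
    have hcsq : Real.cos (ω * T) ^ 2 < 1 := by
      linarith [Real.sin_sq_add_cos_sq (ω * T), pow_pos hsin 2]
    exact (abs_lt.1 ((sq_lt_one_iff_abs_lt_one _).1 hcsq)).2
  have hcm : 0 < 1 + Real.cos (ω * T) := by rw [← hcos2]; positivity
  rw [lt_div_iff₀ hM0]
  have hSpos := Complex.normSq_nonneg (polarCurve ρ ξ₀ + polarCurve ρ ξ₁)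
  rw [hS] at hSpos
  by_contra hcon
  rw [not_lt] at hcon
  set c := Real.cos (ω * T)
  set d := ρ ξ₀ * ρ ξ₁ * Real.cos (ξ₁ - ξ₀)
  set n := ρ ξ₀ ^ 2 + ρ ξ₁ ^ 2 with hn
  -- The energy quadratic in terms of the squared chord n - 2d and the squared norm n + 2d of the
  -- sum of the ends.
  have hrel : (n - 2 * d) * (1 + c) = (1 - c) * (2 * M * (1 + c) - (n + 2 * d)) := by
    linear_combination 2 * hroot
  -- The midpoint being outside bounds the squared chord by a multiple of 1 - c. Inserted in `hrel`
  -- this leaves, up to O(e), (1 + c)(2M - 2) ≤ 4, which contradicts c ≥ 2/M because (M - 2)(M + 1)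
  -- > 0.
  have hDle : (n - 2 * d) * (1 - 16 * e) ≤ 2 * (1 - c) * R ^ 2 := by linarith
  have hkey : (2 * M * (1 + c) - (n + 2 * d)) * (1 - 16 * e) ≤ 2 * R ^ 2 * (1 + c) := by
    have h5 : (1 - c) * ((2 * M * (1 + c) - (n + 2 * d)) * (1 - 16 * e))
        ≤ (1 - c) * (2 * R ^ 2 * (1 + c)) := by
      have h6 := mul_le_mul_of_nonneg_right hDle hcm.le
      calc (1 - c) * ((2 * M * (1 + c) - (n + 2 * d)) * (1 - 16 * e))
          = (n - 2 * d) * (1 - 16 * e) * (1 + c) := by linear_combination (-(1 - 16 * e)) * hrel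
        _ ≤ 2 * (1 - c) * R ^ 2 * (1 + c) := h6
        _ = _ := by ring
    exact le_of_mul_le_mul_left h5 (by linarith)
  have hSle : n + 2 * d ≤ 4 + 12 * e := by
    have h8 : (n - 2 * d) * (16 * e) ≤ (n - 2 * d) * 1 :=
      mul_le_mul_of_nonneg_left (by linarith) hD0
    linarith
  have hlin : (1 + c) * (2 * M * (1 - 16 * e) - 2 - 6 * e) ≤ 4 + 12 * e := by
    have h7 : (1 + c) * (2 * R ^ 2) ≤ (1 + c) * (2 + 6 * e) :=
      mul_le_mul_of_nonneg_left (by linarith) hcm.le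
    have h8 : 0 ≤ (n + 2 * d) * (16 * e) := by positivity
    linarith
  have hMe : 2000 * (M * e) ≤ M - 2 := by nlinarith [mul_pos he0 hM0]
  have hM1c : M + 2 ≤ M * (1 + c) := by linarith
  have hpos : 0 ≤ 2 * M * (1 - 16 * e) - 2 - 6 * e := by linarith
  have hA : (M + 2) * (2 * M * (1 - 16 * e) - 2 - 6 * e) ≤ M * (4 + 12 * e) := by
    have h9 := mul_le_mul_of_nonneg_right hM1c hpos
    have h10 := mul_le_mul_of_nonneg_left hlin hM0.le
    linarith
  have hMM : 4 * e ≤ 2 * (M * e) := by linarith [mul_le_mul_of_nonneg_left hM.le he0.le]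
  have hMM2 : 2 * (M * e) ≤ M ^ 2 * e := by
    linarith [mul_le_mul_of_nonneg_left hM.le (mul_pos he0 hM0).le]
  nlinarith

end outer

lemma outer_arcs (E ω Cε : ℝ) (hω : 0 < ω) (hCε : 0 < Cε) (f : ℝ → ℝ → ℝ)
    (hper : ∀ ε ∈ Icc (-Cε) Cε, Function.Periodic (fun ξ => f ξ ε) (2 * Real.pi))
    (hf : ContDiffOn ℝ 2 (fun p : ℝ × ℝ => f p.1 p.2) (univ ×ˢ Icc (-Cε) Cε)) (hE : ω ^ 2 < E) :
    ∃ εE δE : ℝ, 0 < εE ∧ εE ≤ Cε ∧ 0 < δE ∧ δE ≤ Real.pi ∧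
      ∀ ε ξ₀ ξ₁ : ℝ, |ε| < εE → |ξ₀ - ξ₁| < δE →
        ∃ (T : ℝ) (z : ℝ → ℂ), T < Real.pi / ω ∧
          IsOuterArc E ω f ε ξ₀ ξ₁ T z ∧
          (∀ z' : ℝ → ℂ, IsOuterFixedEnds E ω f ε ξ₀ ξ₁ T z' → EqOn z' z (Icc 0 T)) ∧
          (∀ (T' : ℝ) (z' : ℝ → ℂ), T' < Real.pi / ω → IsOuterArc E ω f ε ξ₀ ξ₁ T' z' →
            T' = T ∧ EqOn z' z (Icc 0 T)) := by
  set M := 2 * E / ω ^ 2 with hMdef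
  have hM : 2 < M := by rw [hMdef, lt_div_iff₀ (by positivity)]; linarith
  have hM0 : 0 < M := by linarith
  -- One small number serves both as the distance to the unit circle in C² and as the bound on |ξ₀ -
  -- ξ₁|; it shrinks with M - 2, that is, as E approaches ω².
  set e := min (1 / 1000) ((M - 2) / (1000 * M ^ 2)) with hedef
  have he0 : 0 < e := lt_min (by norm_num) (div_pos (by linarith) (by positivity))
  have he1 : e ≤ 1 / 1000 := min_le_left _ _
  have he2 : 1000 * M ^ 2 * e ≤ M - 2 := by
    have := (le_div_iff₀ (by positivity)).1 (min_le_right (1 / 1000) ((M - 2) / (1000 * M ^ 2)))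
    linarith
  obtain ⟨ε₀, hε0, hε1, hnear⟩ := exists_nearCircle hCε hper hf (κ := e) he0
  refine ⟨ε₀, e, hε0, hε1, he0, by linarith [Real.pi_gt_three], fun ε ξ₀ ξ₁ hε hξ => ?_⟩
  have hρ := hnear ε hε
  set ρ : ℝ → ℝ := fun ξ => 1 + ε * f ξ ε with hρdef
  have hξ' : |ξ₁ - ξ₀| ≤ e := by rw [abs_sub_comm]; exact hξ.le
  obtain ⟨c, hc1, hc2, hc3⟩ := outer_root_exists hM he0 he1 he2 hρ hξ'
  have hc2' : c < 1 := hc2.trans ((div_lt_one hM0).2 hM)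
  have hcos : Real.cos (ω * (Real.arccos c / ω)) = c := by
    rw [mul_div_cancel₀ _ hω.ne', Real.cos_arccos hc1.le hc2'.le]
  have hT0 : 0 < Real.arccos c / ω := div_pos (Real.arccos_pos.2 hc2') hω
  have hTω : Real.arccos c / ω < Real.pi / ω := by
    refine div_lt_div_of_pos_right (lt_of_le_of_ne (Real.arccos_le_pi c) fun h => ?_) hω
    rw [Real.arccos_eq_pi] at h; linarith
  set T := Real.arccos c / ω with hTdef
  have hsin : Real.sin (ω * T) ≠ 0 := by
    have : ω * T < Real.pi := by rw [lt_div_iff₀ hω] at hTω; linarith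
    exact (Real.sin_pos_of_pos_of_lt_pi (mul_pos hω hT0) this).ne'
  have hroot : M * Real.cos (ω * T) ^ 2
      - 2 * (ρ ξ₀ * ρ ξ₁ * Real.cos (ξ₁ - ξ₀)) * Real.cos (ω * T)
      + ρ ξ₀ ^ 2 + ρ ξ₁ ^ 2 - M = 0 := by rw [hcos]; exact hc3
  refine ⟨T, harmonicOrbit ω T (polarCurve ρ ξ₀) (polarCurve ρ ξ₁), hTω,
    ⟨⟨hT0, harmonicOrbit_zero hsin _ _, harmonicOrbit_self hsin _ _,
      harmonicOrbit_isOuterClassical hω hT0 hTω ?_⟩, fun s hs => ?_⟩, fun z' hz' => ?_,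
      fun T' z' hT' hz' => ?_⟩
  · rw [dot_polarCurve, normSq_polarCurve, normSq_polarCurve]; exact hroot
  · exact outer_arc_outside hM he0 he1 he2 hρ hξ' hω hT0 hTω (by rw [hcos]; exact hc2) hroot hs
  · exact (eqOn_harmonicOrbit hω hT0 hTω hz'.start hz'.finish hz'.classical).1
  · obtain ⟨⟨hp, hst, hfi, hcl⟩, hout⟩ := hz'
    obtain ⟨a1, a2⟩ := eqOn_harmonicOrbit hω hp hT' hst hfi hcl
    have hst' : boundaryCurve f ε ξ₀ = polarCurve ρ ξ₀ := rfl
    have hfi' : boundaryCurve f ε ξ₁ = polarCurve ρ ξ₁ := rfl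
    rw [hst', hfi', dot_polarCurve, normSq_polarCurve, normSq_polarCurve] at a2
    rw [hst', hfi'] at a1
    have hmid : T' / 2 ∈ Ioo 0 T' := ⟨half_pos hp, half_lt_self hp⟩
    have hout' := hout _ hmid
    rw [a1 (Ioo_subset_Icc_self hmid)] at hout'
    -- Of the competing arc only the midpoint is tested: it lies outside the domain, so the cosine
    -- is below 2/M and is the same root. Injectivity of the cosine on [0, π] then gives the same
    -- duration.
    have hlong := cos_lt_of_outside hM he0 he1 he2 hρ hξ' hω hp hT' a2
      (not_lt.1 fun h => hout' (subset_closure h))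
    have hceq := outer_root_unique hM he0 he1 he2 hρ hξ' hlong (by rw [hcos]; exact hc2) a2 hroot
    have hωT' : ω * T' < Real.pi := by rw [lt_div_iff₀ hω] at hT'; linarith
    have hωT : ω * T < Real.pi := by rw [lt_div_iff₀ hω] at hTω; linarith
    have hTT : T' = T := mul_left_cancel₀ hω.ne' (Real.injOn_cos
      ⟨(mul_pos hω hp).le, hωT'.le⟩ ⟨(mul_pos hω hT0).le, hωT.le⟩ hceq)
    refine ⟨hTT, ?_⟩
    rw [← hTT]; exact a1

end RefractionBilliard

end

theorem mainTheorem11 (E h μ ω Cε : ℝ) (hEh : 0 < E + h) (hμ : 0 < μ) (hω : 0 < ω)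
    (hCε : 0 < Cε) (f : ℝ → ℝ → ℝ)
    (hper : ∀ ε ∈ Set.Icc (-Cε) Cε, Function.Periodic (fun ξ => f ξ ε) (2 * Real.pi))
    (hf : ContDiffOn ℝ 2 (fun p : ℝ × ℝ => f p.1 p.2) (Set.univ ×ˢ Set.Icc (-Cε) Cε)) :
    -- inner arcs
    (∃ εI δI C : ℝ, 0 < εI ∧ εI ≤ Cε ∧ 0 < δI ∧ δI ≤ Real.pi ∧ 0 < C ∧
      ∀ ε : ℝ, |ε| < εI →
        ∃ (T : ℝ → ℝ → ℝ) (z : ℝ → ℝ → ℝ → ℂ),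
          (∀ ξ₀ ξ₁ : ℝ, |ξ₀ - ξ₁| < δI →
            RefractionBilliard.IsInnerArc E h μ f ε ξ₀ ξ₁ (T ξ₀ ξ₁) (z ξ₀ ξ₁) ∧
            (∀ (T' : ℝ) (z' : ℝ → ℂ), RefractionBilliard.IsInnerArc E h μ f ε ξ₀ ξ₁ T' z' →
              T' = T ξ₀ ξ₁ ∧ Set.EqOn z' (z ξ₀ ξ₁) (Set.Icc 0 (T ξ₀ ξ₁))) ∧
            InnerProductGeometry.angle (deriv (RefractionBilliard.boundaryCurve f ε) ξ₀)
              (derivWithin (z ξ₀ ξ₁) (Set.Icc 0 (T ξ₀ ξ₁)) 0) ∈ Set.Ioo C (Real.pi - C) ∧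
            InnerProductGeometry.angle (deriv (RefractionBilliard.boundaryCurve f ε) ξ₁)
              (derivWithin (z ξ₀ ξ₁) (Set.Icc 0 (T ξ₀ ξ₁)) (T ξ₀ ξ₁)) ∈ Set.Ioo C (Real.pi - C)) ∧
          RefractionBilliard.IsC1InEndpoints δI T z) ∧
    -- outer arcs
    (ω ^ 2 < E →
      ∃ εE δE : ℝ, 0 < εE ∧ εE ≤ Cε ∧ 0 < δE ∧ δE ≤ Real.pi ∧
        ∀ ε ξ₀ ξ₁ : ℝ, |ε| < εE → |ξ₀ - ξ₁| < δE →
          ∃ (T : ℝ) (z : ℝ → ℂ), T < Real.pi / ω ∧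
            RefractionBilliard.IsOuterArc E ω f ε ξ₀ ξ₁ T z ∧
            (∀ z' : ℝ → ℂ, RefractionBilliard.IsOuterFixedEnds E ω f ε ξ₀ ξ₁ T z' →
              Set.EqOn z' z (Set.Icc 0 T)) ∧
            (∀ (T' : ℝ) (z' : ℝ → ℂ), T' < Real.pi / ω →
              RefractionBilliard.IsOuterArc E ω f ε ξ₀ ξ₁ T' z' →
              T' = T ∧ Set.EqOn z' z (Set.Icc 0 T))) := by
  exact ⟨RefractionBilliard.inner_arcs E h μ Cε hEh hμ hCε f hper hf,
    RefractionBilliard.outer_arcs E ω Cε hω hCε f hper hf⟩
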